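/- Let $m$ be Lebesgue measure on $(0,1)$, and for a measurable $x:(0,1)\to\mathbb R$ let $x^*(t)=\inf\{s\ge 0: m(\{|x|\ge s\})\le t\}$ be its decreasing rearrangement. For $x,y\in L_1(0,1)$ write $y\prec\prec x$ if $\int_0^t y^*(s)\,ds\le\int_0^t x^*(s)\,ds$ for all $t\ge 0$. A symmetric space $E$ on $(0,1)$ is a Banach space of (classes modulo a.e. equality of) real measurable functions on $(0,1)$ such that, for $x\in E$ and measurable $y$: if $|y|\le|x|$ then $y\in E$ and $\|y\|_E\le\|x\|_E$; and if $y^*=x^*$ then $y\in E$ and $\|y\|_E=\|x\|_E$. It is fully symmetric if, moreover, $x\in E$, $y\in L_1(0,1)$ and $y\prec\prec x$ imply $y\in E$ and $\|y\|_E\le\|x\|_E$. One has $E\subseteq L_1(0,1)$. A doubly stochastic operator is a positive linear operator $T$ on $L_1(0,1)$ that is a contraction in $L_1$ and in $L_\infty$ and satisfies $T1=1$ and $\int_0^1 Tf=\int_0^1 f$ for all $f\ge0$. For $0\le x\in L_1(0,1)$ let $\Omega'(x)=\{Tx: T \text{ doubly stochastic}\}$. For $0\le x\in E$ let $Q'(x)$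 be the closure, in the norm of $E$, of the convex hull of the set of extreme points of $\Omega'(x)$. For $\tau>0$ let $(\sigma_\tau x)(s)=x(s/\tau)$ if $s\le\min\{1,\tau\}$ and $(\sigma_\tau x)(s)=0$ if $\tau<s\le1$. Theorem. Let $E$ be a fully symmetric space on $(0,1)$ and let $0\le x\in E$. Then the limit $$\varphi(x)=\lim_{\tau\to\infty}\frac1\tau\,\|\sigma_\tau(x^*)\|_E$$ exists and is finite, and $\Omega'(x)=Q'(x)$ if and only if $\varphi(x)=0$. -/

import Mathlib

open MeasureTheory Set Filter Topology
open scoped ENNReal NNReal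

namespace FullySymm

/-- Lebesgue measure on the interval `(0,1)`. -/
noncomputable abbrev leb : Measure ℝ := volume.restrict (Ioo (0 : ℝ) 1)

/-- `L₀(0,1)`: a.e.-classes of real-valued Lebesgue measurable functions on `(0,1)`. -/
abbrev L0 : Type := ℝ →ₘ[leb] ℝ

/-- The decreasing rearrangement `x*(t) = inf {s ≥ 0 : m{|x| ≥ s} ≤ t}`, as a function of
`t > 0`. -/
noncomputable def rearr (x : L0) (t : ℝ) : ℝ :=
  sInf {s : ℝ | 0 ≤ s ∧ leb {w | s ≤ |x w|} ≤ ENNReal.ofReal t}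

theorem rearr_set_nonempty (x : L0) {t : ℝ} (ht : 0 < t) :
    {s : ℝ | 0 ≤ s ∧ leb {w | s ≤ |x w|} ≤ ENNReal.ofReal t}.Nonempty := by
  have hmeas : Measurable (fun w => |x w|) := (x.stronglyMeasurable.measurable).abs
  have hT : Tendsto (fun n : ℕ => leb {w | (n : ℝ) ≤ |x w|}) atTop
      (𝓝 (leb (⋂ n : ℕ, {w | (n : ℝ) ≤ |x w|}))) := by
    refine tendsto_measure_iInter_atTop
      (fun n => (measurableSet_le measurable_const hmeas).nullMeasurableSet) ?_
      ⟨0, measure_ne_top _ _⟩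
    intro a b hab w hw
    have hw' : (b : ℝ) ≤ |x w| := hw
    exact le_trans (Nat.cast_le.mpr hab) hw'
  have hE : (⋂ n : ℕ, {w | (n : ℝ) ≤ |x w|}) = ∅ := by
    ext w
    simp only [mem_iInter, mem_ofPred_eq, mem_empty_iff_false, iff_false, not_forall, not_le]
    exact exists_nat_gt _
  rw [hE, measure_empty] at hT
  have hev := hT.eventually (gt_mem_nhds (ENNReal.ofReal_pos.mpr ht))
  obtain ⟨n, hn⟩ := hev.exists
  exact ⟨n, Nat.cast_nonneg n, hn.le⟩

theorem rearr_antitoneOn (x : L0) : AntitoneOn (rearr x) (Ioo 0 1) := by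
  intro a ha b _ hab
  refine csInf_le_csInf ⟨0, fun s hs => hs.1⟩ (rearr_set_nonempty x ha.1) ?_
  intro s hs
  exact ⟨hs.1, hs.2.trans (ENNReal.ofReal_le_ofReal hab)⟩

theorem rearr_aestronglyMeasurable (x : L0) : AEStronglyMeasurable (rearr x) leb :=
  (aemeasurable_restrict_of_antitoneOn measurableSet_Ioo
    (rearr_antitoneOn x)).aestronglyMeasurable

/-- `x*` as an element of `L₀(0,1)`. -/
noncomputable def rearrangement (x : L0) : L0 :=
  AEEqFun.mk (rearr x) (rearr_aestronglyMeasurable x)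

/-- `y* = x*`. -/
def SameRearr (y x : L0) : Prop := ∀ t ∈ Ioo (0 : ℝ) 1, rearr y t = rearr x t

/-- Hardy–Littlewood–Pólya submajorization `y ≺≺ x`. -/
def Submajorized (y x : L0) : Prop :=
  ∀ t : ℝ, 0 ≤ t →
    ∫⁻ s in Ioo 0 t, ENNReal.ofReal (rearr y s) ≤ ∫⁻ s in Ioo 0 t, ENNReal.ofReal (rearr x s)

theorem dilation_aux (τ : ℝ) (x : L0) : AEStronglyMeasurable
    ((Iic (min 1 τ)).indicator (fun s : ℝ => x (s / τ))) leb :=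
  ((x.stronglyMeasurable.comp_measurable (measurable_id.div_const τ)).indicator
    measurableSet_Iic).aestronglyMeasurable

/-- The dilation operator: `(σ_τ x)(s) = x(s/τ)` for `s ≤ min(1,τ)`, and `0` otherwise. -/
noncomputable def dilation (τ : ℝ) (x : L0) : L0 :=
  AEEqFun.mk ((Iic (min 1 τ)).indicator (fun s : ℝ => x (s / τ))) (dilation_aux τ x)

/-- A Banach ideal lattice on `(0,1)`: a linear space of measurable functions, complete under a
norm, such that `x ∈ E` and `|y| ≤ |x|` imply `y ∈ E` and `‖y‖ ≤ ‖x‖`. -/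
structure BanachIdealLattice where
  carrier : Submodule ℝ L0
  /-- a norm on the additive group `E`: subadditive, even, vanishing exactly at `0` -/
  norm : AddGroupNorm carrier
  norm_smul : ∀ (c : ℝ) (x : carrier), norm (c • x) = |c| * norm x
  complete : ∀ u : ℕ → carrier,
    (∀ ε > 0, ∃ N : ℕ, ∀ m ≥ N, ∀ n ≥ N, norm (u m - u n) < ε) →
      ∃ l : carrier, Tendsto (fun n => norm (u n - l)) atTop (𝓝 0)
  solid : ∀ (x : carrier) (y : L0), |y| ≤ |(x : L0)| → ∃ h : y ∈ carrier, norm ⟨y, h⟩ ≤ norm x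

/-- A symmetric space on `(0,1)`. -/
structure SymmetricSpace extends BanachIdealLattice where
  symmetric : ∀ (x : carrier) (y : L0), SameRearr y x →
    ∃ h : y ∈ carrier, norm ⟨y, h⟩ = norm x

namespace SymmetricSpace

/-- The norm topology of `E` comes from this instance. -/
noncomputable instance (E : SymmetricSpace) : NormedAddCommGroup E.carrier :=
  E.norm.toNormedAddCommGroup

noncomputable instance (E : SymmetricSpace) : NormedSpace ℝ E.carrier where
  norm_smul_le c x := (E.norm_smul c x).le

open Classical in
/-- The norm of `E` extended by `∞` outside `E`. -/
noncomputable def extNorm (E : SymmetricSpace) (y : L0) : ℝ≥0∞ :=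
  if h : y ∈ E.carrier then ENNReal.ofReal (E.norm ⟨y, h⟩) else ⊤

/-- `E` is fully symmetric (note that `L₁ + L_∞ = L₁` on `(0,1)`). -/
def IsFullySymmetric (E : SymmetricSpace) : Prop :=
  ∀ (x : E.carrier) (y : L0), y.Integrable → Submajorized y x →
    ∃ h : y ∈ E.carrier, E.norm ⟨y, h⟩ ≤ E.norm x

end SymmetricSpace

/-- Doubly stochastic operators on `L₁(0,1)` (note that `L₁ + L_∞ = L₁` on `(0,1)`). -/
structure IsDoublyStochastic (T : Lp ℝ 1 leb →L[ℝ] Lp ℝ 1 leb) : Prop where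
  /-- contraction in `L₁` -/
  norm_le : ∀ f, ‖T f‖ ≤ ‖f‖
  /-- contraction in `L_∞` (no condition if `f` is not in `L_∞`) -/
  norm_top_le : ∀ f, eLpNorm (T f) ∞ leb ≤ eLpNorm f ∞ leb
  nonneg : ∀ f, 0 ≤ f → 0 ≤ T f
  integral_eq : ∀ f, 0 ≤ f → ∫ s, T f s ∂leb = ∫ s, f s ∂leb
  map_one : T (Lp.const 1 leb (1 : ℝ)) = Lp.const 1 leb (1 : ℝ)

/-- The orbit `Ω'(x)` of `x ∈ L₁(0,1)` under the doubly stochastic operators. -/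
def orbit (x : L0) : Set L0 :=
  {y | ∃ f : Lp ℝ 1 leb, (f : L0) = x ∧
    ∃ T : Lp ℝ 1 leb →L[ℝ] Lp ℝ 1 leb, IsDoublyStochastic T ∧ y = (T f : L0)}

/-- `Q'(x)`: the closure, in the norm of `E`, of the convex hull of the extreme points of
`Ω'(x)`. -/
def Qprime (E : SymmetricSpace) (x : L0) : Set L0 :=
  Subtype.val '' closure
    {z : E.carrier | (z : L0) ∈ convexHull ℝ ((orbit x).extremePoints ℝ)}

end FullySymm

/-! The argument rests on one duality: `headInt x t` is the minimum over r ≥ 0 of `tailInt x r` + r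
t. Submajorization therefore follows from an inequality between the integrals ∫ (|x| - r)₊, and
replacing r by n r there corresponds to replacing t by t/n in ∫₀ᵗ x*. Since ∫₀ᵗ of (1/τ) σ_τ x* is
∫₀ x* up to t/τ, the functions `scaledDilation τ x` decrease in the submajorization order for τ ≥ 1,
and the limit φ(x) exists by monotonicity.

Suppose φ(x) = 0 and y ≺ x. Cut (0,1) along the level bands of y of height δ, and cut x* into
windows, one for each band, with the length of the band and the mean of y* over the matching
interval (`Decr.exists_windows`). On a window, the average of n cyclic rotations is close to the
mean (`Decr.exists_average`). After gluing, y differs from an average of n functions equimeasurable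
with x by at most δ + e + d, where e and d are submajorized by (1/n) σ_n x*
(`Majorized.exists_convexHull`). Such equimeasurable functions are extreme
(`mem_extremePoints_of_map_eq`), and the E-norm of the error is controlled by a multiple of δ and
twice the norm of (1/n) σ_n x*. The same approximation in L₁ proves Ryff's theorem that y ≺ x
implies y ∈ Ω'(x), because orbits are L₁-closed by weak compactness of the doubly stochastic
operators. That closedness also gives Q'(x) ⊆ Ω'(x), as E embeds continuously in L₁.

Conversely, an extreme point has the truncation integrals of x (`tailInt_eq_of_mem_extremePoints`):
at a level where they differ, z could be perturbed in both directions. A convex combination z of n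
extreme points then satisfies ∫ (z - r)₊ ≥ ∫ (x - n r)₊. Hence (1/τ) σ_τ x* is submajorized by |z -
c| + (n/τ) c for any constant c ≥ 0, and letting τ → ∞ gives ‖z - c‖ ≥ φ(x) whatever n was
(`le_extNorm_sub`). The mean value of x lies in Ω'(x), so it belongs to Q'(x) only if φ(x) = 0. -/

namespace FullySymm

/-! ### Rearrangements, and the duality between head and tail integrals. -/

/-- `∫ (|x| - r)₊`. -/
noncomputable def tailInt (x : L0) (r : ℝ) : ℝ≥0∞ := ∫⁻ w, ENNReal.ofReal (|x w| - r) ∂leb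

/-- `∫₀ᵗ x*`. -/
noncomputable def headInt (x : L0) (t : ℝ) : ℝ≥0∞ :=
  ∫⁻ s in Ioo 0 t, ENNReal.ofReal (rearr x s)

theorem L0.measurable (x : L0) : Measurable x := x.stronglyMeasurable.measurable

theorem leb_univ : leb univ = 1 := by simp [leb]

theorem leb_le_one (s : Set ℝ) : leb s ≤ 1 := leb_univ ▸ measure_mono (subset_univ s)

instance : IsProbabilityMeasure leb := ⟨leb_univ⟩

theorem rearr_nonneg (x : L0) (t : ℝ) : 0 ≤ rearr x t := Real.sInf_nonneg fun _ h => h.1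

theorem rearr_of_one_le (x : L0) {t : ℝ} (ht : 1 ≤ t) : rearr x t = 0 := by
  refine le_antisymm (csInf_le ⟨0, fun s hs => hs.1⟩ ⟨le_rfl, ?_⟩) (rearr_nonneg x t)
  exact (leb_le_one _).trans (by simpa using ENNReal.ofReal_le_ofReal ht)

/-- The strict level set at r is exhausted by the non-strict ones at r + 1/(n+1), so the infimum
reduces to a condition on a single set. This makes x* the generalized inverse of the distribution
function. -/
theorem rearr_le_iff (x : L0) {r t : ℝ} (hr : 0 ≤ r) (ht : 0 < t) :
    rearr x t ≤ r ↔ leb {w | r < |x w|} ≤ ENNReal.ofReal t := by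
  constructor
  · intro h
    have hU : {w | r < |x w|} = ⋃ n : ℕ, {w | r + 1 / ((n : ℝ) + 1) ≤ |x w|} := by
      ext w
      simp only [mem_ofPred_eq, mem_iUnion]
      constructor
      · intro hw
        obtain ⟨n, hn⟩ := exists_nat_one_div_lt (sub_pos.2 hw)
        exact ⟨n, by linarith⟩
      · rintro ⟨n, hn⟩
        have : (0 : ℝ) < 1 / ((n : ℝ) + 1) := by positivity
        linarith
    have hm : Monotone fun n : ℕ => {w | r + 1 / ((n : ℝ) + 1) ≤ |x w|} := by
      intro a b hab w hw
      have hw' : r + 1 / ((a : ℝ) + 1) ≤ |x w| := hw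
      have : 1 / ((b : ℝ) + 1) ≤ 1 / ((a : ℝ) + 1) := by
        apply one_div_le_one_div_of_le (by positivity)
        have : (a : ℝ) ≤ b := Nat.cast_le.2 hab
        linarith
      change r + 1 / ((b : ℝ) + 1) ≤ |x w|
      linarith
    rw [hU, hm.measure_iUnion]
    refine iSup_le fun n => ?_
    have hn : (0 : ℝ) < 1 / ((n : ℝ) + 1) := by positivity
    obtain ⟨s, hs, hs'⟩ := exists_lt_of_csInf_lt (rearr_set_nonempty x ht)
      (lt_of_le_of_lt h (lt_add_of_pos_right r hn))
    exact (measure_mono fun w (hw : _ ≤ _) => hs'.le.trans hw).trans hs.2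
  · intro h
    refine le_of_forall_gt fun s hs => ?_
    obtain ⟨s', h1, h2⟩ := exists_between hs
    refine lt_of_le_of_lt (csInf_le ⟨0, fun s hs => hs.1⟩ ⟨hr.trans h1.le, ?_⟩) h2
    exact (measure_mono fun w (hw : _ ≤ _) => h1.trans_le hw).trans h

theorem lt_rearr_iff (x : L0) {r t : ℝ} (hr : 0 ≤ r) (ht : 0 < t) :
    r < rearr x t ↔ ENNReal.ofReal t < leb {w | r < |x w|} := by
  rw [← not_le, rearr_le_iff x hr ht, not_le]

theorem leb_lt_rearr (x : L0) {r : ℝ} (hr : 0 ≤ r) :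
    leb {t | r < rearr x t} = leb {w | r < |x w|} := by
  set m := leb {w | r < |x w|} with hm
  have hm1 : m ≤ 1 := leb_le_one _
  have hmt : m ≠ ⊤ := ne_top_of_le_ne_top ENNReal.one_ne_top hm1
  have : {t | r < rearr x t} ∩ Ioo 0 1 = Ioo 0 m.toReal := by
    ext t
    simp only [mem_inter_iff, mem_ofPred_eq, mem_Ioo]
    constructor
    · rintro ⟨h, h0, h1⟩
      rw [lt_rearr_iff x hr h0, ← hm] at h
      exact ⟨h0, (ENNReal.ofReal_lt_iff_lt_toReal h0.le hmt).1 h⟩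
    · rintro ⟨h0, h⟩
      refine ⟨?_, h0, h.trans_le ?_⟩
      · rw [lt_rearr_iff x hr h0, ← hm]
        exact (ENNReal.ofReal_lt_iff_lt_toReal h0.le hmt).2 h
      · exact ENNReal.toReal_le_of_le_ofReal zero_le_one (by simpa using hm1)
  rw [leb, Measure.restrict_apply' measurableSet_Ioo, this]
  simp [hmt]

theorem aemeasurable_rearr (x : L0) : AEMeasurable (rearr x) leb :=
  (rearr_aestronglyMeasurable x).aemeasurable

/-- Both laws are probability measures with the same mass on every open upper half-line. It
transfers integrals of functions of |x| to x*. -/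
theorem map_rearr (x : L0) : leb.map (rearr x) = leb.map (fun w => |x w|) := by
  have hx : Measurable (fun w => |x w|) := x.measurable.abs
  have : IsProbabilityMeasure (leb.map (rearr x)) :=
    Measure.isProbabilityMeasure_map (aemeasurable_rearr x)
  have : IsProbabilityMeasure (leb.map (fun w => |x w|)) :=
    Measure.isProbabilityMeasure_map hx.aemeasurable
  refine Measure.ext_of_Iic _ _ fun r => ?_
  rw [← compl_Ioi, prob_compl_eq_one_sub measurableSet_Ioi,
    prob_compl_eq_one_sub measurableSet_Ioi]
  congr 1
  rw [Measure.map_apply_of_aemeasurable (aemeasurable_rearr x) measurableSet_Ioi,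
    Measure.map_apply hx measurableSet_Ioi]
  rcases lt_or_ge r 0 with hr | hr
  · have h1 : rearr x ⁻¹' Ioi r = univ := by
      ext t; simpa using hr.trans_le (rearr_nonneg x t)
    have h2 : (fun w => |x w|) ⁻¹' Ioi r = univ := by
      ext t; simpa using hr.trans_le (abs_nonneg _)
    rw [h1, h2]
  · exact leb_lt_rearr x hr

theorem lintegral_comp_rearr (x : L0) {φ : ℝ → ℝ≥0∞} (hφ : Measurable φ) :
    ∫⁻ t, φ (rearr x t) ∂leb = ∫⁻ w, φ |x w| ∂leb := by
  rw [← lintegral_map' hφ.aemeasurable (aemeasurable_rearr x), map_rearr,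
    lintegral_map hφ x.measurable.abs]

theorem tailInt_eq_rearr (x : L0) (r : ℝ) :
    tailInt x r = ∫⁻ t in Ioo 0 1, ENNReal.ofReal (rearr x t - r) :=
  (lintegral_comp_rearr x (φ := fun v => ENNReal.ofReal (v - r)) (by fun_prop)).symm

theorem rearr_antitoneOn_Ioi (x : L0) : AntitoneOn (rearr x) (Ioi 0) := by
  intro a ha b _ hab
  refine csInf_le_csInf ⟨0, fun s hs => hs.1⟩ (rearr_set_nonempty x ha) ?_
  intro s hs
  exact ⟨hs.1, hs.2.trans (ENNReal.ofReal_le_ofReal hab)⟩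

theorem headInt_of_one_le (x : L0) {t : ℝ} (ht : 1 ≤ t) : headInt x t = headInt x 1 := by
  have : Ioo 0 t = Ioo 0 1 ∪ Ico 1 t := by
    ext s; simp only [mem_Ioo, mem_union, mem_Ico]
    constructor
    · rintro ⟨h0, h1⟩
      rcases lt_or_ge s 1 with h | h
      · exact Or.inl ⟨h0, h⟩
      · exact Or.inr ⟨h, h1⟩
    · rintro (⟨h0, h1⟩ | ⟨h0, h1⟩)
      · exact ⟨h0, h1.trans_le ht⟩
      · exact ⟨zero_lt_one.trans_le h0, h1⟩
  rw [headInt, this, lintegral_union measurableSet_Ico]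
  · rw [setLIntegral_congr_fun (g := fun _ => 0) measurableSet_Ico
      (fun s hs => by simp [rearr_of_one_le x hs.1])]
    simp [headInt]
  · rw [Set.disjoint_left]
    rintro s ⟨_, h⟩ ⟨h', _⟩
    exact absurd h (not_lt.2 h')

/-- The upper estimate of `∫₀ᵗ g` by truncations. -/
theorem lintegral_Ioo_le_trunc {g : ℝ → ℝ} {r t : ℝ} (hr : 0 ≤ r) (ht1 : t ≤ 1) :
    ∫⁻ s in Ioo 0 t, ENNReal.ofReal (g s)
      ≤ (∫⁻ s in Ioo 0 1, ENNReal.ofReal (g s - r)) + ENNReal.ofReal (r * t) := by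
  calc ∫⁻ s in Ioo 0 t, ENNReal.ofReal (g s)
      ≤ ∫⁻ s in Ioo 0 t, (ENNReal.ofReal (g s - r) + ENNReal.ofReal r) := by
        refine lintegral_mono fun s => ?_
        have : g s = (g s - r) + r := by ring
        conv_lhs => rw [this]
        exact ENNReal.ofReal_add_le
    _ = (∫⁻ s in Ioo 0 t, ENNReal.ofReal (g s - r)) + ENNReal.ofReal (r * t) := by
        rw [lintegral_add_right _ measurable_const]
        simp [ENNReal.ofReal_mul hr]
    _ ≤ _ := by
        gcongr

/-- For an antitone function the estimate `lintegral_Ioo_le_trunc` is attained. -/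
theorem trunc_eq_lintegral_Ioo {g : ℝ → ℝ} (hg : AntitoneOn g (Ioo 0 1)) (h0 : ∀ t, 0 ≤ g t)
    {t : ℝ} (ht : 0 < t) (ht1 : t < 1) :
    (∫⁻ s in Ioo 0 1, ENNReal.ofReal (g s - g t)) + ENNReal.ofReal (g t * t)
      = ∫⁻ s in Ioo 0 t, ENNReal.ofReal (g s) := by
  have hsplit : Ioo (0 : ℝ) 1 = Ioo 0 t ∪ Ico t 1 := by
    rw [Ioo_union_Ico_eq_Ioo ht ht1.le]
  have hd : Disjoint (Ioo (0 : ℝ) t) (Ico t 1) := by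
    rw [Set.disjoint_left]
    rintro s ⟨_, h⟩ ⟨h', _⟩
    exact absurd h (not_lt.2 h')
  rw [hsplit, lintegral_union measurableSet_Ico hd,
    setLIntegral_congr_fun (s := Ico t 1) (g := fun _ => 0) measurableSet_Ico (fun s hs => by
      have := hg ⟨ht, ht1⟩ ⟨ht.trans_le hs.1, hs.2⟩ hs.1
      simpa using this)]
  have : ENNReal.ofReal (g t * t) = ∫⁻ s in Ioo 0 t, ENNReal.ofReal (g t) := by
    simp [ENNReal.ofReal_mul (h0 t)]
  rw [this, lintegral_zero, add_zero, ← lintegral_add_right _ measurable_const]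
  refine setLIntegral_congr_fun measurableSet_Ioo fun s hs => ?_
  have := hg ⟨hs.1, hs.2.trans ht1⟩ ⟨ht, ht1⟩ hs.2.le
  rw [← ENNReal.ofReal_add (by linarith) (h0 t)]
  congr 1; ring

/-- One half of the duality; `exists_headInt_eq` shows that some r attains it. -/
theorem headInt_le (x : L0) {r t : ℝ} (hr : 0 ≤ r) :
    headInt x t ≤ tailInt x r + ENNReal.ofReal (r * t) := by
  rw [tailInt_eq_rearr]
  rcases le_total t 1 with h | h
  · exact lintegral_Ioo_le_trunc hr h
  · rw [headInt_of_one_le x h]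
    refine (lintegral_Ioo_le_trunc hr le_rfl).trans ?_
    gcongr

theorem headInt_one (x : L0) : headInt x 1 = tailInt x 0 := by
  rw [tailInt_eq_rearr, headInt]; simp

/-- The minimizer is r = x*(t) for t < 1, and r = 0 once t ≥ 1. -/
theorem exists_headInt_eq (x : L0) {t : ℝ} (ht : 0 < t) :
    ∃ r, 0 ≤ r ∧ headInt x t = tailInt x r + ENNReal.ofReal (r * t) := by
  rcases lt_or_ge t 1 with h | h
  · refine ⟨rearr x t, rearr_nonneg x t, ?_⟩
    rw [tailInt_eq_rearr, trunc_eq_lintegral_Ioo (rearr_antitoneOn x) (rearr_nonneg x) ht h,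
      headInt]
  · exact ⟨0, le_rfl, by simp [headInt_of_one_le x h, headInt_one]⟩

theorem headInt_zero (x : L0) : headInt x 0 = 0 := by simp [headInt]

theorem submajorized_of_headInt {x y : L0}
    (h : ∀ t, 0 < t → t ≤ 1 → headInt y t ≤ headInt x t) : Submajorized y x := by
  intro t ht
  change headInt y t ≤ headInt x t
  rcases ht.eq_or_lt with rfl | ht
  · simp [headInt_zero]
  rcases le_total t 1 with h1 | h1
  · exact h t ht h1
  · rw [headInt_of_one_le x h1, headInt_of_one_le y h1]
    exact h 1 one_pos le_rfl

theorem submajorized_of_tailInt {x y : L0} (h : ∀ r, 0 ≤ r → tailInt y r ≤ tailInt x r) :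
    Submajorized y x := by
  refine submajorized_of_headInt fun t ht _ => ?_
  obtain ⟨r, hr, e⟩ := exists_headInt_eq x ht
  rw [e]
  exact (headInt_le y hr).trans (by gcongr; exact h r hr)

/-- A decreasing function on `(0,1)` is its own rearrangement, as far as integrals are
concerned. -/
theorem headInt_of_antitone {x : L0} {g : ℝ → ℝ} (hg : AntitoneOn g (Ioo 0 1))
    (h0 : ∀ t, 0 ≤ g t) (hx : x =ᵐ[leb] g) {t : ℝ} (ht : 0 < t) (ht1 : t ≤ 1) :
    headInt x t = ∫⁻ s in Ioo 0 t, ENNReal.ofReal (g s) := by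
  have key : ∀ r, tailInt x r = ∫⁻ s in Ioo 0 1, ENNReal.ofReal (g s - r) := fun r => by
    refine lintegral_congr_ae (hx.mono fun w hw => ?_)
    simp only [hw, abs_of_nonneg (h0 w)]
  rcases ht1.eq_or_lt with rfl | ht1
  · rw [headInt_one, key]
    simp
  apply le_antisymm
  · refine (headInt_le x (h0 t)).trans ?_
    rw [key, trunc_eq_lintegral_Ioo hg h0 ht ht1]
  · obtain ⟨r, hr, e⟩ := exists_headInt_eq x ht
    rw [e, key]
    exact lintegral_Ioo_le_trunc hr ht1.le

theorem tailInt_zero (x : L0) : tailInt x 0 = ∫⁻ w, ENNReal.ofReal |x w| ∂leb := by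
  simp [tailInt]

theorem integrable_iff_tailInt (x : L0) : x.Integrable ↔ tailInt x 0 ≠ ⊤ := by
  rw [tailInt_zero, AEEqFun.Integrable, ← lt_top_iff_ne_top]
  simp only [Integrable, x.aestronglyMeasurable, true_and, HasFiniteIntegral, ← Real.norm_eq_abs,
    ofReal_norm]

theorem tailInt_anti (x : L0) {r s : ℝ} (h : r ≤ s) : tailInt x s ≤ tailInt x r :=
  lintegral_mono fun w => ENNReal.ofReal_le_ofReal (by linarith)

theorem tailInt_ne_top {x : L0} (hx : x.Integrable) {r : ℝ} (hr : 0 ≤ r) : tailInt x r ≠ ⊤ :=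
  ne_top_of_le_ne_top ((integrable_iff_tailInt x).1 hx) (tailInt_anti x hr)

end FullySymm

/-! ### Doubly stochastic operators and majorization. -/

namespace FullySymm

section orbit

variable {T : Lp ℝ 1 leb →L[ℝ] Lp ℝ 1 leb}

theorem IsDoublyStochastic.mono (hT : IsDoublyStochastic T) {f g : Lp ℝ 1 leb} (h : f ≤ g) :
    T f ≤ T g := by
  have := hT.nonneg (g - f) (sub_nonneg.2 h)
  rw [map_sub] at this
  exact sub_nonneg.1 this

theorem Lp_const_eq_smul (r : ℝ) : Lp.const 1 leb r = r • Lp.const 1 leb (1 : ℝ) := by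
  have := (Lp.constₗ 1 leb ℝ (E := ℝ)).map_smul r 1
  simpa using this

theorem IsDoublyStochastic.map_const (hT : IsDoublyStochastic T) (r : ℝ) :
    T (Lp.const 1 leb r) = Lp.const 1 leb r := by
  rw [Lp_const_eq_smul, map_smul, hT.map_one]

theorem lintegral_ofReal_Lp (f : Lp ℝ 1 leb) (hf : 0 ≤ f) :
    ∫⁻ s, ENNReal.ofReal (f s) ∂leb = ENNReal.ofReal (∫ s, f s ∂leb) :=
  (ofReal_integral_eq_lintegral_ofReal (L1.integrable_coeFn f) ((Lp.coeFn_nonneg f).2 hf)).symm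

theorem Lp_coe_nonneg {f : Lp ℝ 1 leb} : 0 ≤ (f : L0) ↔ 0 ≤ f := Iff.rfl

theorem L0_nonneg_ae {x : L0} (hx : 0 ≤ x) : ∀ᵐ s ∂leb, 0 ≤ x s := by
  filter_upwards [AEEqFun.coeFn_le.2 hx, AEEqFun.coeFn_zero (μ := leb) (β := ℝ)] with s h h0
  simpa [h0] using h

theorem L0_nonneg_of_ae {x : L0} (hx : ∀ᵐ s ∂leb, 0 ≤ x s) : 0 ≤ x := by
  rw [← AEEqFun.coeFn_le]
  filter_upwards [hx, AEEqFun.coeFn_zero (μ := leb) (β := ℝ)] with s h h0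
  simpa [h0] using h

theorem tailInt_of_nonneg {x : L0} (hx : 0 ≤ x) (r : ℝ) :
    tailInt x r = ∫⁻ s, ENNReal.ofReal (x s - r) ∂leb := by
  refine lintegral_congr_ae ?_
  filter_upwards [L0_nonneg_ae hx] with s hs
  rw [abs_of_nonneg hs]

theorem Lp_integrable (f : Lp ℝ 1 leb) : (f : L0).Integrable := L1.integrable_coeFn f

/-- Doubly stochastic operators decrease `∫ (f - r)₊`. -/
theorem IsDoublyStochastic.tailInt_le (hT : IsDoublyStochastic T) {f : Lp ℝ 1 leb} (hf : 0 ≤ f)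
    {r : ℝ} : tailInt (T f : L0) r ≤ tailInt (f : L0) r := by
  rw [tailInt_of_nonneg (Lp_coe_nonneg.2 (hT.nonneg f hf)), tailInt_of_nonneg (Lp_coe_nonneg.2 hf)]
  -- As T fixes constants and is positive, T f - r = T (f - r) ≤ T ((f - r)₊), and T preserves the
  -- integral of the nonnegative function (f - r)₊.
  set g : Lp ℝ 1 leb := (f - Lp.const 1 leb r) ⊔ 0 with hg
  have hg0 : 0 ≤ g := le_sup_right
  have hTg : T f - Lp.const 1 leb r ≤ T g := by
    rw [← hT.map_const r, ← map_sub]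
    exact hT.mono le_sup_left
  have hTg0 : 0 ≤ T g := hT.nonneg g hg0
  calc ∫⁻ s, ENNReal.ofReal ((T f : L0) s - r) ∂leb
      ≤ ∫⁻ s, ENNReal.ofReal (T g s) ∂leb := by
        refine lintegral_mono_ae ?_
        filter_upwards [Lp.coeFn_sub (T f) (Lp.const 1 leb r), (Lp.coeFn_le _ _).2 hTg,
          Lp.coeFn_const (μ := leb) 1 r] with s h1 h2 h3
        apply ENNReal.ofReal_le_ofReal
        rw [h1, Pi.sub_apply, h3] at h2
        simpa using h2
    _ = ∫⁻ s, ENNReal.ofReal (g s) ∂leb := by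
        rw [lintegral_ofReal_Lp _ hTg0, lintegral_ofReal_Lp _ hg0, hT.integral_eq _ hg0]
    _ = ∫⁻ s, ENNReal.ofReal ((f : L0) s - r) ∂leb := by
        refine lintegral_congr_ae ?_
        filter_upwards [Lp.coeFn_sup (f - Lp.const 1 leb r) 0,
          Lp.coeFn_sub f (Lp.const 1 leb r), Lp.coeFn_const (μ := leb) 1 r,
          Lp.coeFn_zero ℝ 1 leb] with s h1 h2 h3 h4
        rw [hg, h1, Pi.sup_apply, h2, h4, Pi.sub_apply, h3]
        rcases le_total 0 (f s - r) with h | h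
        · simp
        · simp

/-- `y ≺ x` for nonnegative integrable functions. -/
structure Majorized (y x : L0) : Prop where
  nonneg : 0 ≤ y
  integrable : y.Integrable
  zero_eq : tailInt y 0 = tailInt x 0
  tailInt_le : ∀ r, 0 ≤ r → tailInt y r ≤ tailInt x r

theorem Majorized.submajorized {y x : L0} (h : Majorized y x) : Submajorized y x :=
  submajorized_of_tailInt h.tailInt_le

theorem majorized_of_mem_orbit {x y : L0} (hx : 0 ≤ x) (hy : y ∈ orbit x) : Majorized y x := by
  obtain ⟨f, rfl, T, hT, rfl⟩ := hy
  have hf : 0 ≤ f := hx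
  refine ⟨hT.nonneg f hf, Lp_integrable _, ?_, fun r _ => hT.tailInt_le hf⟩
  rw [tailInt_of_nonneg (Lp_coe_nonneg.2 (hT.nonneg f hf)),
    tailInt_of_nonneg (Lp_coe_nonneg.2 hf)]
  simp only [sub_zero]
  rw [lintegral_ofReal_Lp _ (hT.nonneg f hf), lintegral_ofReal_Lp _ hf, hT.integral_eq f hf]

end orbit

theorem Lp_smul_nonneg {a : ℝ} (ha : 0 ≤ a) {f : Lp ℝ 1 leb} (hf : 0 ≤ f) : 0 ≤ a • f := by
  rw [← Lp.coeFn_nonneg] at hf ⊢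
  filter_upwards [hf, Lp.coeFn_smul a f] with s h h'
  rw [h']
  exact mul_nonneg ha h

theorem convex_isDoublyStochastic :
    Convex ℝ {T : Lp ℝ 1 leb →L[ℝ] Lp ℝ 1 leb | IsDoublyStochastic T} := by
  intro S hS T hT a b ha hb hab
  simp only [mem_ofPred_eq] at hS hT ⊢
  refine ⟨fun f => ?_, fun f => ?_, fun f hf => ?_, fun f hf => ?_, ?_⟩
  · calc ‖a • S f + b • T f‖ ≤ ‖a • S f‖ + ‖b • T f‖ := norm_add_le _ _
      _ = a * ‖S f‖ + b * ‖T f‖ := by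
        rw [norm_smul, norm_smul, Real.norm_of_nonneg ha, Real.norm_of_nonneg hb]
      _ ≤ a * ‖f‖ + b * ‖f‖ := by gcongr; exacts [hS.norm_le f, hT.norm_le f]
      _ = ‖f‖ := by rw [← add_mul, hab, one_mul]
  · have e : ((a • S + b • T) f : ℝ → ℝ) =ᵐ[leb] a • (S f : ℝ → ℝ) + b • (T f : ℝ → ℝ) := by
      change ((a • S f + b • T f : Lp ℝ 1 leb) : ℝ → ℝ) =ᵐ[leb] _
      filter_upwards [Lp.coeFn_add (a • S f) (b • T f), Lp.coeFn_smul a (S f),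
        Lp.coeFn_smul b (T f)] with s h1 h2 h3
      rw [h1, Pi.add_apply, h2, h3]; rfl
    rw [eLpNorm_congr_ae e]
    refine (eLpNorm_add_le ((Lp.aestronglyMeasurable _).const_smul _)
      ((Lp.aestronglyMeasurable _).const_smul _) le_top).trans ?_
    rw [eLpNorm_const_smul, eLpNorm_const_smul]
    calc _ ≤ ‖a‖ₑ * eLpNorm f ∞ leb + ‖b‖ₑ * eLpNorm f ∞ leb := by
          gcongr; exacts [hS.norm_top_le f, hT.norm_top_le f]
      _ = _ := by
        rw [← add_mul, Real.enorm_of_nonneg ha, Real.enorm_of_nonneg hb,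
          ← ENNReal.ofReal_add ha hb, hab]
        simp
  · exact add_nonneg (Lp_smul_nonneg ha (hS.nonneg f hf)) (Lp_smul_nonneg hb (hT.nonneg f hf))
  · have e : ((a • S + b • T) f : ℝ → ℝ) =ᵐ[leb] fun s => a * S f s + b * T f s := by
      change ((a • S f + b • T f : Lp ℝ 1 leb) : ℝ → ℝ) =ᵐ[leb] _
      filter_upwards [Lp.coeFn_add (a • S f) (b • T f), Lp.coeFn_smul a (S f),
        Lp.coeFn_smul b (T f)] with s h1 h2 h3
      rw [h1, Pi.add_apply, h2, h3]; rfl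
    rw [integral_congr_ae e, integral_add ((L1.integrable_coeFn _).const_mul _)
      ((L1.integrable_coeFn _).const_mul _), integral_const_mul, integral_const_mul,
      hS.integral_eq f hf, hT.integral_eq f hf, ← add_mul, hab, one_mul]
  · change a • S _ + b • T _ = _
    rw [hS.map_one, hT.map_one, ← add_smul, hab, one_smul]

theorem convex_orbit (x : L0) : Convex ℝ (orbit x) := by
  rintro _ ⟨f, hf, S, hS, rfl⟩ _ ⟨g, hg, T, hT, rfl⟩ a b ha hb hab
  obtain rfl : f = g := Subtype.ext (hf.trans hg.symm)
  exact ⟨f, hf, a • S + b • T, convex_isDoublyStochastic hS hT ha hb hab, rfl⟩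

end FullySymm

/-! ### Invariant Markov kernels as doubly stochastic operators. -/

namespace FullySymm

open ProbabilityTheory

section kernel

variable {η : Kernel ℝ ℝ}

theorem integrable_kernel_integral (hη : η ∘ₘ leb = leb) {f : ℝ → ℝ} (hf : Integrable f leb) :
    Integrable (fun s => ∫ t, f t ∂η s) leb := by
  have h : Integrable f ((η ∘ₖ Kernel.const Unit leb) ()) := by
    rwa [← Measure.comp_eq_comp_const_apply, hη]
  simpa using h.integral_comp

theorem integral_kernel_integral (hη : η ∘ₘ leb = leb) {f : ℝ → ℝ} (hf : Integrable f leb) :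
    ∫ s, ∫ t, f t ∂η s ∂leb = ∫ t, f t ∂leb := by
  have h : Integrable f ((η ∘ₖ Kernel.const Unit leb) ()) := by
    rwa [← Measure.comp_eq_comp_const_apply, hη]
  have := Kernel.integral_comp h
  rw [← Measure.comp_eq_comp_const_apply, hη] at this
  simpa using this.symm

/-- Invariance makes a null set negligible for almost every fibre measure, so integration against η
respects a.e. classes. -/
theorem ae_ae_kernel (hη : η ∘ₘ leb = leb) {p : ℝ → Prop} (h : ∀ᵐ t ∂leb, p t) :
    ∀ᵐ s ∂leb, ∀ᵐ t ∂η s, p t := by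
  rw [← hη] at h
  exact Measure.ae_ae_of_ae_comp h

theorem ae_integrable_kernel (hη : η ∘ₘ leb = leb) {f : ℝ → ℝ} (hf : Integrable f leb) :
    ∀ᵐ s ∂leb, Integrable f (η s) := by
  rw [← hη] at hf
  exact Measure.ae_integrable_of_integrable_comp hf

theorem integral_kernel_congr (hη : η ∘ₘ leb = leb) {f g : ℝ → ℝ} (h : f =ᵐ[leb] g) :
    (fun s => ∫ t, f t ∂η s) =ᵐ[leb] fun s => ∫ t, g t ∂η s :=
  (ae_ae_kernel hη h).mono fun _ hs => integral_congr_ae hs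

variable (η) in
/-- The doubly stochastic operator of a Markov kernel which leaves Lebesgue measure invariant. -/
noncomputable def kernelOp (hη : η ∘ₘ leb = leb) : Lp ℝ 1 leb →L[ℝ] Lp ℝ 1 leb :=
  LinearMap.mkContinuous
    { toFun := fun f => (integrable_kernel_integral hη (L1.integrable_coeFn f)).toL1 _
      map_add' := fun f g => by
        rw [← Integrable.toL1_add, Integrable.toL1_eq_toL1_iff]
        filter_upwards [integral_kernel_congr hη (Lp.coeFn_add f g),
          ae_integrable_kernel hη (L1.integrable_coeFn f),
          ae_integrable_kernel hη (L1.integrable_coeFn g)] with s h hf hg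
        rw [h]
        exact integral_add hf hg
      map_smul' := fun c f => by
        rw [RingHom.id_apply, ← Integrable.toL1_smul, Integrable.toL1_eq_toL1_iff]
        filter_upwards [integral_kernel_congr hη (Lp.coeFn_smul c f)] with s h
        rw [h]
        exact integral_const_mul c _ } 1 (fun f => by
      rw [one_mul]
      change ‖(integrable_kernel_integral hη (L1.integrable_coeFn f)).toL1 _‖ ≤ ‖f‖
      rw [L1.norm_of_fun_eq_integral_norm
        (integrable_kernel_integral hη (L1.integrable_coeFn f)), L1.norm_eq_integral_norm,
        ← integral_kernel_integral hη (L1.integrable_coeFn f).norm]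
      exact integral_mono (integrable_kernel_integral hη (L1.integrable_coeFn f)).norm
        (integrable_kernel_integral hη (L1.integrable_coeFn f).norm)
        fun s => norm_integral_le_integral_norm _)

theorem kernelOp_coe (hη : η ∘ₘ leb = leb) (f : Lp ℝ 1 leb) :
    kernelOp η hη f =ᵐ[leb] fun s => ∫ t, f t ∂η s :=
  Integrable.coeFn_toL1 (integrable_kernel_integral hη (L1.integrable_coeFn f))

theorem isDoublyStochastic_kernelOp [IsMarkovKernel η] (hη : η ∘ₘ leb = leb) :
    IsDoublyStochastic (kernelOp η hη) := by
  refine ⟨fun f => ?_, fun f => ?_, fun f hf => ?_, fun f _ => ?_, ?_⟩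
  · refine ((kernelOp η hη).le_opNorm f).trans ?_
    refine mul_le_of_le_one_left (norm_nonneg _) ?_
    exact LinearMap.mkContinuous_norm_le _ zero_le_one _
  · rw [eLpNorm_congr_ae (kernelOp_coe hη f)]
    rcases eq_or_ne (eLpNorm f ∞ leb) ⊤ with h | h
    · rw [h]; exact le_top
    rw [eLpNorm_exponent_top] at h ⊢
    refine eLpNormEssSup_le_of_ae_enorm_bound ?_
    have hb : ∀ᵐ t ∂leb, ‖f t‖ₑ ≤ eLpNormEssSup f leb := ae_le_eLpNormEssSup
    filter_upwards [ae_ae_kernel hη hb] with s hs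
    refine (enorm_integral_le_lintegral_enorm _).trans ((lintegral_mono_ae hs).trans ?_)
    rw [eLpNorm_exponent_top]
    simp
  · rw [← Lp.coeFn_nonneg] at hf ⊢
    filter_upwards [kernelOp_coe hη f, ae_ae_kernel hη hf] with s hs h
    rw [hs]
    exact integral_nonneg_of_ae h
  · rw [integral_congr_ae (kernelOp_coe hη f),
      integral_kernel_integral hη (L1.integrable_coeFn f)]
  · refine Lp.ext ?_
    have h1 := Lp.coeFn_const (μ := leb) 1 (1 : ℝ)
    filter_upwards [kernelOp_coe hη (Lp.const 1 leb (1 : ℝ)), integral_kernel_congr hη h1, h1]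
      with s h2 h3 h4
    rw [h2, h3, h4]
    simp

end kernel

/-- Equimeasurable functions lie in the same orbit. -/
theorem mem_orbit_of_map_eq {x z : L0} (hx : x.Integrable)
    (h : leb.map z = leb.map x) : z ∈ orbit x := by
  have hxm := x.measurable
  have hzm := z.measurable
  -- κ v is the law of a point t conditioned on x t = v. The kernel η s = κ (z s) picks a random
  -- point of the fibre x = z s; it preserves `leb` because z and x have the same law, and it
  -- averages x to z.
  set κ := condDistrib (id : ℝ → ℝ) x leb with hκ
  let η : Kernel ℝ ℝ := κ.comap z hzm
  have hη : η ∘ₘ leb = leb := by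
    have : η ∘ₘ leb = κ ∘ₘ (leb.map z) := by
      rw [← Measure.deterministic_comp_eq_map hzm, Measure.comp_assoc,
        Kernel.comp_deterministic_eq_comap]
    rw [this, h, condDistrib_comp_map hxm.aemeasurable aemeasurable_id, Measure.map_id]
  have hfib : ∀ᵐ v ∂(leb.map x), ∀ᵐ t ∂κ v, x t = v := by
    have hS : MeasurableSet {p : ℝ × ℝ | x p.2 = p.1} :=
      measurableSet_eq_fun (hxm.comp measurable_snd) measurable_fst
    refine Measure.ae_ae_of_ae_compProd (p := fun p : ℝ × ℝ => x p.2 = p.1) ?_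
    rw [hκ, compProd_map_condDistrib aemeasurable_id,
      ae_map_iff (hxm.prodMk measurable_id).aemeasurable hS]
    exact Eventually.of_forall fun _ => rfl
  rw [← h] at hfib
  have hfib' : ∀ᵐ s ∂leb, ∀ᵐ t ∂η s, x t = z s := ae_of_ae_map hzm.aemeasurable hfib
  refine ⟨hx.toL1 x, ?_, kernelOp η hη, isDoublyStochastic_kernelOp hη, ?_⟩
  · simp [Integrable.toL1, MemLp.toLp]
  · refine AEEqFun.ext ?_
    filter_upwards [kernelOp_coe hη (hx.toL1 x), integral_kernel_congr hη hx.coeFn_toL1, hfib']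
      with s h1 h2 h3
    rw [h1, h2, integral_congr_ae h3]
    simp

end FullySymm

/-! ### Weak compactness of the doubly stochastic operators. -/

namespace FullySymm

/-- `h n → g` weakly along the ultrafilter `U`, tested on sets. -/
def WeakLim (U : Ultrafilter ℕ) (h : ℕ → Lp ℝ 1 leb) (g : Lp ℝ 1 leb) : Prop :=
  ∀ B, MeasurableSet B →
    Tendsto (fun n => ∫ s in B, h n s ∂leb) U (𝓝 (∫ s in B, g s ∂leb))

namespace WeakLim

variable {U : Ultrafilter ℕ} {h h' : ℕ → Lp ℝ 1 leb} {g g' : Lp ℝ 1 leb}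

theorem setIntegral_add (f g : Lp ℝ 1 leb) (B : Set ℝ) :
    ∫ s in B, (f + g : Lp ℝ 1 leb) s ∂leb = ∫ s in B, f s ∂leb + ∫ s in B, g s ∂leb := by
  rw [integral_congr_ae (ae_restrict_of_ae (Lp.coeFn_add f g))]
  exact integral_add (L1.integrable_coeFn f).integrableOn (L1.integrable_coeFn g).integrableOn

theorem setIntegral_smul (c : ℝ) (f : Lp ℝ 1 leb) (B : Set ℝ) :
    ∫ s in B, (c • f : Lp ℝ 1 leb) s ∂leb = c * ∫ s in B, f s ∂leb := by
  rw [integral_congr_ae (ae_restrict_of_ae (Lp.coeFn_smul c f))]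
  exact integral_const_mul c _

theorem abs_setIntegral_le (f : Lp ℝ 1 leb) (B : Set ℝ) : |∫ s in B, f s ∂leb| ≤ ‖f‖ := by
  rw [L1.norm_eq_integral_norm, ← Real.norm_eq_abs]
  exact (norm_integral_le_integral_norm _).trans
    (setIntegral_le_integral (L1.integrable_coeFn f).norm
      (Eventually.of_forall fun _ => norm_nonneg _))

theorem add (H : WeakLim U h g) (H' : WeakLim U h' g') :
    WeakLim U (fun n => h n + h' n) (g + g') := by
  intro B hB
  simp only [setIntegral_add]
  exact (H B hB).add (H' B hB)

theorem smul (c : ℝ) (H : WeakLim U h g) : WeakLim U (fun n => c • h n) (c • g) := by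
  intro B hB
  simp only [setIntegral_smul]
  exact (H B hB).const_mul c

theorem sub (H : WeakLim U h g) (H' : WeakLim U h' g') :
    WeakLim U (fun n => h n - h' n) (g - g') := by
  have := H.add (H'.smul (-1))
  simpa [sub_eq_add_neg] using this

/-- Two test sets suffice: the set where g ≥ 0 and its complement recover ‖g‖ exactly. Applied to a
difference, this gives uniqueness of weak limits. -/
theorem norm_le (H : WeakLim U h g) {C : ℝ} (hC : ∀ n, ‖h n‖ ≤ C) : ‖g‖ ≤ C := by
  have hgm : Measurable g := (Lp.stronglyMeasurable g).measurable
  set S := {s | 0 ≤ g s} with hS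
  have hSm : MeasurableSet S := measurableSet_le measurable_const hgm
  have e : ‖g‖ = ∫ s in S, g s ∂leb - ∫ s in Sᶜ, g s ∂leb := by
    rw [L1.norm_eq_integral_norm, ← integral_add_compl hSm (L1.integrable_coeFn g).norm,
      sub_eq_add_neg, ← integral_neg]
    congr 1
    · exact setIntegral_congr_fun hSm fun s hs => Real.norm_of_nonneg hs
    · exact setIntegral_congr_fun hSm.compl fun s hs => Real.norm_of_nonpos (not_le.1 (show ¬ 0 ≤ g s from hs)).le
  rw [e]
  refine le_of_tendsto' ((H S hSm).sub (H Sᶜ hSm.compl)) fun n => ?_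
  refine le_trans ?_ (hC n)
  rw [L1.norm_eq_integral_norm, ← integral_add_compl hSm (L1.integrable_coeFn (h n)).norm,
    sub_eq_add_neg, ← integral_neg]
  exact add_le_add
    (integral_mono (L1.integrable_coeFn _).integrableOn (L1.integrable_coeFn _).norm.integrableOn
      fun s => Real.le_norm_self _)
    (integral_mono (L1.integrable_coeFn _).neg.integrableOn
      (L1.integrable_coeFn _).norm.integrableOn fun s => (neg_le_abs _))

theorem unique (H : WeakLim U h g) (H' : WeakLim U h g') : g = g' := by
  have := (H.sub H').norm_le (C := 0) (fun n => by simp)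
  exact sub_eq_zero.1 (norm_le_zero_iff.1 this)

theorem nonneg (H : WeakLim U h g) (h0 : ∀ n, 0 ≤ h n) : 0 ≤ g := by
  rw [← Lp.coeFn_nonneg]
  refine ae_nonneg_of_forall_setIntegral_nonneg (L1.integrable_coeFn g) fun B hB _ => ?_
  refine ge_of_tendsto' (H B hB) fun n => ?_
  exact integral_nonneg_of_ae (ae_restrict_of_ae ((Lp.coeFn_nonneg _).2 (h0 n)))

theorem const (f : Lp ℝ 1 leb) : WeakLim U (fun _ => f) f := fun _ _ => tendsto_const_nhds

theorem of_tendsto (hU : (U : Filter ℕ) ≤ atTop) (H : Tendsto h atTop (𝓝 g)) :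
    WeakLim U h g := by
  intro B _
  refine Tendsto.mono_left ?_ hU
  rw [tendsto_iff_norm_sub_tendsto_zero] at H ⊢
  refine squeeze_zero (fun _ => norm_nonneg _) (fun n => ?_) H
  have := setIntegral_add (h n - g) g B
  rw [sub_add_cancel] at this
  rw [this, add_sub_cancel_right]
  exact abs_setIntegral_le _ _

end WeakLim

theorem exists_weakLim_L2 (U : Ultrafilter ℕ) (h : ℕ → Lp ℝ 2 leb) {C : ℝ}
    (hb : ∀ n, ‖h n‖ ≤ C) :
    ∃ h' : Lp ℝ 2 leb, ∀ g, Tendsto (fun n => inner ℝ (h n) g) U (𝓝 (inner ℝ h' g)) := by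
  let D := InnerProductSpace.toDual ℝ (Lp ℝ 2 leb)
  have hK := WeakDual.isCompact_closedBall (𝕜 := ℝ) (E := Lp ℝ 2 leb) 0 C
  let φ : ℕ → WeakDual ℝ (Lp ℝ 2 leb) := fun n => StrongDual.toWeakDual (D (h n))
  have hφ : ∀ n, φ n ∈ WeakDual.toStrongDual ⁻¹' Metric.closedBall (0 : StrongDual ℝ (Lp ℝ 2 leb)) C := by
    intro n
    simp only [mem_preimage, mem_closedBall_zero_iff]
    change ‖D (h n)‖ ≤ C
    rw [LinearIsometryEquiv.norm_map]
    exact hb n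
  obtain ⟨ψ, -, hψ⟩ := hK.ultrafilter_le_nhds (U.map φ)
    (le_principal_iff.2 (mem_map.2 (Eventually.of_forall hφ)))
  refine ⟨D.symm (WeakDual.toStrongDual ψ), fun g => ?_⟩
  have h1 : Tendsto φ U (𝓝 ψ) := hψ
  have h2 := ((WeakDual.eval_continuous g).tendsto ψ).comp h1
  have e : inner ℝ (D.symm (WeakDual.toStrongDual ψ)) g = ψ g :=
    InnerProductSpace.toDual_symm_apply
  rw [e]
  exact h2

/-- On a probability space the L_∞ bound is also an L₂ bound, and balls of the Hilbert space are
weakly compact. -/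
theorem exists_weakLim_of_bounded (U : Ultrafilter ℕ) (h : ℕ → Lp ℝ 1 leb) {C : ℝ≥0}
    (hb : ∀ n, eLpNorm (h n) ∞ leb ≤ C) : ∃ g, WeakLim U h g := by
  have hle : ∀ n, eLpNorm (h n) 2 leb ≤ C := fun n =>
    (eLpNorm_le_eLpNorm_of_exponent_le le_top (Lp.aestronglyMeasurable _)).trans (hb n)
  have hm : ∀ n, MemLp (h n) 2 leb := fun n =>
    ⟨Lp.aestronglyMeasurable _, (hle n).trans_lt ENNReal.coe_lt_top⟩
  obtain ⟨k, hk⟩ := exists_weakLim_L2 U (fun n => (hm n).toLp) (C := C) fun n => by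
    rw [Lp.norm_toLp]
    exact ENNReal.toReal_le_coe_of_le_coe (hle n)
  have hki : Integrable k leb := (Lp.memLp k).integrable (by norm_num)
  refine ⟨hki.toL1 k, fun B hB => ?_⟩
  have key := hk (indicatorConstLp 2 hB (measure_ne_top leb B) (1 : ℝ))
  simp only [real_inner_comm (indicatorConstLp 2 hB (measure_ne_top leb B) (1 : ℝ)),
    L2.inner_indicatorConstLp_one] at key
  rw [integral_congr_ae (ae_restrict_of_ae hki.coeFn_toL1)]
  refine key.congr fun n => ?_
  exact integral_congr_ae (ae_restrict_of_ae (hm n).coeFn_toLp)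

section compactness

variable {T : ℕ → Lp ℝ 1 leb →L[ℝ] Lp ℝ 1 leb}

/-- The L_∞ contraction bounds the images of indicators, where the L₂ argument applies. The L₁
contraction makes the limits of an L₁-Cauchy sequence Cauchy, which extends the claim to all of L₁
by density. -/
theorem exists_weakLim_op (hT : ∀ n, IsDoublyStochastic (T n)) (U : Ultrafilter ℕ)
    (f : Lp ℝ 1 leb) : ∃ g, WeakLim U (fun n => T n f) g := by
  induction f using Lp.induction with
  | hp_ne_top => exact ENNReal.one_ne_top
  | indicatorConst c hs hμs =>
    refine exists_weakLim_of_bounded U _ (C := ‖c‖₊) fun n => ?_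
    refine ((hT n).norm_top_le _).trans ?_
    rw [Lp.simpleFunc.coe_indicatorConst, eLpNorm_congr_ae indicatorConstLp_coeFn]
    rw [eLpNorm_exponent_top]
    exact eLpNormEssSup_indicator_const_le _ c
  | add hf hg _ h1 h2 =>
    obtain ⟨g1, h1⟩ := h1
    obtain ⟨g2, h2⟩ := h2
    refine ⟨g1 + g2, ?_⟩
    simp only [map_add]
    exact h1.add h2
  | isClosed =>
    refine IsSeqClosed.isClosed ?_
    intro f f₀ hf hlim
    choose g hg using hf
    have hsub : ∀ k l, ‖g k - g l‖ ≤ ‖f k - f l‖ := fun k l =>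
      ((hg k).sub (hg l)).norm_le fun n => by
        rw [← map_sub]; exact (hT n).norm_le _
    have hc : CauchySeq g := by
      rw [Metric.cauchySeq_iff]
      intro ε hε
      obtain ⟨N, hN⟩ := Metric.cauchySeq_iff.1 hlim.cauchySeq ε hε
      refine ⟨N, fun k hk l hl => ?_⟩
      have := hN k hk l hl
      rw [dist_eq_norm] at this ⊢
      exact (hsub k l).trans_lt this
    obtain ⟨g₀, hg₀⟩ := cauchySeq_tendsto_of_complete hc
    refine ⟨g₀, fun B hB => ?_⟩
    rw [Metric.tendsto_nhds]
    intro ε hε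
    have h1 := Metric.tendsto_nhds.1 hlim (ε / 3) (by positivity)
    have h2 := Metric.tendsto_nhds.1 hg₀ (ε / 3) (by positivity)
    obtain ⟨k, hk1, hk2⟩ := (h1.and h2).exists
    filter_upwards [Metric.tendsto_nhds.1 (hg k B hB) (ε / 3) (by positivity)] with n hn
    rw [dist_eq_norm] at hk1 hk2
    rw [Real.dist_eq] at hn ⊢
    have e1 : |∫ s in B, T n f₀ s ∂leb - ∫ s in B, T n (f k) s ∂leb| ≤ ‖f k - f₀‖ := by
      have := WeakLim.setIntegral_add (T n (f₀ - f k)) (T n (f k)) B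
      rw [← map_add, sub_add_cancel] at this
      rw [this, add_sub_cancel_right, norm_sub_rev]
      exact (WeakLim.abs_setIntegral_le _ _).trans ((hT n).norm_le _)
    have e2 : |∫ s in B, g k s ∂leb - ∫ s in B, g₀ s ∂leb| ≤ ‖g k - g₀‖ := by
      have := WeakLim.setIntegral_add (g k - g₀) g₀ B
      rw [sub_add_cancel] at this
      rw [this, add_sub_cancel_right]
      exact WeakLim.abs_setIntegral_le _ _
    calc _ ≤ |∫ s in B, T n f₀ s ∂leb - ∫ s in B, T n (f k) s ∂leb|
          + |∫ s in B, T n (f k) s ∂leb - ∫ s in B, g k s ∂leb|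
          + |∫ s in B, g k s ∂leb - ∫ s in B, g₀ s ∂leb| := by
          refine (abs_sub_le _ (∫ s in B, g k s ∂leb) _).trans ?_
          gcongr
          exact abs_sub_le _ _ _
      _ < ε := by linarith

theorem Lp_le_const_of_setIntegral {g : Lp ℝ 1 leb} {C : ℝ}
    (h : ∀ B, MeasurableSet B → ∫ s in B, g s ∂leb ≤ C * leb.real B) : ∀ᵐ s ∂leb, g s ≤ C := by
  have : 0 ≤ᵐ[leb] fun s => C - g s := by
    refine ae_nonneg_of_forall_setIntegral_nonneg
      ((integrable_const C).sub (L1.integrable_coeFn g)) fun B hB _ => ?_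
    rw [integral_sub (integrable_const C) (L1.integrable_coeFn g).integrableOn]
    have := h B hB
    simp only [integral_const, smul_eq_mul]
    rw [measureReal_restrict_apply_univ, mul_comm]
    linarith
  filter_upwards [this] with s hs
  simpa using hs

theorem setIntegral_le_of_ae_le {g : Lp ℝ 1 leb} {C : ℝ} (h : ∀ᵐ s ∂leb, g s ≤ C) (B : Set ℝ) :
    ∫ s in B, g s ∂leb ≤ C * leb.real B := by
  have := integral_mono_ae (L1.integrable_coeFn g).integrableOn (integrable_const C)
    (ae_restrict_of_ae (s := B) h)
  simpa [measureReal_restrict_apply_univ, mul_comm] using this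

theorem WeakLim.ae_le {U : Ultrafilter ℕ} {h : ℕ → Lp ℝ 1 leb} {g : Lp ℝ 1 leb}
    (H : WeakLim U h g) {C : ℝ} (hC : ∀ n, ∀ᵐ s ∂leb, h n s ≤ C) : ∀ᵐ s ∂leb, g s ≤ C :=
  Lp_le_const_of_setIntegral fun B hB =>
    le_of_tendsto' (H B hB) fun n => setIntegral_le_of_ae_le (hC n) B

theorem WeakLim.eLpNorm_top_le {U : Ultrafilter ℕ} {h : ℕ → Lp ℝ 1 leb} {g : Lp ℝ 1 leb}
    (H : WeakLim U h g) {C : ℝ≥0∞} (hC : ∀ n, eLpNorm (h n) ∞ leb ≤ C) :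
    eLpNorm g ∞ leb ≤ C := by
  rcases eq_or_ne C ⊤ with rfl | hCt
  · exact le_top
  lift C to ℝ≥0 using hCt
  have hb : ∀ n, ∀ᵐ s ∂leb, |h n s| ≤ C := fun n => by
    have hn := hC n
    rw [eLpNorm_exponent_top] at hn
    filter_upwards [ae_le_eLpNormEssSup (f := h n) (μ := leb)] with s hs
    have := hs.trans hn
    rw [enorm_le_coe] at this
    exact this
  have h1 : ∀ᵐ s ∂leb, g s ≤ C := H.ae_le fun n => (hb n).mono fun s hs => (abs_le.1 hs).2
  have h2 : ∀ᵐ s ∂leb, ((-1 : ℝ) • g) s ≤ C := (H.smul (-1)).ae_le fun n => by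
    filter_upwards [hb n, Lp.coeFn_smul (-1 : ℝ) (h n)] with s hs e
    rw [e, Pi.smul_apply, smul_eq_mul]
    linarith [(abs_le.1 hs).1]
  rw [eLpNorm_exponent_top]
  refine eLpNormEssSup_le_of_ae_enorm_bound ?_
  filter_upwards [h1, h2, Lp.coeFn_smul (-1 : ℝ) g] with s h1 h2 e
  rw [e, Pi.smul_apply, smul_eq_mul] at h2
  rw [enorm_le_coe]
  exact abs_le.2 ⟨by linarith, h1⟩

/-- The doubly stochastic operators are compact in the weak operator topology; a form
sufficient to show that orbits are closed in `L₁`. -/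
theorem exists_isDoublyStochastic_of_tendsto (hT : ∀ n, IsDoublyStochastic (T n))
    {f g : Lp ℝ 1 leb} (h : Tendsto (fun n => T n f) atTop (𝓝 g)) :
    ∃ S : Lp ℝ 1 leb →L[ℝ] Lp ℝ 1 leb, IsDoublyStochastic S ∧ S f = g := by
  let U : Ultrafilter ℕ := hyperfilter ℕ
  -- A single ultrafilter serves all f at once, so linearity of S follows from uniqueness of limits.
  choose S hS using exists_weakLim_op hT U
  have hSn : ∀ f, ‖S f‖ ≤ ‖f‖ := fun f => (hS f).norm_le fun n => (hT n).norm_le f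
  let S' : Lp ℝ 1 leb →L[ℝ] Lp ℝ 1 leb := LinearMap.mkContinuous
    { toFun := S
      map_add' := fun f g => (hS (f + g)).unique (by
        simp only [map_add]; exact (hS f).add (hS g))
      map_smul' := fun c f => (hS (c • f)).unique (by
        simp only [map_smul]; exact (hS f).smul c) } 1 (fun f => by
          rw [one_mul]; exact hSn f)
  refine ⟨S', ⟨hSn, fun f => ?_, fun f hf => ?_, fun f hf => ?_, ?_⟩, ?_⟩
  · exact (hS f).eLpNorm_top_le fun n => (hT n).norm_top_le f
  · exact (hS f).nonneg fun n => (hT n).nonneg f hf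
  · have := hS f univ MeasurableSet.univ
    simp only [Measure.restrict_univ, (hT _).integral_eq f hf] at this
    exact tendsto_nhds_unique this tendsto_const_nhds
  · refine (hS _).unique ?_
    simp only [(hT _).map_one]
    exact WeakLim.const _
  · exact (hS f).unique (WeakLim.of_tendsto Nat.hyperfilter_le_atTop h)

end compactness

end FullySymm

/-! ### Cutting a decreasing function into windows with prescribed integrals. -/

namespace FullySymm

/-- Integrable nonnegative functions which decrease on `(0,∞)`. -/
structure Decr (f : ℝ → ℝ) : Prop where
  meas : Measurable f
  nonneg : ∀ t, 0 ≤ f t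
  anti : AntitoneOn f (Ioi 0)
  int : Integrable f

theorem Decr.ii {f : ℝ → ℝ} (hf : Decr f) (a b : ℝ) : IntervalIntegrable f volume a b :=
  hf.int.intervalIntegrable

theorem setLIntegral_Ico_comp_add {ψ : ℝ → ℝ≥0∞} (hψ : Measurable ψ) (p q c : ℝ) :
    ∫⁻ t in Ico p q, ψ (t + c) = ∫⁻ t in Ico (p + c) (q + c), ψ t := by
  have := (measurePreserving_add_right volume c).setLIntegral_comp_preimage
    (measurableSet_Ico (a := p + c) (b := q + c)) hψ
  simpa using this

theorem setLIntegral_Ico_split (ψ : ℝ → ℝ≥0∞) {p q r : ℝ} (h1 : p ≤ q) (h2 : q ≤ r) :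
    ∫⁻ t in Ico p r, ψ t = (∫⁻ t in Ico p q, ψ t) + ∫⁻ t in Ico q r, ψ t := by
  rw [← Ico_union_Ico_eq_Ico h1 h2, lintegral_union measurableSet_Ico]
  rw [Set.disjoint_left]
  rintro s ⟨_, h⟩ ⟨h', _⟩
  exact absurd h (not_lt.2 h')

theorem Decr.integral_shift_le {f : ℝ → ℝ} (hf : Decr f) {a b m : ℝ} (ha : 0 ≤ a) (hab : a ≤ b)
    (hm : 0 ≤ m) : ∫ s in b..(b + m), f s ≤ ∫ s in a..(a + m), f s := by
  have e : ∫ s in b..(b + m), f s = ∫ s in a..(a + m), f (s + (b - a)) := by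
    rw [intervalIntegral.integral_comp_add_right]
    congr 1 <;> ring
  rw [e]
  refine intervalIntegral.integral_mono_on_of_le_Ioo (by linarith)
    (hf.int.comp_add_right _).intervalIntegrable (hf.ii _ _) fun s hs => ?_
  have : 0 < s := ha.trans_lt hs.1
  exact hf.anti this (mem_Ioi.2 (by linarith)) (by linarith)

/-- The partial integrals of `f` over `[0,t]` dominate those of `g` for `t ≤ M`, with equality
at `M`. -/
def HeadDom (g f : ℝ → ℝ) (M : ℝ) : Prop :=
  (∀ t ∈ Icc 0 M, ∫ s in (0 : ℝ)..t, g s ≤ ∫ s in (0 : ℝ)..t, f s) ∧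
    ∫ s in (0 : ℝ)..M, g s = ∫ s in (0 : ℝ)..M, f s

/-- One can cut out of `f` a window whose integral equals that of `g` over `[M', M]`, in such
a way that the rest of `f` still dominates `g`. -/
theorem Decr.exists_window {f g : ℝ → ℝ} (hf : Decr f) (hg : Decr g) {M M' : ℝ} (h0 : 0 ≤ M')
    (hM : M' ≤ M) (hd : HeadDom g f M) :
    ∃ u f' : ℝ → ℝ, Decr u ∧ Decr f' ∧ ∫ s in (0 : ℝ)..(M - M'), u s = ∫ s in M'..M, g s ∧
      HeadDom g f' M' ∧ ∀ φ : ℝ → ℝ≥0∞, Measurable φ →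
        ∫⁻ t in Ico 0 M, φ (f t) = (∫⁻ t in Ico 0 (M - M'), φ (u t)) +
          ∫⁻ t in Ico 0 M', φ (f' t) := by
  obtain ⟨hle, heq⟩ := hd
  set m := M - M' with hm
  have hm0 : 0 ≤ m := by linarith
  have hX : ∀ a b : ℝ, ∫ s in a..b, f s = (∫ s in (0 : ℝ)..b, f s) - ∫ s in (0 : ℝ)..a, f s :=
    fun a b => (intervalIntegral.integral_interval_sub_left (hf.ii _ _) (hf.ii _ _)).symm
  have hY : ∀ a b : ℝ, ∫ s in a..b, g s = (∫ s in (0 : ℝ)..b, g s) - ∫ s in (0 : ℝ)..a, g s :=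
    fun a b => (intervalIntegral.integral_interval_sub_left (hg.ii _ _) (hg.ii _ _)).symm
  have hcX : Continuous fun t => ∫ s in (0 : ℝ)..t, f s :=
    intervalIntegral.continuous_primitive (fun a b => hf.ii a b) 0
  have hcA : Continuous fun a => ∫ s in a..(a + m), f s := by
    rw [show (fun a => ∫ s in a..(a + m), f s) = fun a => (∫ s in (0 : ℝ)..(a + m), f s) -
      ∫ s in (0 : ℝ)..a, f s from funext fun a => hX _ _]
    exact (hcX.comp (continuous_id.add continuous_const)).sub hcX
  -- The window [a, a + m] slides from a = 0, where its f-integral is too large, to a = M', where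
  -- domination at M' and equality at M make it too small. Continuity gives the right position.
  have hq1 : ∫ s in M'..(M' + m), f s ≤ ∫ s in M'..M, g s := by
    rw [hX, hY, show M' + m = M by rw [hm]; ring, ← heq]
    linarith [hle M' ⟨h0, hM⟩]
  have hq2 : ∫ s in M'..M, g s ≤ ∫ s in (0 : ℝ)..(0 + m), f s := by
    have h1 := hg.integral_shift_le le_rfl h0 hm0
    rw [show M' + m = M by rw [hm]; ring] at h1
    refine h1.trans ?_
    rw [zero_add]
    exact hle m ⟨hm0, by linarith⟩
  obtain ⟨a, ⟨ha0, haM⟩, ha⟩ := intermediate_value_Icc' h0 hcA.continuousOn ⟨hq1, hq2⟩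
  simp only at ha
  -- The window is removed and the part to its right is shifted left to close the gap, which keeps
  -- the function decreasing.
  let f' : ℝ → ℝ := fun t => if t < a then f t else f (t + m)
  have hf'lt : ∀ t, t < a → f' t = f t := fun t ht => if_pos ht
  have hf'ge : ∀ t, a ≤ t → f' t = f (t + m) := fun t ht => if_neg (not_lt.2 ht)
  have hf'D : Decr f' := by
    refine ⟨Measurable.ite measurableSet_Iio hf.meas (hf.meas.comp (measurable_add_const m)),
      fun t => ?_, ?_, ?_⟩
    · rcases lt_or_ge t a with h | h
      · rw [hf'lt t h]; exact hf.nonneg _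
      · rw [hf'ge t h]; exact hf.nonneg _
    · intro s hs t ht hst
      have hs' : 0 < s := hs
      have ht' : 0 < t := ht
      rcases lt_or_ge t a with h | h
      · rw [hf'lt t h, hf'lt s (hst.trans_lt h)]
        exact hf.anti hs ht hst
      · rw [hf'ge t h]
        rcases lt_or_ge s a with h' | h'
        · rw [hf'lt s h']
          exact hf.anti hs (mem_Ioi.2 (by linarith)) (by linarith)
        · rw [hf'ge s h']
          exact hf.anti (mem_Ioi.2 (by linarith)) (mem_Ioi.2 (by linarith)) (by linarith)
    · have : f' = (Iio a).piecewise f (fun t => f (t + m)) := rfl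
      rw [this]
      exact Integrable.piecewise measurableSet_Iio hf.int.integrableOn
        (hf.int.comp_add_right m).integrableOn
  have hF1 : ∀ t, t ≤ a → 0 ≤ t → ∫ s in (0 : ℝ)..t, f' s = ∫ s in (0 : ℝ)..t, f s := by
    intro t ht ht0
    refine intervalIntegral.integral_congr_ae ?_
    have : ∀ᵐ s : ℝ, s ≠ a := by simp [ae_iff]
    filter_upwards [this] with s hs hst
    rw [uIoc_of_le ht0] at hst
    exact hf'lt s (lt_of_le_of_ne (hst.2.trans ht) hs)
  have hF2 : ∀ t, a ≤ t → ∫ s in (0 : ℝ)..t, f' s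
      = (∫ s in (0 : ℝ)..(t + m), f s) - ∫ s in M'..M, g s := by
    intro t ht
    rw [← intervalIntegral.integral_add_adjacent_intervals (hf'D.ii 0 a) (hf'D.ii a t),
      hF1 a le_rfl ha0]
    have : ∫ s in a..t, f' s = ∫ s in a..t, f (s + m) := by
      refine intervalIntegral.integral_congr fun s hs => ?_
      rw [uIcc_of_le ht] at hs
      exact hf'ge s hs.1
    rw [this, intervalIntegral.integral_comp_add_right, ← ha, hX (a + m), hX a]
    ring
  refine ⟨fun t => f (t + a), f', ?_, hf'D, ?_, ⟨?_, ?_⟩, ?_⟩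
  · refine ⟨hf.meas.comp (measurable_add_const a), fun t => hf.nonneg _, ?_,
      hf.int.comp_add_right a⟩
    intro s hs t ht hst
    have hs' : 0 < s := hs
    have ht' : 0 < t := ht
    exact hf.anti (mem_Ioi.2 (by linarith)) (mem_Ioi.2 (by linarith)) (by linarith)
  · rw [intervalIntegral.integral_comp_add_right, ← ha]
    congr 1 <;> ring
  · rintro t ⟨ht0, htM⟩
    rcases le_total t a with h | h
    · rw [hF1 t h ht0]
      exact hle t ⟨ht0, htM.trans hM⟩
    · rw [hF2 t h]
      -- Beyond the cut one compares f with g up to t + m; the g-integral subtracted over [M', M] is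
      -- at most that over [t, t + m], since g decreases and t ≤ M'.
      have h1 := hle (t + m) ⟨by linarith, by linarith⟩
      have h2 := hg.integral_shift_le ht0 htM hm0
      rw [show M' + m = M by rw [hm]; ring, hY t] at h2
      linarith
  · rw [hF2 M' haM, show M' + m = M by rw [hm]; ring, ← heq, hY M' M]
    ring
  · intro φ hφ
    have hφf : Measurable fun t => φ (f t) := hφ.comp hf.meas
    rw [setLIntegral_Ico_split _ ha0 (show a ≤ M by linarith),
      setLIntegral_Ico_split (p := a) _ (show a ≤ a + m by linarith) (show a + m ≤ M by linarith),
      setLIntegral_Ico_split (r := M') _ ha0 haM, setLIntegral_Ico_comp_add hφf 0 m a,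
      setLIntegral_congr_fun (s := Ico 0 a) (f := fun t => φ (f' t)) measurableSet_Ico
        (fun t ht => congrArg φ (hf'lt t ht.2)),
      setLIntegral_congr_fun (s := Ico a M') (f := fun t => φ (f' t)) measurableSet_Ico
        (fun t ht => congrArg φ (hf'ge t ht.1)), setLIntegral_Ico_comp_add hφf a M' m,
      show M' + m = M by rw [hm]; ring, zero_add, add_comm m a]
    ring

/-- Decomposition of `f` into windows with the same integrals as `g` on the intervals
`[M (k+1), M k]`. -/
theorem Decr.exists_windows {f g : ℝ → ℝ} (hf : Decr f) (hg : Decr g) {M : ℕ → ℝ}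
    (hM : Antitone M) (h0 : ∀ k, 0 ≤ M k) (hlim : Tendsto M atTop (𝓝 0))
    (hd : HeadDom g f (M 0)) :
    ∃ u : ℕ → ℝ → ℝ, (∀ k, Decr (u k)) ∧
      (∀ k, ∫ s in (0 : ℝ)..(M k - M (k + 1)), u k s = ∫ s in M (k + 1)..M k, g s) ∧
      ∀ φ : ℝ → ℝ≥0∞, Measurable φ →
        ∑' k, ∫⁻ t in Ico 0 (M k - M (k + 1)), φ (u k t) = ∫⁻ t in Ico 0 (M 0), φ (f t) := by
  -- The hypotheses sit under the existential so that the choice is a total function which can be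
  -- iterated.
  have step : ∀ (k : ℕ) (f : ℝ → ℝ), ∃ u f' : ℝ → ℝ, Decr f ∧ HeadDom g f (M k) →
      Decr u ∧ (Decr f' ∧ HeadDom g f' (M (k + 1))) ∧
      ∫ s in (0 : ℝ)..(M k - M (k + 1)), u s = ∫ s in M (k + 1)..M k, g s ∧
      ∀ φ : ℝ → ℝ≥0∞, Measurable φ →
        ∫⁻ t in Ico 0 (M k), φ (f t) = (∫⁻ t in Ico 0 (M k - M (k + 1)), φ (u t)) +
          ∫⁻ t in Ico 0 (M (k + 1)), φ (f' t) := by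
    intro k f
    by_cases h : Decr f ∧ HeadDom g f (M k)
    · obtain ⟨u, f', h1, h2, h3, h4, h5⟩ :=
        h.1.exists_window hg (h0 (k + 1)) (hM (Nat.le_succ k)) h.2
      exact ⟨u, f', fun _ => ⟨h1, ⟨h2, h4⟩, h3, h5⟩⟩
    · exact ⟨f, f, fun h' => absurd h' h⟩
  choose U N hUN using step
  let F : ℕ → ℝ → ℝ := fun k => Nat.rec f (fun k f => N k f) k
  have hF : ∀ k, Decr (F k) ∧ HeadDom g (F k) (M k) := by
    intro k
    induction k with
    | zero => exact ⟨hf, hd⟩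
    | succ k ih => exact (hUN k (F k) ih).2.1
  have hsum : ∀ φ : ℝ → ℝ≥0∞, Measurable φ → ∀ K : ℕ, ∫⁻ t in Ico 0 (M 0), φ (f t) =
      (∑ k ∈ Finset.range K, ∫⁻ t in Ico 0 (M k - M (k + 1)), φ (U k (F k) t)) +
        ∫⁻ t in Ico 0 (M K), φ (F K t) := by
    intro φ hφ K
    induction K with
    | zero => simp [F]
    | succ K ih =>
      rw [ih, (hUN K (F K) (hF K)).2.2.2 φ hφ, Finset.sum_range_succ, add_assoc]
  refine ⟨fun k => U k (F k), fun k => (hUN k _ (hF k)).1, fun k => (hUN k _ (hF k)).2.2.1, ?_⟩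
  -- After K steps the remainder lives on [0, M K). For indicator functions its contribution is at
  -- most M K and vanishes in the limit; equality of the resulting measures then covers unbounded φ.
  have hlaw : (Measure.sum fun k =>
      (volume.restrict (Ico 0 (M k - M (k + 1)))).map (U k (F k))) =
      (volume.restrict (Ico 0 (M 0))).map f := by
    ext S hS
    rw [Measure.sum_apply _ hS, Measure.map_apply hf.meas hS]
    have hφ : Measurable (S.indicator (fun _ => (1 : ℝ≥0∞))) := measurable_const.indicator hS
    have e : ∀ (v : ℝ → ℝ) (hv : Measurable v) (L : ℝ),
        (volume.restrict (Ico 0 L)) (v ⁻¹' S)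
          = ∫⁻ t in Ico 0 L, S.indicator (fun _ => (1 : ℝ≥0∞)) (v t) := by
      intro v hv L
      rw [← lintegral_indicator_one (hv hS)]
      rfl
    have h1 : Tendsto (fun K => (∑ k ∈ Finset.range K, ∫⁻ t in Ico 0 (M k - M (k + 1)),
        S.indicator (fun _ => (1 : ℝ≥0∞)) (U k (F k) t)) +
        ∫⁻ t in Ico 0 (M K), S.indicator (fun _ => (1 : ℝ≥0∞)) (F K t)) atTop
        (𝓝 ((∑' k, ∫⁻ t in Ico 0 (M k - M (k + 1)),
          S.indicator (fun _ => (1 : ℝ≥0∞)) (U k (F k) t)) + 0)) := by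
      refine (ENNReal.tendsto_nat_tsum _).add ?_
      have h2 : Tendsto (fun K => ENNReal.ofReal (M K)) atTop (𝓝 0) := by
        simpa using ENNReal.tendsto_ofReal hlim
      refine tendsto_of_tendsto_of_tendsto_of_le_of_le tendsto_const_nhds h2
        (fun _ => zero_le) fun K => ?_
      calc ∫⁻ t in Ico 0 (M K), S.indicator (fun _ => (1 : ℝ≥0∞)) (F K t)
          ≤ ∫⁻ t in Ico 0 (M K), (1 : ℝ≥0∞) := lintegral_mono fun t => by
            by_cases h : F K t ∈ S <;> simp [h]
        _ = ENNReal.ofReal (M K) := by simp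
    simp only [← hsum _ hφ, add_zero] at h1
    have h2 := tendsto_nhds_unique h1 tendsto_const_nhds
    rw [e f hf.meas, ← h2]
    refine tsum_congr fun k => ?_
    rw [Measure.map_apply (hUN k _ (hF k)).1.meas hS, e _ (hUN k _ (hF k)).1.meas]
  intro φ hφ
  rw [← lintegral_map hφ hf.meas, ← hlaw, lintegral_sum_measure]
  exact tsum_congr fun k => (lintegral_map hφ (hUN k _ (hF k)).1.meas).symm

end FullySymm

/-! ### Approximating a mean by averages of rotations. -/

namespace FullySymm

theorem sum_range_add_mod {n : ℕ} (G : ℕ → ℝ) (j : ℕ) :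
    ∑ i ∈ Finset.range n, G ((i + j) % n) = ∑ i ∈ Finset.range n, G i := by
  induction j with
  | zero =>
    refine Finset.sum_congr rfl fun i hi => ?_
    rw [add_zero, Nat.mod_eq_of_lt (Finset.mem_range.1 hi)]
  | succ j ih =>
    rw [← ih]
    have h1 := Finset.sum_range_succ (fun i => G ((i + j) % n)) n
    have h2 := Finset.sum_range_succ' (fun i => G ((i + j) % n)) n
    simp only [Nat.add_mod_left, zero_add] at h1 h2
    have h3 : ∀ i, i + (j + 1) = i + 1 + j := fun i => by omega
    simp only [h3]
    linarith

/-- The rotation by `a` of `[0, m)`. -/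
noncomputable def rot (m a t : ℝ) : ℝ := if t < m - a then t + a else t + (a - m)

theorem measurable_rot (m a : ℝ) : Measurable (rot m a) :=
  Measurable.ite measurableSet_Iio (measurable_add_const a) (measurable_add_const _)

theorem setLIntegral_rot {ψ : ℝ → ℝ≥0∞} (hψ : Measurable ψ) {m a : ℝ} (ha : 0 ≤ a)
    (ham : a ≤ m) : ∫⁻ t in Ico 0 m, ψ (rot m a t) = ∫⁻ t in Ico 0 m, ψ t := by
  rw [setLIntegral_Ico_split _ (sub_nonneg.2 ham) (by linarith : m - a ≤ m),
    setLIntegral_congr_fun (s := Ico 0 (m - a)) (f := fun t => ψ (rot m a t)) (g := fun t => ψ (t + a)) measurableSet_Ico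
      (fun t ht => congrArg ψ (if_pos ht.2)),
    setLIntegral_congr_fun (s := Ico (m - a) m) (f := fun t => ψ (rot m a t)) (g := fun t => ψ (t + (a - m))) measurableSet_Ico
      (fun t ht => congrArg ψ (if_neg (not_lt.2 ht.1))),
    setLIntegral_Ico_comp_add hψ, setLIntegral_Ico_comp_add hψ,
    setLIntegral_Ico_split ψ ha ham, add_comm]
  congr 3 <;> ring_nf

theorem setLIntegral_floor_mod (ψ : ℝ → ℝ≥0∞) (hψ : Measurable ψ) {h : ℝ} (hh : 0 < h) (n : ℕ) :
    ∫⁻ t in Ico 0 (n * h), ψ (t - ⌊t / h⌋₊ * h) = n * ∫⁻ t in Ico 0 h, ψ t := by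
  induction n with
  | zero => simp
  | succ n ih =>
    have hn : (0 : ℝ) ≤ n * h := by positivity
    rw [setLIntegral_Ico_split _ hn (show (n : ℝ) * h ≤ (n + 1 : ℕ) * h by push_cast; nlinarith),
      ih, setLIntegral_congr_fun (s := Ico (n * h) ((n + 1 : ℕ) * h))
        (g := fun t => ψ (t + -(n * h))) measurableSet_Ico ?_, setLIntegral_Ico_comp_add hψ]
    · push_cast
      rw [show (n : ℝ) * h + -(n * h) = 0 by ring, show ((n : ℝ) + 1) * h + -(n * h) = h by ring]
      ring
    · intro t ht
      have : ⌊t / h⌋₊ = n := by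
        rw [Nat.floor_eq_iff (div_nonneg (hn.trans ht.1) hh.le), le_div_iff₀ hh, div_lt_iff₀ hh]
        refine ⟨ht.1, ?_⟩
        have := ht.2
        push_cast at this
        exact this
      simp only [this, sub_eq_add_neg]

/-- The sum of a decreasing function over an arithmetic progression compared with its
integral. -/
theorem Decr.abs_sum_sub_integral_le {u : ℝ → ℝ} (hu : Decr u) {h r : ℝ} (hr0 : 0 < r)
    (hrh : r < h) (n : ℕ) :
    |h * ∑ l ∈ Finset.range (n + 1), u (r + l * h) - ∫ s in (0 : ℝ)..((n + 1 : ℕ) * h), u s|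
      ≤ h * u r + ∫ s in (0 : ℝ)..h, u s := by
  have hh : 0 < h := hr0.trans hrh
  -- There is one sample point r + l h in each cell. By monotonicity a sample is at least the cell
  -- average to its right and at most the one to its left, so all but the first sample and the first
  -- cell are absorbed.
  set I : ℕ → ℝ := fun l => ∫ s in (l * h : ℝ)..((l + 1 : ℕ) * h), u s with hI
  have hsum : ∀ n : ℕ, ∑ l ∈ Finset.range n, I l = ∫ s in (0 : ℝ)..(n * h), u s := by
    intro n
    have := intervalIntegral.sum_integral_adjacent_intervals (f := u) (μ := volume)
      (a := fun l : ℕ => (l * h : ℝ)) (n := n) fun k _ => hu.ii _ _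
    simpa [hI] using this
  have hup : ∀ l : ℕ, h * u (r + (l + 1 : ℕ) * h) ≤ I l := by
    intro l
    have : h * u (r + (l + 1 : ℕ) * h) = ∫ s in (l * h : ℝ)..((l + 1 : ℕ) * h),
        u (r + (l + 1 : ℕ) * h) := by
      rw [intervalIntegral.integral_const, smul_eq_mul]; push_cast; ring
    rw [this]
    refine intervalIntegral.integral_mono_on_of_le_Ioo (by push_cast; nlinarith)
      intervalIntegrable_const (hu.ii _ _) fun s hs => ?_
    have : (0 : ℝ) ≤ l * h := by positivity
    have h1 := hs.1
    have h2 := hs.2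
    exact hu.anti (mem_Ioi.2 (by linarith)) (mem_Ioi.2 (by push_cast; linarith)) (by linarith)
  have hlo : ∀ l : ℕ, I (l + 1) ≤ h * u (r + l * h) := by
    intro l
    have : h * u (r + l * h) = ∫ s in ((l + 1 : ℕ) * h : ℝ)..((l + 1 + 1 : ℕ) * h),
        u (r + l * h) := by
      rw [intervalIntegral.integral_const, smul_eq_mul]; push_cast; ring
    rw [this]
    refine intervalIntegral.integral_mono_on_of_le_Ioo (by push_cast; nlinarith)
      (hu.ii _ _) intervalIntegrable_const fun s hs => ?_
    have : (0 : ℝ) ≤ l * h := by positivity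
    have h1 := hs.1
    push_cast at h1
    exact hu.anti (mem_Ioi.2 (by linarith)) (mem_Ioi.2 (by linarith)) (by linarith)
  have hI0 : I 0 = ∫ s in (0 : ℝ)..h, u s := by simp [hI]
  have hIn : ∀ l, 0 ≤ I l := fun l =>
    (mul_nonneg hh.le (hu.nonneg _)).trans (hup l)
  rw [← hsum (n + 1), ← hI0, abs_le]
  have hu0 : 0 ≤ h * u r := mul_nonneg hh.le (hu.nonneg _)
  constructor
  · have h1 : ∑ l ∈ Finset.range n, I (l + 1) ≤ ∑ l ∈ Finset.range n, h * u (r + l * h) :=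
      Finset.sum_le_sum fun l _ => hlo l
    rw [Finset.sum_range_succ' I, Finset.sum_range_succ, mul_add, Finset.mul_sum]
    have := mul_nonneg hh.le (hu.nonneg (r + n * h))
    linarith
  · have h1 : ∑ l ∈ Finset.range n, h * u (r + (l + 1 : ℕ) * h) ≤ ∑ l ∈ Finset.range n, I l :=
      Finset.sum_le_sum fun l _ => hup l
    rw [Finset.sum_range_succ I, Finset.sum_range_succ', mul_add, Finset.mul_sum]
    have := hIn n
    have := hIn 0
    simp only [Nat.cast_zero, zero_mul, add_zero]
    linarith

theorem ofReal_intervalIntegral_le {v : ℝ → ℝ} {h : ℝ} (hh : 0 ≤ h)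
    (hv : IntegrableOn v (Ico 0 h)) :
    ENNReal.ofReal (∫ s in (0 : ℝ)..h, v s) ≤ ∫⁻ s in Ico 0 h, ENNReal.ofReal (v s) := by
  rw [intervalIntegral.integral_of_le hh, ← integral_Ico_eq_integral_Ioc]
  calc ENNReal.ofReal (∫ s in Ico 0 h, v s)
      ≤ ENNReal.ofReal (∫ s in Ico 0 h, max (v s) 0) :=
        ENNReal.ofReal_le_ofReal (integral_mono hv hv.pos_part fun s => le_max_left _ _)
    _ = ∫⁻ s in Ico 0 h, ENNReal.ofReal (max (v s) 0) :=
        ofReal_integral_eq_lintegral_ofReal hv.pos_part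
          (Eventually.of_forall fun s => le_max_right _ _)
    _ = _ := by simp [ENNReal.ofReal_max]

/-- The mean of a decreasing function over `[0,m)` is approximated by averages of `n`
equimeasurable functions. -/
theorem Decr.exists_average {u : ℝ → ℝ} (hu : Decr u) {m : ℝ} (hm : 0 < m) {n : ℕ} (hn : 0 < n) :
    ∃ (ζ : ℕ → ℝ → ℝ) (e : ℝ → ℝ) (d : ℝ), (∀ i, Measurable (ζ i)) ∧ Measurable e ∧
      (∀ t, 0 ≤ e t) ∧ 0 ≤ d ∧
      (∀ i < n, ∀ φ : ℝ → ℝ≥0∞, Measurable φ →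
        ∫⁻ t in Ico 0 m, φ (ζ i t) = ∫⁻ t in Ico 0 m, φ (u t)) ∧
      (∀ r, 0 ≤ r → ∫⁻ t in Ico 0 m, ENNReal.ofReal (e t - r)
        ≤ ∫⁻ t in Ico 0 m, ENNReal.ofReal (u t - n * r)) ∧
      (∀ r, 0 ≤ r → ∫⁻ _ in Ico 0 m, ENNReal.ofReal (d - r)
        ≤ ∫⁻ t in Ico 0 m, ENNReal.ofReal (u t - n * r)) ∧
      ∀ᵐ t, t ∈ Ico 0 m →
        |(∫ s in (0 : ℝ)..m, u s) / m - (∑ i ∈ Finset.range n, ζ i t) / n| ≤ e t + d := by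
  have hn' : (0 : ℝ) < n := Nat.cast_pos.2 hn
  set h : ℝ := m / n with hh
  have hh0 : 0 < h := by positivity
  have hnh : n * h = m := by rw [hh]; field_simp
  have hhm : h ≤ m := by
    rw [hh]; exact div_le_self hm.le (Nat.one_le_cast.2 hn)
  have hφint : ∀ r : ℝ, Measurable fun t => ENNReal.ofReal (u t - r) := fun r =>
    (hu.meas.sub_const r).ennreal_ofReal
  have hmono : ∀ r : ℝ, ∫⁻ t in Ico 0 h, ENNReal.ofReal (u t - r)
      ≤ ∫⁻ t in Ico 0 m, ENNReal.ofReal (u t - r) := fun r =>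
    lintegral_mono_set (Ico_subset_Ico_right hhm)
  have hI0 : 0 ≤ ∫ s in (0 : ℝ)..h, u s :=
    intervalIntegral.integral_nonneg hh0.le fun s _ => hu.nonneg s
  -- The averaged functions are the rotations of u by multiples of h = m/n. The error e repeats u/n
  -- from the first cell on all n cells; the constant d is the share of the first cell in the mean.
  refine ⟨fun i t => u (rot m (i * h) t), fun t => u (t - ⌊t / h⌋₊ * h) / n,
    (∫ s in (0 : ℝ)..h, u s) / m, fun i => hu.meas.comp (measurable_rot _ _), ?_,
    fun t => div_nonneg (hu.nonneg _) hn'.le, by positivity, ?_, ?_, ?_, ?_⟩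
  · refine (hu.meas.comp ?_).div_const _
    fun_prop
  · intro i hi φ hφ
    refine setLIntegral_rot (ψ := fun t => φ (u t)) (hφ.comp hu.meas) (by positivity) ?_
    rw [← hnh]
    have : (i : ℝ) ≤ n := Nat.cast_le.2 hi.le
    gcongr
  · intro r _
    refine le_trans (le_of_eq ?_) (hmono _)
    have hmeas : Measurable fun t => ENNReal.ofReal (u t / n - r) :=
      ((hu.meas.div_const _).sub_const r).ennreal_ofReal
    have := setLIntegral_floor_mod (fun t => ENNReal.ofReal (u t / n - r)) hmeas hh0 n
    rw [hnh] at this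
    rw [this, ← lintegral_const_mul _ hmeas]
    refine lintegral_congr fun t => ?_
    rw [← ENNReal.ofReal_natCast, ← ENNReal.ofReal_mul hn'.le]
    congr 1
    field_simp
  · intro r hr
    refine le_trans ?_ (hmono _)
    -- Since m = n h, the constant m r equals ∫₀ʰ n r, and the bound becomes (∫₀ʰ (u - n r))₊ ≤ ∫₀ʰ
    -- (u - n r)₊.
    have h1 : ∫⁻ _ in Ico 0 m, ENNReal.ofReal ((∫ s in (0 : ℝ)..h, u s) / m - r)
        = ENNReal.ofReal (∫ s in (0 : ℝ)..h, (u s - n * r)) := by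
      rw [setLIntegral_const, Real.volume_Ico, sub_zero, mul_comm, ← ENNReal.ofReal_mul hm.le,
        intervalIntegral.integral_sub (hu.ii _ _) intervalIntegrable_const,
        intervalIntegral.integral_const, smul_eq_mul, sub_zero]
      congr 1
      rw [mul_sub, ← hnh]
      field_simp
    rw [h1]
    exact ofReal_intervalIntegral_le hh0.le (hu.int.integrableOn.sub (integrable_const _))
  -- Multiples of h are discarded so that the offset r is strictly positive: u decreases only on
  -- (0,∞).
  · have hcount : ∀ᵐ t : ℝ, t ∉ range fun j : ℕ => (j * h : ℝ) :=
      (countable_range _).ae_notMem _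
    filter_upwards [hcount] with t ht htm
    set j := ⌊t / h⌋₊ with hj
    set r := t - j * h with hr
    have hj1 : (j : ℝ) * h ≤ t := by
      rw [← le_div_iff₀ hh0]; exact Nat.floor_le (div_nonneg htm.1 hh0.le)
    have hj2 : t < (j + 1) * h := by
      rw [← div_lt_iff₀ hh0]; exact Nat.lt_floor_add_one _
    have hr0 : 0 < r := by
      refine lt_of_le_of_ne (by linarith) fun h0 => ht ⟨j, ?_⟩
      simp only; linarith
    have hrh : r < h := by linarith
    have hjn : j < n := by
      by_contra hc
      have : (n : ℝ) ≤ j := Nat.cast_le.2 (not_lt.1 hc)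
      have := htm.2
      nlinarith
    -- The n rotations of t visit each cell once at the same offset r, so their average is a Riemann
    -- sum of u.
    have hζ : ∀ i ∈ Finset.range n, u (rot m (i * h) t) = u (r + ((i + j) % n : ℕ) * h) := by
      intro i hi
      have hi := Finset.mem_range.1 hi
      congr 1
      rw [rot]
      split_ifs with hc
      · have hij : i + j < n := by
          by_contra hc'
          have : (n : ℝ) ≤ i + j := by exact_mod_cast not_lt.1 hc'
          nlinarith
        rw [Nat.mod_eq_of_lt hij]
        push_cast; linarith
      · have hij : n ≤ i + j := by
          by_contra hc'
          have : (i : ℝ) + j + 1 ≤ n := by exact_mod_cast not_le.1 hc'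
          nlinarith
        rw [Nat.mod_eq_sub_mod hij, Nat.mod_eq_of_lt (by omega), Nat.cast_sub hij]
        push_cast; linarith
    rw [Finset.sum_congr rfl hζ, sum_range_add_mod (fun l => u (r + l * h)) j]
    obtain ⟨n', rfl⟩ := Nat.exists_eq_succ_of_ne_zero hn.ne'
    have key := hu.abs_sum_sub_integral_le hr0 hrh n'
    rw [Nat.succ_eq_add_one] at *
    rw [hnh] at key
    set S := ∑ l ∈ Finset.range (n' + 1), u (r + l * h)
    have e1 : (∫ s in (0 : ℝ)..m, u s) / m - S / ((n' + 1 : ℕ) : ℝ)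
        = -((h * S - ∫ s in (0 : ℝ)..m, u s) / m) := by
      rw [← hnh]; field_simp; ring
    have e2 : u r / ((n' + 1 : ℕ) : ℝ) + (∫ s in (0 : ℝ)..h, u s) / m
        = (h * u r + ∫ s in (0 : ℝ)..h, u s) / m := by
      rw [← hnh]; field_simp
    rw [e1, e2, abs_neg, abs_div, abs_of_pos hm]
    gcongr

end FullySymm

/-! ### Transport of level bands to intervals, and gluing. -/

namespace FullySymm

/-- The measure of the part of `C` to the left of `s`. -/
noncomputable def fillMap (C : Set ℝ) (s : ℝ) : ℝ := leb.real (C ∩ Iic s)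

theorem fillMap_mono (C : Set ℝ) : Monotone (fillMap C) := fun _ _ h =>
  measureReal_mono (inter_subset_inter_right _ (Iic_subset_Iic.2 h))

theorem fillMap_lipschitz (C : Set ℝ) : LipschitzWith 1 (fillMap C) := by
  refine LipschitzWith.of_le_add fun s t => ?_
  rcases le_total s t with h | h
  · exact (fillMap_mono C h).trans (le_add_of_nonneg_right dist_nonneg)
  · have h1 : C ∩ Iic s ⊆ (C ∩ Iic t) ∪ Ioc t s := by
      rintro w ⟨hw, hws⟩
      rcases le_or_gt w t with h' | h'
      · exact Or.inl ⟨hw, h'⟩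
      · exact Or.inr ⟨h', hws⟩
    have h2 : leb.real (Ioc t s) ≤ s - t := by
      refine ENNReal.toReal_le_of_le_ofReal (sub_nonneg.2 h) ?_
      exact (Measure.restrict_apply_le _ _).trans (by simp)
    rw [Real.dist_eq, abs_of_nonneg (sub_nonneg.2 h)]
    exact (measureReal_mono h1).trans ((measureReal_union_le _ _).trans (by gcongr; rfl))

theorem measurable_fillMap (C : Set ℝ) : Measurable (fillMap C) :=
  (fillMap_mono C).measurable

theorem fillMap_zero (C : Set ℝ) : fillMap C 0 = 0 := by
  have : leb (C ∩ Iic 0) = 0 := by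
    refine measure_mono_null inter_subset_right ?_
    rw [leb, Measure.restrict_apply measurableSet_Iic]
    have : Iic (0 : ℝ) ∩ Ioo 0 1 = ∅ := by
      ext s; simp only [mem_inter_iff, mem_Iic, mem_Ioo, mem_empty_iff_false, iff_false]
      rintro ⟨h1, h2, _⟩; linarith
    simp [this]
  simp [fillMap, Measure.real, this]

theorem leb_inter_Ioo (C : Set ℝ) (hC : MeasurableSet C) : leb (C ∩ Ioo 0 1) = leb C := by
  rw [leb, Measure.restrict_apply hC, Measure.restrict_apply (hC.inter measurableSet_Ioo),
    inter_assoc, inter_self]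

theorem fillMap_one {C : Set ℝ} (hC : MeasurableSet C) : fillMap C 1 = leb.real C := by
  refine le_antisymm (measureReal_mono inter_subset_left) ?_
  rw [Measure.real, ← leb_inter_Ioo C hC]
  exact measureReal_mono (inter_subset_inter_right _ fun s hs => hs.2.le)

/-- The probability integral transform: `fillMap C` is the continuous distribution function of the
restriction of `leb` to C, so it pushes that measure to Lebesgue measure on an interval. -/
theorem map_fillMap {C : Set ℝ} (hC : MeasurableSet C) :
    (leb.restrict C).map (fillMap C) = volume.restrict (Ico 0 (leb.real C)) := by
  have hmeas := measurable_fillMap C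
  set m := leb.real C with hm
  have hm0 : 0 ≤ m := measureReal_nonneg
  have hlevel : ∀ t ∈ Icc 0 m, ∃ b, fillMap C b = t := by
    intro t ht
    have := intermediate_value_Icc zero_le_one (fillMap_lipschitz C).continuous.continuousOn
    rw [fillMap_zero, fillMap_one hC] at this
    obtain ⟨b, -, hb⟩ := this ht
    exact ⟨b, hb⟩
  have hIic : ∀ b, (leb.restrict C) (Iic b) = ENNReal.ofReal (fillMap C b) := by
    intro b
    rw [Measure.restrict_apply measurableSet_Iic, inter_comm, fillMap, ofReal_measureReal]
  have huniv : (leb.restrict C) univ = ENNReal.ofReal m := by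
    rw [Measure.restrict_apply_univ, hm, ofReal_measureReal]
  refine Measure.ext_of_Iic _ _ fun t => ?_
  rw [Measure.map_apply hmeas measurableSet_Iic, Measure.restrict_apply measurableSet_Iic]
  rcases lt_or_ge t 0 with ht | ht
  · have h1 : fillMap C ⁻¹' Iic t = ∅ := by
      ext s; simp only [mem_preimage, mem_Iic, mem_empty_iff_false, iff_false, not_le]
      exact ht.trans_le measureReal_nonneg
    have h2 : Iic t ∩ Ico 0 m = ∅ := by
      ext s; simp only [mem_inter_iff, mem_Iic, mem_Ico, mem_empty_iff_false, iff_false]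
      rintro ⟨h1, h2, _⟩; linarith
    rw [h1, h2]; simp
  rcases lt_or_ge t m with htm | htm
  · have h2 : Iic t ∩ Ico 0 m = Icc 0 t := by
      ext s; simp only [mem_inter_iff, mem_Iic, mem_Ico, mem_Icc]
      constructor
      · rintro ⟨h1, h2, _⟩; exact ⟨h2, h1⟩
      · rintro ⟨h1, h2⟩; exact ⟨h2, h1, h2.trans_lt htm⟩
    rw [h2, Real.volume_Icc, sub_zero]
    apply le_antisymm
    -- `fillMap` may be flat, so a point at level exactly t need not bound the sublevel set; points
    -- at levels t' > t do.
    · refine le_of_forall_gt_imp_ge_of_dense fun c hc => ?_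
      rcases eq_or_ne c ⊤ with rfl | hct
      · exact le_top
      obtain ⟨t', ht', ht'2⟩ : ∃ t', t < t' ∧ t' ≤ m ∧ ENNReal.ofReal t' ≤ c := by
        refine ⟨min m c.toReal, lt_min htm ((ENNReal.ofReal_lt_iff_lt_toReal ht hct).1 hc),
          min_le_left _ _, ?_⟩
        exact ENNReal.ofReal_le_of_le_toReal (min_le_right _ _)
      obtain ⟨b, hb⟩ := hlevel t' ⟨ht.trans ht'.le, ht'2.1⟩
      refine le_trans (measure_mono (t := Iic b) fun s hs => ?_) ((hIic b).le.trans ?_)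
      · by_contra hbs
        have h1 := fillMap_mono C (not_le.1 hbs).le
        have h2 : fillMap C s ≤ t := hs
        linarith
      · rw [hb]; exact ht'2.2
    · obtain ⟨b, hb⟩ := hlevel t ⟨ht, htm.le⟩
      rw [← hb, ← hIic]
      exact measure_mono fun s hs => fillMap_mono C hs
  · have h1 : fillMap C ⁻¹' Iic t = univ := by
      ext s; simp only [mem_preimage, mem_Iic, mem_univ, iff_true]
      exact (measureReal_mono inter_subset_left).trans htm
    have h2 : Iic t ∩ Ico 0 m = Ico 0 m := inter_eq_right.2 fun s hs => hs.2.le.trans htm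
    rw [h1, h2, huniv]; simp

/-- On each fibre of `κ` a measure preserving map onto an interval. -/
noncomputable def patchMap (κ : ℝ → ℕ) (s : ℝ) : ℝ := fillMap (κ ⁻¹' {κ s}) s

theorem measurable_patch {β : Type*} [MeasurableSpace β] {κ : ℝ → ℕ} (hκ : Measurable κ)
    {Ψ : ℕ → ℝ → β} (hΨ : ∀ k, Measurable (Ψ k)) :
    Measurable fun s => Ψ (κ s) (patchMap κ s) := by
  have : Measurable fun p : ℕ × ℝ => Ψ p.1 (fillMap (κ ⁻¹' {p.1}) p.2) :=
    measurable_from_prod_countable_right fun k =>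
      (hΨ k).comp (measurable_fillMap (κ ⁻¹' {k}))
  exact this.comp (hκ.prodMk measurable_id)

theorem lintegral_patch {κ : ℝ → ℕ} (hκ : Measurable κ) {Ψ : ℕ → ℝ → ℝ≥0∞}
    (hΨ : ∀ k, Measurable (Ψ k)) :
    ∫⁻ s, Ψ (κ s) (patchMap κ s) ∂leb
      = ∑' k, ∫⁻ t in Ico 0 (leb.real (κ ⁻¹' {k})), Ψ k t := by
  have hm : ∀ k, MeasurableSet (κ ⁻¹' {k}) := fun k => hκ (measurableSet_singleton k)
  have hU : (⋃ k, κ ⁻¹' {k}) = univ := by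
    ext s; simp
  rw [← setLIntegral_univ, ← hU, lintegral_iUnion hm]
  · refine tsum_congr fun k => ?_
    rw [← map_fillMap (hm k), lintegral_map (hΨ k) (measurable_fillMap _)]
    refine setLIntegral_congr_fun (hm k) fun s hs => ?_
    have : κ s = k := hs
    simp only [patchMap, this]
  · intro i j hij
    rw [Function.onFun, Set.disjoint_left]
    rintro s hs hs'
    exact hij ((show κ s = i from hs).symm.trans hs')

theorem ae_patch {κ : ℝ → ℕ} (hκ : Measurable κ) {P : ℕ → ℝ → Prop}
    (hP : ∀ k, ∀ᵐ t, t ∈ Ico 0 (leb.real (κ ⁻¹' {k})) → P k t) :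
    ∀ᵐ s ∂leb, patchMap κ s ∈ Ico 0 (leb.real (κ ⁻¹' {κ s})) ∧ P (κ s) (patchMap κ s) := by
  have hP' : ∀ k, ∀ᵐ t ∂(volume.restrict (Ico 0 (leb.real (κ ⁻¹' {k})))),
      t ∈ Ico 0 (leb.real (κ ⁻¹' {k})) ∧ P k t := fun k => by
    rw [ae_restrict_iff' measurableSet_Ico]
    filter_upwards [hP k] with t ht h using ⟨h, ht h⟩
  -- P need not be measurable, so the exceptional sets are enlarged to measurable null sets before
  -- integrating their indicators.
  let N : ℕ → Set ℝ := fun k => toMeasurable (volume.restrict (Ico 0 (leb.real (κ ⁻¹' {k}))))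
    {t | ¬ (t ∈ Ico 0 (leb.real (κ ⁻¹' {k})) ∧ P k t)}
  have hN : ∀ k, MeasurableSet (N k) := fun k => measurableSet_toMeasurable _ _
  have hΨ : ∀ k, Measurable ((N k).indicator (fun _ => (1 : ℝ≥0∞))) :=
    fun k => measurable_const.indicator (hN k)
  have h0 := lintegral_patch hκ hΨ
  have hz : ∀ k, ∫⁻ t in Ico 0 (leb.real (κ ⁻¹' {k})), (N k).indicator (fun _ => (1 : ℝ≥0∞)) t
      = 0 := fun k => by
    rw [lintegral_indicator_const (hN k), one_mul, measure_toMeasurable]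
    exact hP' k
  simp only [hz, tsum_zero] at h0
  rw [lintegral_eq_zero_iff (measurable_patch hκ hΨ)] at h0
  filter_upwards [h0] with s hs
  by_contra hc
  have : patchMap κ s ∈ N (κ s) := subset_toMeasurable _ _ hc
  simp [this] at hs

/-- Cutting off t ≤ 0, and using that x* vanishes from 1 on, gives an integrable function on the
whole line, as the translations of windows require. -/
theorem decr_rearr {x : L0} (hx : x.Integrable) : Decr ((Ioi 0).indicator (rearr x)) := by
  have hmeas : Measurable ((Ioi 0).indicator (rearr x)) := by
    refine measurable_of_Ioi fun r => ?_
    rcases lt_or_ge r 0 with hr | hr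
    · convert MeasurableSet.univ
      ext t
      simp only [mem_preimage, mem_Ioi, mem_univ, iff_true]
      exact hr.trans_le (indicator_nonneg (fun t _ => rearr_nonneg x t) t)
    · have : (Ioi 0).indicator (rearr x) ⁻¹' Ioi r
          = Ioi 0 ∩ {t | ENNReal.ofReal t < leb {w | r < |x w|}} := by
        ext t
        by_cases ht : 0 < t
        · simp [indicator, ht, lt_rearr_iff x hr ht]
        · simp [indicator, ht, hr]
      rw [this]
      exact measurableSet_Ioi.inter (measurableSet_lt ENNReal.measurable_ofReal measurable_const)
  refine ⟨hmeas, fun t => indicator_nonneg (fun t _ => rearr_nonneg x t) t, ?_, ?_⟩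
  · intro a ha b hb hab
    rw [indicator_of_mem ha, indicator_of_mem hb]
    exact rearr_antitoneOn_Ioi x ha hb hab
  · have hz : ∀ t, t ∉ Ioo (0 : ℝ) 1 → (Ioi 0).indicator (rearr x) t = 0 := by
      intro t ht
      by_cases h : 0 < t
      · rw [indicator_of_mem (show t ∈ Ioi (0 : ℝ) from h)]
        exact rearr_of_one_le x (not_lt.1 fun h1 => ht ⟨h, h1⟩)
      · exact indicator_of_notMem h _
    refine (integrableOn_iff_integrable_of_support_subset (s := Ioo 0 1) ?_).1 ?_
    · intro t ht
      by_contra hc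
      exact ht (hz t hc)
    · refine ⟨hmeas.aestronglyMeasurable, ?_⟩
      rw [hasFiniteIntegral_iff_ofReal (Eventually.of_forall fun t =>
        indicator_nonneg (fun t _ => rearr_nonneg x t) t),
        setLIntegral_congr_fun (g := fun t => ENNReal.ofReal (rearr x t)) measurableSet_Ioo
        (fun t ht => by simp only; rw [indicator_of_mem (show t ∈ Ioi (0 : ℝ) from ht.1)])]
      change headInt x 1 < ⊤
      rw [headInt_one, lt_top_iff_ne_top]
      exact tailInt_ne_top hx le_rfl

theorem headInt_eq_ofReal {x : L0} (hx : x.Integrable) {t : ℝ} (ht : 0 ≤ t) :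
    headInt x t = ENNReal.ofReal (∫ s in (0 : ℝ)..t, (Ioi 0).indicator (rearr x) s) := by
  have hD := decr_rearr hx
  rw [intervalIntegral.integral_of_le ht, integral_Ioc_eq_integral_Ioo,
    ofReal_integral_eq_lintegral_ofReal hD.int.integrableOn
      (Eventually.of_forall fun s => hD.nonneg s), headInt]
  refine setLIntegral_congr_fun measurableSet_Ioo fun s hs => ?_
  rw [indicator_of_mem (show s ∈ Ioi (0 : ℝ) from hs.1)]

theorem Majorized.headDom {x y : L0} (hx : x.Integrable) (h : Majorized y x) :
    HeadDom ((Ioi 0).indicator (rearr y)) ((Ioi 0).indicator (rearr x)) 1 := by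
  have hDx := decr_rearr hx
  have hDy := decr_rearr h.integrable
  constructor
  · rintro t ⟨ht, -⟩
    have := h.submajorized t ht
    change headInt y t ≤ headInt x t at this
    rw [headInt_eq_ofReal hx ht, headInt_eq_ofReal h.integrable ht] at this
    exact (ENNReal.ofReal_le_ofReal_iff
      (intervalIntegral.integral_nonneg ht fun s _ => hDx.nonneg s)).1 this
  · have := h.zero_eq
    rw [← headInt_one, ← headInt_one, headInt_eq_ofReal hx zero_le_one,
      headInt_eq_ofReal h.integrable zero_le_one] at this
    exact (ENNReal.ofReal_eq_ofReal_iff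
      (intervalIntegral.integral_nonneg zero_le_one fun s _ => hDy.nonneg s)
      (intervalIntegral.integral_nonneg zero_le_one fun s _ => hDx.nonneg s)).1 this

theorem lintegral_Ico_indicator_rearr (x : L0) {φ : ℝ → ℝ≥0∞} (hφ : Measurable φ) :
    ∫⁻ t in Ico 0 1, φ ((Ioi 0).indicator (rearr x) t) = ∫⁻ w, φ |x w| ∂leb := by
  rw [← lintegral_comp_rearr x hφ, setLIntegral_congr Ioo_ae_eq_Ico.symm]
  refine setLIntegral_congr_fun measurableSet_Ioo fun s hs => ?_
  rw [indicator_of_mem (show s ∈ Ioi (0 : ℝ) from hs.1)]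

theorem tendsto_leb_ge (y : L0) {δ : ℝ} (hδ : 0 < δ) :
    Tendsto (fun k : ℕ => leb.real {s | δ * k ≤ |y s|}) atTop (𝓝 0) := by
  have hmeas : Measurable (fun w => |y w|) := y.measurable.abs
  have hT : Tendsto (fun n : ℕ => leb {w | δ * n ≤ |y w|}) atTop
      (𝓝 (leb (⋂ n : ℕ, {w | δ * n ≤ |y w|}))) := by
    refine tendsto_measure_iInter_atTop
      (fun n => (measurableSet_le measurable_const hmeas).nullMeasurableSet) ?_
      ⟨0, measure_ne_top _ _⟩
    intro a b hab w hw
    have hw' : δ * b ≤ |y w| := hw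
    have : δ * a ≤ δ * b := by gcongr
    exact this.trans hw'
  have hE : (⋂ n : ℕ, {w | δ * n ≤ |y w|}) = ∅ := by
    ext w
    simp only [mem_iInter, mem_ofPred_eq, mem_empty_iff_false, iff_false, not_forall, not_le]
    obtain ⟨n, hn⟩ := exists_nat_gt (|y w| / δ)
    exact ⟨n, by rwa [div_lt_iff₀ hδ, mul_comm] at hn⟩
  rw [hE, measure_empty] at hT
  exact (ENNReal.tendsto_toReal ENNReal.zero_ne_top).comp hT

/-- If `y ≺ x` then `y` is approximated by averages of functions equimeasurable with `x`. -/
theorem Majorized.exists_average {x y : L0} (hx0 : 0 ≤ x) (hx : x.Integrable)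
    (h : Majorized y x) {n : ℕ} (hn : 0 < n) {δ : ℝ} (hδ : 0 < δ) :
    ∃ (z : ℕ → ℝ → ℝ) (e d : ℝ → ℝ), (∀ i, Measurable (z i)) ∧ Measurable e ∧ Measurable d ∧
      (∀ s, 0 ≤ e s) ∧ (∀ s, 0 ≤ d s) ∧ (∀ i < n, leb.map (z i) = leb.map x) ∧
      (∀ r, 0 ≤ r → ∫⁻ s, ENNReal.ofReal (e s - r) ∂leb ≤ tailInt x (n * r)) ∧
      (∀ r, 0 ≤ r → ∫⁻ s, ENNReal.ofReal (d s - r) ∂leb ≤ tailInt x (n * r)) ∧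
      ∀ᵐ s ∂leb, |y s - (∑ i ∈ Finset.range n, z i s) / n| ≤ δ + e s + d s := by
  have hyabs : Measurable fun s => |y s| := y.measurable.abs
  set M : ℕ → ℝ := fun k => leb.real {s | δ * k ≤ |y s|} with hMdef
  have hM0 : M 0 = 1 := by
    simp [hMdef]
  have hMnn : ∀ k, 0 ≤ M k := fun k => measureReal_nonneg
  have hManti : Antitone M := by
    intro a b hab
    refine measureReal_mono fun w hw => ?_
    have hw' : δ * b ≤ |y w| := hw
    have : δ * a ≤ δ * b := by gcongr
    exact this.trans hw'
  -- κ s indexes the band of height δ containing |y s|. The k-th band has measure M k - M (k+1), the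
  -- length of the k-th window.
  set κ : ℝ → ℕ := fun s => ⌊|y s| / δ⌋₊ with hκdef
  have hκ : Measurable κ := Nat.measurable_floor.comp (hyabs.div_const δ)
  have hκs : ∀ s, δ * κ s ≤ |y s| ∧ |y s| < δ * (κ s + 1) := by
    intro s
    have h0 : 0 ≤ |y s| / δ := by positivity
    have h1 := Nat.floor_le h0
    have h2 := Nat.lt_floor_add_one (|y s| / δ)
    rw [le_div_iff₀ hδ] at h1
    rw [div_lt_iff₀ hδ] at h2
    constructor <;> simp only [hκdef] <;> linarith
  have hmk : ∀ k, leb.real (κ ⁻¹' {k}) = M k - M (k + 1) := by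
    intro k
    have hsub : {s | δ * (k + 1 : ℕ) ≤ |y s|} ⊆ {s | δ * k ≤ |y s|} := by
      intro w hw
      have hw' : δ * (k + 1 : ℕ) ≤ |y w| := hw
      push_cast at hw'
      change δ * k ≤ |y w|
      linarith
    rw [hMdef]
    simp only
    rw [← measureReal_sdiff hsub (measurableSet_le measurable_const hyabs)]
    congr 1
    ext s
    simp only [mem_preimage, mem_singleton_iff, Set.mem_sdiff, mem_ofPred_eq, not_le]
    obtain ⟨h1, h2⟩ := hκs s
    constructor
    · rintro rfl; exact ⟨h1, by push_cast; exact h2⟩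
    · rintro ⟨h3, h4⟩
      push_cast at h4
      have a1 : (κ s : ℝ) < k + 1 := lt_of_mul_lt_mul_left (h1.trans_lt h4) hδ.le
      have a2 : (k : ℝ) < κ s + 1 := lt_of_mul_lt_mul_left (h3.trans_lt h2) hδ.le
      have b1 : κ s < k + 1 := by exact_mod_cast a1
      have b2 : k < κ s + 1 := by exact_mod_cast a2
      omega
  have hDx := decr_rearr hx
  have hDy := decr_rearr h.integrable
  obtain ⟨u, hu, hui, hulaw⟩ := hDx.exists_windows hDy hManti hMnn (tendsto_leb_ge y hδ)
    (by rw [hM0]; exact h.headDom hx)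
  rw [hM0] at hulaw
  simp only [← hmk] at hui hulaw
  have hlaw : ∀ φ : ℝ → ℝ≥0∞, Measurable φ →
      ∑' k, ∫⁻ t in Ico 0 (leb.real (κ ⁻¹' {k})), φ (u k t) = ∫⁻ w, φ |x w| ∂leb :=
    fun φ hφ => (hulaw φ hφ).trans (lintegral_Ico_indicator_rearr x hφ)
  -- The mean of a window is that of y* over [M (k+1), M k], where y* stays between δ k and δ (k+1),
  -- as |y| does on the band. This is the source of the error δ.
  have hmean : ∀ k, 0 < leb.real (κ ⁻¹' {k}) →
      δ * k ≤ (∫ s in (0 : ℝ)..leb.real (κ ⁻¹' {k}), u k s) / leb.real (κ ⁻¹' {k}) ∧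
      (∫ s in (0 : ℝ)..leb.real (κ ⁻¹' {k}), u k s) / leb.real (κ ⁻¹' {k}) ≤ δ * (k + 1) := by
    intro k hk
    rw [hui k, le_div_iff₀ hk, div_le_iff₀ hk, hmk k]
    have hle : M (k + 1) ≤ M k := hManti (Nat.le_succ k)
    have c : ∀ c : ℝ, c * (M k - M (k + 1)) = ∫ s in M (k + 1)..M k, c := fun c => by
      rw [intervalIntegral.integral_const, smul_eq_mul, mul_comm]
    rw [c, c]
    constructor
    · refine intervalIntegral.integral_mono_on_of_le_Ioo hle intervalIntegrable_const
        (hDy.ii _ _) fun s hs => ?_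
      have hs0 : 0 < s := (hMnn _).trans_lt hs.1
      rw [indicator_of_mem (show s ∈ Ioi (0 : ℝ) from hs0)]
      by_contra hc
      obtain ⟨r, hr1, hr2⟩ := exists_between (not_le.1 hc)
      have h1 := (rearr_le_iff y ((rearr_nonneg y s).trans hr1.le) hs0).1 hr1.le
      have h2 : M k ≤ s := by
        refine ENNReal.toReal_le_of_le_ofReal hs0.le (le_trans (measure_mono fun w hw => ?_) h1)
        exact hr2.trans_le hw
      linarith [hs.2]
    · refine intervalIntegral.integral_mono_on_of_le_Ioo hle
        (hDy.ii _ _) intervalIntegrable_const fun s hs => ?_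
      have hs0 : 0 < s := (hMnn _).trans_lt hs.1
      rw [indicator_of_mem (show s ∈ Ioi (0 : ℝ) from hs0)]
      refine (rearr_le_iff y (by positivity) hs0).2 ?_
      calc leb {w | δ * (k + 1) < |y w|} ≤ leb {w | δ * (k + 1 : ℕ) ≤ |y w|} := by
            refine measure_mono fun w hw => ?_
            push_cast
            exact le_of_lt (show δ * (k + 1) < |y w| from hw)
        _ = ENNReal.ofReal (M (k + 1)) := (ofReal_measureReal).symm
        _ ≤ ENNReal.ofReal s := ENNReal.ofReal_le_ofReal hs.1.le
  have hblock : ∀ k, ∃ (ζ : ℕ → ℝ → ℝ) (e : ℝ → ℝ) (d : ℝ), (∀ i, Measurable (ζ i)) ∧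
      Measurable e ∧ (∀ t, 0 ≤ e t) ∧ 0 ≤ d ∧
      (∀ i < n, ∀ φ : ℝ → ℝ≥0∞, Measurable φ →
        ∫⁻ t in Ico 0 (leb.real (κ ⁻¹' {k})), φ (ζ i t)
          = ∫⁻ t in Ico 0 (leb.real (κ ⁻¹' {k})), φ (u k t)) ∧
      (∀ r, 0 ≤ r → ∫⁻ t in Ico 0 (leb.real (κ ⁻¹' {k})), ENNReal.ofReal (e t - r)
        ≤ ∫⁻ t in Ico 0 (leb.real (κ ⁻¹' {k})), ENNReal.ofReal (u k t - n * r)) ∧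
      (∀ r, 0 ≤ r → ∫⁻ _ in Ico 0 (leb.real (κ ⁻¹' {k})), ENNReal.ofReal (d - r)
        ≤ ∫⁻ t in Ico 0 (leb.real (κ ⁻¹' {k})), ENNReal.ofReal (u k t - n * r)) ∧
      ∀ᵐ t, t ∈ Ico 0 (leb.real (κ ⁻¹' {k})) →
        |(∫ s in (0 : ℝ)..leb.real (κ ⁻¹' {k}), u k s) / leb.real (κ ⁻¹' {k})
          - (∑ i ∈ Finset.range n, ζ i t) / n| ≤ e t + d := by
    intro k
    rcases (measureReal_nonneg (μ := leb) (s := κ ⁻¹' {k})).eq_or_lt with h0 | h0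
    · rw [← h0]
      exact ⟨fun _ _ => 0, fun _ => 0, 0, fun _ => measurable_const, measurable_const,
        fun _ => le_rfl, le_rfl, by simp, by simp, by simp, by simp⟩
    · exact (hu k).exists_average h0 hn
  choose ζ e d hζm hem he0 hd0 hζlaw heb hdb hav using hblock
  -- Each band is mapped to its window by `patchMap` and the window approximants are pulled back.
  -- Summing over k restores the law of x, since the windows together exhaust x*.
  refine ⟨fun i s => ζ (κ s) i (patchMap κ s), fun s => e (κ s) (patchMap κ s),
    fun s => d (κ s), fun i => measurable_patch hκ fun k => hζm k i, measurable_patch hκ hem,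
    (measurable_from_nat (f := d)).comp hκ, fun s => he0 _ _, fun s => hd0 _, ?_, ?_, ?_, ?_⟩
  · intro i hi
    have hzm : Measurable fun s => ζ (κ s) i (patchMap κ s) :=
      measurable_patch hκ fun k => hζm k i
    have hxabs : leb.map x = leb.map fun w => |x w| := by
      refine Measure.map_congr ?_
      filter_upwards [L0_nonneg_ae hx0] with s hs
      rw [abs_of_nonneg hs]
    rw [hxabs]
    ext S hS
    have hφ : Measurable (S.indicator (fun _ => (1 : ℝ≥0∞))) := measurable_const.indicator hS
    rw [← lintegral_indicator_one hS, ← lintegral_indicator_one hS]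
    change ∫⁻ a, S.indicator (fun _ => (1 : ℝ≥0∞)) a ∂_ = ∫⁻ a, S.indicator (fun _ => 1) a ∂_
    rw [lintegral_map hφ hzm, lintegral_map hφ x.measurable.abs, ← hlaw _ hφ,
      lintegral_patch hκ (Ψ := fun k t => S.indicator (fun _ => (1 : ℝ≥0∞)) (ζ k i t))
        fun k => hφ.comp (hζm k i)]
    exact tsum_congr fun k => hζlaw k i hi _ hφ
  · intro r hr
    rw [lintegral_patch hκ (Ψ := fun k t => ENNReal.ofReal (e k t - r))
      fun k => ((hem k).sub_const r).ennreal_ofReal, tailInt,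
      ← hlaw (fun v => ENNReal.ofReal (v - n * r)) (by fun_prop)]
    exact ENNReal.tsum_le_tsum fun k => heb k r hr
  · intro r hr
    rw [lintegral_patch hκ (Ψ := fun k _ => ENNReal.ofReal (d k - r))
      fun k => measurable_const, tailInt,
      ← hlaw (fun v => ENNReal.ofReal (v - n * r)) (by fun_prop)]
    exact ENNReal.tsum_le_tsum fun k => hdb k r hr
  · filter_upwards [ae_patch hκ hav, L0_nonneg_ae h.nonneg] with s hs hys
    obtain ⟨hmem, hb⟩ := hs
    obtain ⟨h1, h2⟩ := hκs s
    rw [abs_of_nonneg hys] at h1 h2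
    obtain ⟨h3, h4⟩ := hmean (κ s) (hmem.1.trans_lt hmem.2)
    rw [abs_le] at hb ⊢
    constructor <;> linarith

end FullySymm

/-! ### Approximation in the orbit, and Ryff's theorem. -/

namespace FullySymm

/-- Use the duality for v at level r/n, where r is the minimizer for x at t/n; the terms (r/n) t and
r (t/n) coincide. -/
theorem headInt_le_of_tailInt_mul {v x : L0} {n : ℝ} (hn : 0 < n)
    (h : ∀ r, 0 ≤ r → tailInt v r ≤ tailInt x (n * r)) {t : ℝ} (ht : 0 < t) :
    headInt v t ≤ headInt x (t / n) := by
  obtain ⟨r, hr, e⟩ := exists_headInt_eq x (div_pos ht hn)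
  rw [e]
  refine (headInt_le v (r := r / n) (div_nonneg hr hn.le)).trans ?_
  have h1 := h (r / n) (div_nonneg hr hn.le)
  rw [mul_div_cancel₀ _ hn.ne'] at h1
  rw [show r / n * t = r * (t / n) by ring]
  gcongr

theorem tendsto_headInt_zero {x : L0} (hx : x.Integrable) :
    Tendsto (headInt x) (𝓝[≥] 0) (𝓝 0) := by
  have hD := decr_rearr hx
  have h1 : Tendsto (fun t : ℝ => ENNReal.ofReal
      (∫ s in (0 : ℝ)..t, (Ioi 0).indicator (rearr x) s)) (𝓝[≥] 0) (𝓝 0) := by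
    have hc : Continuous fun t : ℝ => ENNReal.ofReal
        (∫ s in (0 : ℝ)..t, (Ioi 0).indicator (rearr x) s) :=
      ENNReal.continuous_ofReal.comp
        (intervalIntegral.continuous_primitive (fun a b => hD.ii a b) 0)
    simpa using (hc.tendsto 0).mono_left nhdsWithin_le_nhds
  refine h1.congr' ?_
  filter_upwards [self_mem_nhdsWithin] with t ht
  exact (headInt_eq_ofReal hx ht).symm

theorem map_mk {f : ℝ → ℝ} (hf : Measurable f) :
    leb.map (AEEqFun.mk f hf.aestronglyMeasurable : L0) = leb.map f :=
  Measure.map_congr (AEEqFun.coeFn_mk _ _)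

theorem mk_nonneg {f : ℝ → ℝ} (hf : Measurable f) (h : ∀ s, 0 ≤ f s) :
    (0 : L0) ≤ AEEqFun.mk f hf.aestronglyMeasurable :=
  L0_nonneg_of_ae <| (AEEqFun.coeFn_mk f hf.aestronglyMeasurable).mono fun s hs => by
    rw [hs]; exact h s

theorem tailInt_mk {f : ℝ → ℝ} (hf : Measurable f) (h : ∀ s, 0 ≤ f s) (r : ℝ) :
    tailInt (AEEqFun.mk f hf.aestronglyMeasurable) r = ∫⁻ s, ENNReal.ofReal (f s - r) ∂leb :=
  lintegral_congr_ae <| (AEEqFun.coeFn_mk f hf.aestronglyMeasurable).mono fun s hs => by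
    simp only [hs, abs_of_nonneg (h s)]

/-- If `y ≺ x` then `y` is approximated by convex combinations of functions equimeasurable
with `x`. -/
theorem Majorized.exists_convexHull {x y : L0} (hx0 : 0 ≤ x) (hx : x.Integrable)
    (h : Majorized y x) {n : ℕ} (hn : 0 < n) {δ : ℝ} (hδ : 0 < δ) :
    ∃ w e d : L0, w ∈ convexHull ℝ {z : L0 | leb.map z = leb.map x} ∧ 0 ≤ e ∧ 0 ≤ d ∧
      (∀ t, 0 < t → headInt e t ≤ headInt x (t / n)) ∧
      (∀ t, 0 < t → headInt d t ≤ headInt x (t / n)) ∧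
      ∀ᵐ s ∂leb, |y s - w s| ≤ δ + e s + d s := by
  have hn' : (0 : ℝ) < n := Nat.cast_pos.2 hn
  obtain ⟨z, e, d, hz, he, hd, he0, hd0, hlaw, heb, hdb, hav⟩ := h.exists_average hx0 hx hn hδ
  refine ⟨∑ i ∈ Finset.range n, (n : ℝ)⁻¹ • (AEEqFun.mk (z i) (hz i).aestronglyMeasurable : L0),
    AEEqFun.mk e he.aestronglyMeasurable, AEEqFun.mk d hd.aestronglyMeasurable, ?_,
    mk_nonneg he he0, mk_nonneg hd hd0, fun t ht => ?_, fun t ht => ?_, ?_⟩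
  · refine (convex_convexHull ℝ _).sum_mem (fun i _ => by positivity) ?_ fun i hi => ?_
    · simp [hn.ne']
    · refine subset_convexHull ℝ _ ?_
      rw [mem_ofPred_eq, map_mk (hz i)]
      exact hlaw i (Finset.mem_range.1 hi)
  · refine headInt_le_of_tailInt_mul hn' (fun r hr => ?_) ht
    rw [tailInt_mk he he0]
    exact heb r hr
  · refine headInt_le_of_tailInt_mul hn' (fun r hr => ?_) ht
    rw [tailInt_mk hd hd0]
    exact hdb r hr
  · have hs1 : ∀ᵐ s ∂leb, ∀ i : ℕ, ((n : ℝ)⁻¹ •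
        (AEEqFun.mk (z i) (hz i).aestronglyMeasurable : L0)) s = (n : ℝ)⁻¹ * z i s := by
      rw [ae_all_iff]
      intro i
      filter_upwards [AEEqFun.coeFn_smul (n : ℝ)⁻¹
        (AEEqFun.mk (z i) (hz i).aestronglyMeasurable : L0),
        AEEqFun.coeFn_mk (z i) (hz i).aestronglyMeasurable] with s h1 h2
      rw [h1, Pi.smul_apply, h2, smul_eq_mul]
    filter_upwards [hav, hs1, AEEqFun.coeFn_finsetSum (Finset.range n) (fun i =>
      (n : ℝ)⁻¹ • (AEEqFun.mk (z i) (hz i).aestronglyMeasurable : L0)),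
      AEEqFun.coeFn_mk e he.aestronglyMeasurable, AEEqFun.coeFn_mk d hd.aestronglyMeasurable]
      with s h1 h2 h3 h4 h5
    rw [h3, h4, h5, Finset.sum_apply, Finset.sum_congr rfl fun i _ => h2 i, ← Finset.mul_sum,
      inv_mul_eq_div]
    exact h1

theorem lintegral_eq_headInt {x : L0} (hx : 0 ≤ x) :
    ∫⁻ s, ENNReal.ofReal (x s) ∂leb = headInt x 1 := by
  rw [headInt_one, tailInt_of_nonneg hx]
  simp

theorem tendsto_headInt_one_div {x : L0} (hx : x.Integrable) :
    Tendsto (fun k : ℕ => headInt x (1 / ((k + 1 : ℕ) : ℝ))) atTop (𝓝 0) := by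
  refine (tendsto_headInt_zero hx).comp (tendsto_nhdsWithin_iff.2 ⟨?_, ?_⟩)
  · have := tendsto_one_div_add_atTop_nhds_zero_nat (𝕜 := ℝ)
    simpa using this
  · exact Eventually.of_forall fun k => by
      rw [mem_Ici]; positivity

/-- Orbits are closed in `L₁`. -/
theorem mem_orbit_of_tendsto {x y : L0} (hx : x.Integrable) (hy : y.Integrable) {w : ℕ → L0}
    (hw : ∀ k, w k ∈ orbit x)
    (hlim : Tendsto (fun k => ∫⁻ s, ENNReal.ofReal |y s - w k s| ∂leb) atTop (𝓝 0)) :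
    y ∈ orbit x := by
  have hstep : ∀ k : ℕ, ∃ T : Lp ℝ 1 leb →L[ℝ] Lp ℝ 1 leb, IsDoublyStochastic T ∧
      w k = (T (hx.toL1 x) : L0) := by
    intro k
    obtain ⟨f, hf, T, hT, e⟩ := hw k
    have hfx : f = hx.toL1 x := Subtype.ext (by
      rw [hf]; simp [Integrable.toL1, MemLp.toLp])
    subst hfx
    exact ⟨T, hT, e⟩
  choose T hT hTw using hstep
  have hlim' : Tendsto (fun k => T k (hx.toL1 x)) atTop (𝓝 (hy.toL1 y)) := by
    rw [tendsto_iff_edist_tendsto_0]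
    refine hlim.congr fun k => ?_
    rw [edist_dist, dist_eq_norm, L1.ofReal_norm_sub_eq_lintegral]
    refine lintegral_congr_ae ?_
    filter_upwards [hy.coeFn_toL1] with s h2
    rw [h2, Real.enorm_eq_ofReal_abs, abs_sub_comm, hTw k]
  obtain ⟨S, hS, hSe⟩ := exists_isDoublyStochastic_of_tendsto hT hlim'
  refine ⟨hx.toL1 x, by simp [Integrable.toL1, MemLp.toLp], S, hS, ?_⟩
  rw [hSe]
  simp [Integrable.toL1, MemLp.toLp]

/-- Ryff's theorem: the orbit of `x` contains every `y` majorized by `x`. -/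
theorem Majorized.mem_orbit {x y : L0} (hx0 : 0 ≤ x) (hx : x.Integrable)
    (h : Majorized y x) : y ∈ orbit x := by
  -- With n = k + 1 and δ = 1/(k+1), each error function has L₁ norm at most the integral of x* over
  -- (0, 1/(k+1)), which tends to 0 for every integrable x.
  have hstep : ∀ k : ℕ, ∃ w ∈ orbit x, ∫⁻ s, ENNReal.ofReal |y s - w s| ∂leb ≤
      ENNReal.ofReal (1 / ((k + 1 : ℕ) : ℝ)) +
        headInt x (1 / ((k + 1 : ℕ) : ℝ)) + headInt x (1 / ((k + 1 : ℕ) : ℝ)) := by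
    intro k
    obtain ⟨w, e, d, hw, he0, hd0, he, hd, hb⟩ := h.exists_convexHull hx0 hx (Nat.succ_pos k)
      (δ := 1 / ((k + 1 : ℕ) : ℝ)) (by positivity)
    refine ⟨w, convexHull_min (fun z hz => mem_orbit_of_map_eq hx hz) (convex_orbit x) hw, ?_⟩
    calc _ ≤ ∫⁻ s, (ENNReal.ofReal (1 / ((k + 1 : ℕ) : ℝ)) + ENNReal.ofReal (e s) +
          ENNReal.ofReal (d s)) ∂leb := by
          refine lintegral_mono_ae ?_
          filter_upwards [hb, L0_nonneg_ae he0, L0_nonneg_ae hd0] with s h1 h3 h4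
          have hk : (0 : ℝ) ≤ 1 / ((k + 1 : ℕ) : ℝ) := by positivity
          rw [← ENNReal.ofReal_add hk h3, ← ENNReal.ofReal_add (add_nonneg hk h3) h4]
          exact ENNReal.ofReal_le_ofReal h1
      _ ≤ _ := by
          rw [lintegral_add_right _ d.measurable.ennreal_ofReal,
            lintegral_add_right _ e.measurable.ennreal_ofReal, lintegral_eq_headInt he0,
            lintegral_eq_headInt hd0, lintegral_const, leb_univ, mul_one]
          gcongr
          · exact he 1 one_pos
          · exact hd 1 one_pos
  choose w hw hwb using hstep
  refine mem_orbit_of_tendsto hx h.integrable hw ?_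
  refine tendsto_of_tendsto_of_tendsto_of_le_of_le tendsto_const_nhds ?_ (fun _ => zero_le) hwb
  have h1 : Tendsto (fun k : ℕ => ENNReal.ofReal (1 / ((k + 1 : ℕ) : ℝ))) atTop (𝓝 0) := by
    have := ENNReal.tendsto_ofReal (tendsto_one_div_add_atTop_nhds_zero_nat (𝕜 := ℝ))
    simpa using this
  simpa using (h1.add (tendsto_headInt_one_div hx)).add (tendsto_headInt_one_div hx)

end FullySymm

/-! ### Extreme points of the orbit. -/

namespace FullySymm

theorem tailInt_eq_of_map_eq {x z : L0} (h : leb.map z = leb.map x) (r : ℝ) :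
    tailInt z r = tailInt x r := by
  have hφ : Measurable fun v : ℝ => ENNReal.ofReal (|v| - r) := by fun_prop
  rw [tailInt, tailInt, ← lintegral_map hφ z.measurable, h, lintegral_map hφ x.measurable]

/-- Functions equimeasurable with `x` are extreme points of the orbit of `x`. -/
theorem mem_extremePoints_of_map_eq {x z : L0} (hx0 : 0 ≤ x) (hx : x.Integrable)
    (h : leb.map z = leb.map x) : z ∈ (orbit x).extremePoints ℝ := by
  have hz := mem_orbit_of_map_eq hx h
  refine mem_extremePoints_iff_left.2 ⟨hz, fun u hu v hv => ?_⟩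
  rintro ⟨a, b, ha, hb, hab, huv⟩
  have hzM := majorized_of_mem_orbit hx0 hz
  have huM := majorized_of_mem_orbit hx0 hu
  have hvM := majorized_of_mem_orbit hx0 hv
  have hco : ∀ᵐ s ∂leb, z s = a * u s + b * v s := by
    rw [← huv]
    filter_upwards [AEEqFun.coeFn_add (a • u) (b • v), AEEqFun.coeFn_smul a u,
      AEEqFun.coeFn_smul b v] with s h1 h2 h3
    rw [h1, Pi.add_apply, h2, h3]
    rfl
  -- Convexity of (· - q)₊ gives one pointwise inequality, while u, v ≺ x and z equimeasurable with
  -- x give the opposite inequality of integrals. Rational levels keep the exceptional null set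
  -- countable.
  have hq : ∀ q : ℚ, 0 ≤ q → ∀ᵐ s ∂leb, ENNReal.ofReal (z s - q) =
      ENNReal.ofReal a * ENNReal.ofReal (u s - q) + ENNReal.ofReal b * ENNReal.ofReal (v s - q) := by
    intro q hq
    have hq' : (0 : ℝ) ≤ q := Rat.cast_nonneg.2 hq
    have hm : ∀ w : L0, Measurable fun s => ENNReal.ofReal (w s - q) := fun w =>
      (w.measurable.sub_const _).ennreal_ofReal
    refine ae_eq_of_ae_le_of_lintegral_le ?_ ?_ ?_ ?_
    · filter_upwards [hco] with s hs
      rw [← ENNReal.ofReal_mul ha.le, ← ENNReal.ofReal_mul hb.le]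
      refine le_trans (ENNReal.ofReal_le_ofReal ?_) ENNReal.ofReal_add_le
      rw [hs]
      have : (q : ℝ) = a * q + b * q := by rw [← add_mul, hab, one_mul]
      linarith
    · rw [← tailInt_of_nonneg hzM.nonneg]
      exact tailInt_ne_top hzM.integrable hq'
    · exact (((hm u).const_mul _).add ((hm v).const_mul _)).aemeasurable
    · rw [lintegral_add_left ((hm u).const_mul _), lintegral_const_mul _ (hm u),
        lintegral_const_mul _ (hm v), ← tailInt_of_nonneg hzM.nonneg,
        ← tailInt_of_nonneg huM.nonneg, ← tailInt_of_nonneg hvM.nonneg,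
        tailInt_eq_of_map_eq h]
      calc _ ≤ ENNReal.ofReal a * tailInt x q + ENNReal.ofReal b * tailInt x q := by
            gcongr
            exacts [huM.tailInt_le _ hq', hvM.tailInt_le _ hq']
        _ = tailInt x q := by
            rw [← add_mul, ← ENNReal.ofReal_add ha.le hb.le, hab]; simp
  have hall : ∀ᵐ s ∂leb, ∀ q : ℚ, 0 ≤ q → ENNReal.ofReal (z s - q) =
      ENNReal.ofReal a * ENNReal.ofReal (u s - q) +
        ENNReal.ofReal b * ENNReal.ofReal (v s - q) := by
    rw [ae_all_iff]
    intro q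
    by_cases h : 0 ≤ q
    · filter_upwards [hq q h] with s hs _ using hs
    · exact Eventually.of_forall fun s h' => absurd h' h
  refine AEEqFun.ext ?_
  filter_upwards [hall, hco, L0_nonneg_ae huM.nonneg, L0_nonneg_ae hvM.nonneg] with s hs hzs hus hvs
  -- At a rational level strictly between p and q the convexity inequality is strict.
  have key : ∀ {a b p q : ℝ}, 0 < a → 0 < b → a + b = 1 → 0 ≤ p → p < q →
      (∀ c : ℚ, 0 ≤ c → ENNReal.ofReal (a * p + b * q - c) =
        ENNReal.ofReal a * ENNReal.ofReal (p - c) + ENNReal.ofReal b * ENNReal.ofReal (q - c)) →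
      False := by
    intro a b p q ha hb hab hp hpq H
    obtain ⟨c, hc1, hc2⟩ := exists_rat_btwn hpq
    have hc0 : (0 : ℚ) ≤ c := Rat.cast_nonneg.1 (hp.trans hc1.le)
    have := H c hc0
    rw [ENNReal.ofReal_of_nonpos (p := p - c) (by linarith), mul_zero, zero_add,
      ← ENNReal.ofReal_mul hb.le] at this
    have hpos : 0 < b * (q - c) := mul_pos hb (by linarith)
    have h1 : 0 < a * p + b * q - c := by
      by_contra hc
      rw [ENNReal.ofReal_of_nonpos (not_lt.1 hc), eq_comm, ENNReal.ofReal_eq_zero] at this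
      linarith
    rw [ENNReal.ofReal_eq_ofReal_iff h1.le hpos.le] at this
    have h2 : a * p = a * c := by
      have : a * c = c - b * c := by
        have : a = 1 - b := by linarith
        rw [this]; ring
      linarith
    have := mul_left_cancel₀ ha.ne' h2
    linarith
  rw [hzs]
  rcases lt_trichotomy (u s) (v s) with hlt | heq | hlt
  · refine (key ha hb hab hus hlt fun c hc => ?_).elim
    rw [← hzs]; exact hs c hc
  · rw [← heq, ← add_mul, hab, one_mul]
  · refine (key hb ha (by linarith) hvs hlt fun c hc => ?_).elim
    rw [add_comm, ← hzs, add_comm (ENNReal.ofReal b * _)]; exact hs c hc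

/-- `∫ (x - c)₊` as a real number. -/
noncomputable def cutInt (x : ℝ → ℝ) (c : ℝ) : ℝ := ∫ s, max (x s - c) 0 ∂leb

section cutInt

variable {x : ℝ → ℝ}

theorem integrable_cut (hx : Integrable x leb) (c : ℝ) :
    Integrable (fun s => max (x s - c) 0) leb :=
  (hx.sub (integrable_const c)).pos_part

theorem cutInt_nonneg (c : ℝ) : 0 ≤ cutInt x c := integral_nonneg fun _ => le_max_right _ _

theorem cutInt_anti (hx : Integrable x leb) {c d : ℝ} (h : c ≤ d) : cutInt x d ≤ cutInt x c :=
  integral_mono (integrable_cut hx d) (integrable_cut hx c) fun s => by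
    simp only
    exact max_le_max (by linarith) le_rfl

theorem cutInt_le_add (hx : Integrable x leb) (c d : ℝ) :
    cutInt x c ≤ cutInt x d + |c - d| := by
  have : cutInt x d + |c - d| = ∫ s, (max (x s - d) 0 + |c - d|) ∂leb := by
    rw [integral_add (integrable_cut hx d) (integrable_const _)]
    simp [cutInt]
  rw [this]
  refine integral_mono (integrable_cut hx c)
    ((integrable_cut hx d).add (integrable_const _)) fun s => ?_
  have h1 := neg_abs_le (c - d)
  have h2 := abs_nonneg (c - d)
  simp only
  refine max_le ?_ (by positivity)
  have := le_max_left (x s - d) 0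
  linarith

theorem continuous_cutInt (hx : Integrable x leb) : Continuous (cutInt x) :=
  (LipschitzWith.of_le_add (f := cutInt x) fun c d => by
    rw [Real.dist_eq]; exact cutInt_le_add hx c d).continuous

theorem cutInt_convex (hx : Integrable x leb) {a b c d : ℝ} (ha : 0 ≤ a) (hb : 0 ≤ b)
    (hab : a + b = 1) : cutInt x (a * c + b * d) ≤ a * cutInt x c + b * cutInt x d := by
  simp only [cutInt]
  rw [← integral_const_mul, ← integral_const_mul,
    ← integral_add ((integrable_cut hx c).const_mul a) ((integrable_cut hx d).const_mul b)]
  refine integral_mono (integrable_cut hx _)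
    (((integrable_cut hx c).const_mul a).add ((integrable_cut hx d).const_mul b)) fun s => ?_
  simp only
  refine max_le ?_ (by positivity)
  have h1 := mul_le_mul_of_nonneg_left (le_max_left (x s - c) 0) ha
  have h2 := mul_le_mul_of_nonneg_left (le_max_left (x s - d) 0) hb
  have h3 : x s = a * x s + b * x s := by rw [← add_mul, hab, one_mul]
  linarith

end cutInt

theorem tailInt_eq_cutInt {x : L0} (hx0 : 0 ≤ x) (hx : x.Integrable) (c : ℝ) :
    tailInt x c = ENNReal.ofReal (cutInt x c) := by
  rw [tailInt_of_nonneg hx0, cutInt, ofReal_integral_eq_lintegral_ofReal (integrable_cut hx c)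
    (Eventually.of_forall fun s => le_max_right _ _)]
  simp [ENNReal.ofReal_max]

theorem majorized_mk {x : L0} (hx0 : 0 ≤ x) (hx : x.Integrable) {f : ℝ → ℝ} (hf : Measurable f)
    (hf0 : ∀ᵐ s ∂leb, 0 ≤ f s) (hfi : Integrable f leb) (h0 : cutInt f 0 = cutInt x 0)
    (h : ∀ r, 0 ≤ r → cutInt f r ≤ cutInt x r) :
    Majorized (AEEqFun.mk f hf.aestronglyMeasurable) x := by
  have hco := AEEqFun.coeFn_mk (μ := leb) f hf.aestronglyMeasurable
  have h1 : (0 : L0) ≤ AEEqFun.mk f hf.aestronglyMeasurable :=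
    L0_nonneg_of_ae <| by
      filter_upwards [hco, hf0] with s h1 h2
      rwa [h1]
  have h2 : (AEEqFun.mk f hf.aestronglyMeasurable : L0).Integrable :=
    (integrable_congr hco).2 hfi
  have h3 : ∀ r, cutInt (AEEqFun.mk f hf.aestronglyMeasurable : L0) r = cutInt f r := fun r =>
    integral_congr_ae <| hco.mono fun s hs => by simp only [hs]
  refine ⟨h1, h2, ?_, fun r hr => ?_⟩
  · rw [tailInt_eq_cutInt h1 h2, tailInt_eq_cutInt hx0 hx, h3, h0]
  · rw [tailInt_eq_cutInt h1 h2, tailInt_eq_cutInt hx0 hx, h3]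
    exact ENNReal.ofReal_le_ofReal (h r hr)

/-- If `z ≺ x` is not tight at a level `v` near which `z` takes values, then `z` is not an
extreme point. -/
theorem not_mem_extremePoints_of_gap {x z : L0} (hx0 : 0 ≤ x) (hx : x.Integrable)
    (hz : Majorized z x) {v : ℝ} (hv : 0 < v) (hgap : cutInt z v < cutInt x v)
    (hsupp : ∀ η > 0, 0 < leb (z ⁻¹' Icc (v - η) (v + η))) :
    z ∉ (orbit x).extremePoints ℝ := by
  intro hext
  have hzi : Integrable z leb := hz.integrable
  set D := cutInt x v - cutInt z v with hD
  have hD0 : 0 < D := sub_pos.2 hgap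
  -- v/2 keeps the perturbed function nonnegative. D/8 protects the gap at levels within 2η of v:
  -- the two 1-Lipschitz truncation integrals cost 2η each and the perturbation costs η, in total 5η
  -- < D.
  set η := min (v / 2) (D / 8) with hη
  have hη0 : 0 < η := by positivity
  have hηv : η ≤ v / 2 := min_le_left _ _
  have hηD : η ≤ D / 8 := min_le_right _ _
  set B := z ⁻¹' Icc (v - η) (v + η) with hB
  have hBm : MeasurableSet B := z.measurable measurableSet_Icc
  have hBpos : 0 < leb.real B := ENNReal.toReal_pos (hsupp η hη0).ne' (measure_ne_top _ _)
  -- B is split into two halves of equal measure; adding η on one and subtracting it on the other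
  -- leaves the integral unchanged.
  obtain ⟨b, hb⟩ : ∃ b, fillMap B b = leb.real B / 2 := by
    have := intermediate_value_Icc zero_le_one (fillMap_lipschitz B).continuous.continuousOn
    rw [fillMap_zero, fillMap_one hBm] at this
    obtain ⟨b, -, hb⟩ := this (show leb.real B / 2 ∈ Icc 0 (leb.real B) from
      ⟨by positivity, by linarith⟩)
    exact ⟨b, hb⟩
  set p : ℝ → ℝ := fun s => η * ((B ∩ Iic b).indicator 1 s - (B \ Iic b).indicator 1 s) with hp
  have hB1 : MeasurableSet (B ∩ Iic b) := hBm.inter measurableSet_Iic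
  have hB2 : MeasurableSet (B \ Iic b) := MeasurableSet.diff hBm measurableSet_Iic
  have hpm : Measurable p :=
    ((measurable_one.indicator hB1).sub (measurable_one.indicator hB2)).const_mul η
  have hpB : ∀ s, s ∉ B → p s = 0 := by
    intro s hs
    simp [hp, hs]
  have hpB' : ∀ s ∈ B, |p s| = η := by
    intro s hs
    by_cases h : s ∈ Iic b
    · simp only [hp]
      rw [indicator_of_mem (show s ∈ B ∩ Iic b from ⟨hs, h⟩),
        indicator_of_notMem (show s ∉ B \ Iic b from fun h' => h'.2 h)]
      simp [abs_of_pos hη0]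
    · simp only [hp]
      rw [indicator_of_notMem (show s ∉ B ∩ Iic b from fun h' => h h'.2),
        indicator_of_mem (show s ∈ B \ Iic b from ⟨hs, h⟩)]
      simp [abs_of_pos hη0]
  have hple : ∀ s, |p s| ≤ η := by
    intro s
    by_cases h : s ∈ B
    · exact (hpB' s h).le
    · rw [hpB s h]; simpa using hη0.le
  have hpi : Integrable p leb :=
    Integrable.of_bound hpm.aestronglyMeasurable η (Eventually.of_forall fun s => hple s)
  have hpint : ∫ s, p s ∂leb = 0 := by
    have h1 : leb.real (B ∩ Iic b) = leb.real B / 2 := hb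
    have h2 : leb.real (B \ Iic b) = leb.real B / 2 := by
      have := measureReal_sdiff_add_inter (μ := leb) (s := B) measurableSet_Iic (t := Iic b)
      linarith
    rw [hp, integral_const_mul, integral_sub ((integrable_const _).indicator hB1)
      ((integrable_const _).indicator hB2), integral_indicator_one hB1, integral_indicator_one hB2,
      h1, h2, sub_self, mul_zero]
  have hmaj : ∀ σ : ℝ, |σ| = 1 → Majorized
      (AEEqFun.mk (fun s => z s + σ * p s) (z.measurable.add (hpm.const_mul σ)).aestronglyMeasurable)
      x := by
    intro σ hσ
    have hσp : ∀ s, |σ * p s| ≤ η := fun s => by rw [abs_mul, hσ, one_mul]; exact hple s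
    have hfi : Integrable (fun s => z s + σ * p s) leb := hzi.add (hpi.const_mul σ)
    have hlin : ∫ s, σ * p s ∂leb = 0 := by rw [integral_const_mul, hpint, mul_zero]
    -- Below v - 2η the truncation is linear on B before and after the perturbation, so the zero
    -- mean of p suffices; above v + 2η it vanishes on B.
    have hlow : ∀ c, c ≤ v - 2 * η → cutInt (fun s => z s + σ * p s) c = cutInt z c := by
      intro c hc
      have : cutInt (fun s => z s + σ * p s) c = cutInt z c + ∫ s, σ * p s ∂leb := by
        rw [cutInt, cutInt, ← integral_add (integrable_cut hzi c) (hpi.const_mul σ)]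
        congr 1
        ext s
        by_cases hs : s ∈ B
        · have h1 := (abs_le.1 (hσp s)).1
          have h2 : v - η ≤ z s := hs.1
          rw [max_eq_left (by linarith), max_eq_left (by linarith)]
          ring
        · rw [hpB s hs]; simp
      rw [this, hlin, add_zero]
    have hhigh : ∀ c, v + 2 * η ≤ c → cutInt (fun s => z s + σ * p s) c = cutInt z c := by
      intro c hc
      rw [cutInt, cutInt]
      congr 1
      ext s
      by_cases hs : s ∈ B
      · have h1 := (abs_le.1 (hσp s)).2
        have h2 : z s ≤ v + η := hs.2
        rw [max_eq_right (by linarith), max_eq_right (by linarith)]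
      · rw [hpB s hs]; simp
    have hmid : ∀ c, cutInt (fun s => z s + σ * p s) c ≤ cutInt z c + η := by
      intro c
      have e : cutInt z c + η = ∫ s, (max (z s - c) 0 + η) ∂leb := by
        rw [integral_add (integrable_cut hzi c) (integrable_const _)]
        simp [cutInt]
      rw [e]
      refine integral_mono (integrable_cut hfi c)
        ((integrable_cut hzi c).add (integrable_const _)) fun s => ?_
      have h1 := (abs_le.1 (hσp s)).2
      have h2 := le_max_left (z s - c) 0
      have h3 := le_max_right (z s - c) 0
      simp only
      exact max_le (by linarith) (by linarith)
    have hzle : ∀ r, 0 ≤ r → cutInt z r ≤ cutInt x r := by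
      intro r hr
      have := hz.tailInt_le r hr
      rw [tailInt_eq_cutInt hz.nonneg hz.integrable, tailInt_eq_cutInt hx0 hx] at this
      exact (ENNReal.ofReal_le_ofReal_iff (cutInt_nonneg r)).1 this
    refine majorized_mk (f := fun s => z s + σ * p s) hx0 hx (z.measurable.add (hpm.const_mul σ)) ?_ hfi ?_ ?_
    · filter_upwards [L0_nonneg_ae hz.nonneg] with s hs
      by_cases hsB : s ∈ B
      · have h1 := (abs_le.1 (hσp s)).1
        have h2 : v - η ≤ z s := hsB.1
        linarith
      · rw [hpB s hsB]; simpa using hs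
    · rw [hlow 0 (by linarith)]
      have := hz.zero_eq
      rw [tailInt_eq_cutInt hz.nonneg hz.integrable, tailInt_eq_cutInt hx0 hx] at this
      exact (ENNReal.ofReal_eq_ofReal_iff (cutInt_nonneg 0) (cutInt_nonneg 0)).1 this
    · intro r hr
      rcases le_or_gt r (v - 2 * η) with h1 | h1
      · rw [hlow r h1]; exact hzle r hr
      rcases le_or_gt (v + 2 * η) r with h2 | h2
      · rw [hhigh r h2]; exact hzle r hr
      refine (hmid r).trans ?_
      have habs : |r - v| ≤ 2 * η := abs_le.2 ⟨by linarith, by linarith⟩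
      have h3 := cutInt_le_add hzi r v
      have h4 := cutInt_le_add (x := x) hx v r
      rw [abs_sub_comm] at h4
      linarith
  set z₁ : L0 := AEEqFun.mk (fun s => z s + 1 * p s)
    (z.measurable.add (hpm.const_mul 1)).aestronglyMeasurable with hz₁
  set z₂ : L0 := AEEqFun.mk (fun s => z s + (-1) * p s)
    (z.measurable.add (hpm.const_mul (-1))).aestronglyMeasurable with hz₂
  have hc1 := AEEqFun.coeFn_mk (μ := leb) (fun s => z s + 1 * p s)
    (z.measurable.add (hpm.const_mul 1)).aestronglyMeasurable
  have hc2 := AEEqFun.coeFn_mk (μ := leb) (fun s => z s + (-1) * p s)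
    (z.measurable.add (hpm.const_mul (-1))).aestronglyMeasurable
  have hseg : z ∈ openSegment ℝ z₁ z₂ := by
    refine ⟨1 / 2, 1 / 2, by norm_num, by norm_num, by norm_num, ?_⟩
    refine AEEqFun.ext ?_
    filter_upwards [hc1, hc2, AEEqFun.coeFn_add ((1 / 2 : ℝ) • z₁) ((1 / 2 : ℝ) • z₂),
      AEEqFun.coeFn_smul (1 / 2 : ℝ) z₁, AEEqFun.coeFn_smul (1 / 2 : ℝ) z₂] with s h1 h2 h3 h4 h5
    rw [h3, Pi.add_apply, h4, h5, Pi.smul_apply, Pi.smul_apply, hz₁, hz₂, h1, h2]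
    simp only [smul_eq_mul]
    ring
  have heq := (mem_extremePoints_iff_left.1 hext).2 z₁ ((hmaj 1 (by simp)).mem_orbit hx0 hx) z₂
    ((hmaj (-1) (by simp)).mem_orbit hx0 hx) hseg
  have hzero : ∀ᵐ s ∂leb, s ∉ B := by
    filter_upwards [hc1] with s h1 hs
    rw [← hz₁, heq] at h1
    have : p s = 0 := by linarith
    have h2 := hpB' s hs
    rw [this, abs_zero] at h2
    linarith
  have : leb B = 0 := by
    rw [ae_iff] at hzero
    simpa using hzero
  exact (hsupp η hη0).ne' this

/-- Extreme points of the orbit of `x` have the same truncation integrals as `x`. -/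
theorem tailInt_eq_of_mem_extremePoints {x z : L0} (hx0 : 0 ≤ x) (hx : x.Integrable)
    (hext : z ∈ (orbit x).extremePoints ℝ) {r : ℝ} (hr : 0 ≤ r) : tailInt z r = tailInt x r := by
  have hz := majorized_of_mem_orbit hx0 (mem_extremePoints_iff_left.1 hext).1
  have hzi : Integrable z leb := hz.integrable
  have hxi : Integrable x leb := hx
  have hzle : ∀ r, 0 ≤ r → cutInt z r ≤ cutInt x r := by
    intro r hr
    have := hz.tailInt_le r hr
    rw [tailInt_eq_cutInt hz.nonneg hz.integrable, tailInt_eq_cutInt hx0 hx] at this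
    exact (ENNReal.ofReal_le_ofReal_iff (cutInt_nonneg r)).1 this
  have h00 : cutInt z 0 = cutInt x 0 := by
    have := hz.zero_eq
    rw [tailInt_eq_cutInt hz.nonneg hz.integrable, tailInt_eq_cutInt hx0 hx] at this
    exact (ENNReal.ofReal_eq_ofReal_iff (cutInt_nonneg 0) (cutInt_nonneg 0)).1 this
  have hcz := continuous_cutInt hzi
  have hcx := continuous_cutInt hxi
  set N : Set ℝ := {c | 0 < c ∧ cutInt z c < cutInt x c} with hN
  have hNo : IsOpen N := isOpen_Ioi.inter (isOpen_lt hcz hcx)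
  -- If the law of z charged N, some level in N would have neighbourhoods all of positive mass, and
  -- z could be perturbed there.
  have hzN : ∀ᵐ s ∂leb, z s ∉ N := by
    have h0 : (leb.map z) N = 0 := by
      by_contra hne
      obtain ⟨v, hvN, hv⟩ := exists_mem_forall_mem_nhdsWithin_pos_measure hne
      rw [hNo.nhdsWithin_eq hvN] at hv
      refine not_mem_extremePoints_of_gap hx0 hx hz hvN.1 hvN.2 (fun η hη => ?_) hext
      rw [← Measure.map_apply z.measurable measurableSet_Icc]
      exact hv _ (Icc_mem_nhds (by linarith) (by linarith))
    rw [Measure.map_apply z.measurable hNo.measurableSet] at h0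
    exact measure_eq_zero_iff_ae_notMem.1 h0
  rw [tailInt_eq_cutInt hz.nonneg hz.integrable, tailInt_eq_cutInt hx0 hx]
  congr 1
  by_contra hne
  have hlt : cutInt z r < cutInt x r := lt_of_le_of_ne (hzle r hr) hne
  have hcl : IsClosed {c | cutInt z c = cutInt x c} := isClosed_eq hcz hcx
  -- c₁ is the last contact level up to r. If there is a contact above, let c₂ be the first one: z
  -- takes almost no values strictly between, so its truncation integral is affine on [c₁, c₂]. That
  -- of x is convex with the same endpoint values, so it cannot exceed it at r.
  obtain ⟨c₁, hc₁⟩ := (isCompact_Icc.inter_right hcl).exists_isGreatest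
    (⟨0, ⟨le_rfl, hr⟩, h00⟩ : (Icc 0 r ∩ {c | cutInt z c = cutInt x c}).Nonempty)
  have h1 : cutInt z c₁ = cutInt x c₁ := hc₁.1.2
  have hc1r : c₁ < r := lt_of_le_of_ne hc₁.1.1.2 fun h => hne (h ▸ h1)
  have hgap1 : ∀ c, c₁ < c → c ≤ r → c ∈ N := by
    intro c hc hcr
    have hc0 : 0 < c := hc₁.1.1.1.trans_lt hc
    refine ⟨hc0, lt_of_le_of_ne (hzle c hc0.le) fun h => ?_⟩
    exact absurd (hc₁.2 ⟨⟨hc0.le, hcr⟩, h⟩) (not_le.2 hc)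
  by_cases hex : ∃ C, r ≤ C ∧ cutInt z C = cutInt x C
  · obtain ⟨C, hrC, hC⟩ := hex
    obtain ⟨c₂, hc₂⟩ := (isCompact_Icc.inter_right hcl).exists_isLeast
      (⟨C, ⟨hrC, le_rfl⟩, hC⟩ : (Icc r C ∩ {c | cutInt z c = cutInt x c}).Nonempty)
    have h2 : cutInt z c₂ = cutInt x c₂ := hc₂.1.2
    have hrc2 : r < c₂ := lt_of_le_of_ne hc₂.1.1.1 fun h => hne (h ▸ h2)
    have hgap2 : ∀ c, r ≤ c → c < c₂ → c ∈ N := by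
      intro c hc hcc
      have hc0 : 0 < c := (hc₁.1.1.1.trans_lt hc1r).trans_le hc
      refine ⟨hc0, lt_of_le_of_ne (hzle c hc0.le) fun h => ?_⟩
      exact absurd (hc₂.2 ⟨⟨hc, hcc.le.trans hc₂.1.1.2⟩, h⟩) (not_le.2 hcc)
    have hpos : 0 < c₂ - c₁ := by linarith
    set a := (c₂ - r) / (c₂ - c₁) with ha
    set b := (r - c₁) / (c₂ - c₁) with hb
    have ha0 : 0 ≤ a := div_nonneg (by linarith) hpos.le
    have hb0 : 0 ≤ b := div_nonneg (by linarith) hpos.le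
    have hab : a + b = 1 := by rw [ha, hb]; field_simp; ring
    have hr' : r = a * c₁ + b * c₂ := by rw [ha, hb]; field_simp; ring
    have haff : cutInt z r = a * cutInt z c₁ + b * cutInt z c₂ := by
      simp only [cutInt]
      rw [← integral_const_mul, ← integral_const_mul, ← integral_add
        ((integrable_cut hzi c₁).const_mul a) ((integrable_cut hzi c₂).const_mul b)]
      refine integral_congr_ae ?_
      filter_upwards [hzN] with s hs
      rcases le_or_gt (z s) c₁ with h | h
      · rw [max_eq_right (by linarith), max_eq_right (by linarith), max_eq_right (by linarith)]
        ring
      · have hz2 : c₂ ≤ z s := by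
          by_contra hc
          rcases le_total (z s) r with h' | h'
          · exact hs (hgap1 _ h h')
          · exact hs (hgap2 _ h' (not_le.1 hc))
        rw [max_eq_left (by linarith), max_eq_left (by linarith), max_eq_left (by linarith), hr']
        have : z s = a * z s + b * z s := by rw [← add_mul, hab, one_mul]
        linarith
    have hconv := cutInt_convex (x := x) hxi (c := c₁) (d := c₂) ha0 hb0 hab
    rw [← hr', ← h1, ← h2, ← haff] at hconv
    linarith
  -- Without a contact above r, almost all values of z are at most c₁. Both truncation integrals
  -- then vanish at c₁, hence that of x vanishes at r.
  · push Not at hex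
    have hz0 : cutInt z c₁ = 0 := by
      rw [cutInt]
      refine integral_eq_zero_of_ae ?_
      filter_upwards [hzN] with s hs
      refine max_eq_right ?_
      by_contra hc
      have hlt' : c₁ < z s := by linarith
      rcases le_total (z s) r with h' | h'
      · exact hs (hgap1 _ hlt' h')
      · have hc0 : 0 < z s := hc₁.1.1.1.trans_lt hlt'
        exact hs ⟨hc0, lt_of_le_of_ne (hzle _ hc0.le) (hex _ h')⟩
    have h3 := cutInt_anti hxi hc1r.le
    have h4 := cutInt_nonneg (x := z) r
    linarith

end FullySymm

/-! ### Lower bounds for convex combinations of extreme points. -/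

namespace FullySymm

/-- The measure of a level set is determined by the truncation integrals. -/
theorem leb_lt_le_of_cutInt_eq {x z : ℝ → ℝ} (hxm : Measurable x) (hzm : Measurable z)
    (hx : Integrable x leb) (hz : Integrable z leb)
    (h : ∀ r, 0 ≤ r → cutInt z r = cutInt x r) {c : ℝ} (hc : 0 ≤ c) :
    leb.real {s | c < z s} ≤ leb.real {s | c < x s} := by
  have hU : {s | c < z s} = ⋃ n : ℕ, {s | c + 1 / ((n : ℝ) + 1) < z s} := by
    ext w
    simp only [mem_ofPred_eq, mem_iUnion]
    constructor
    · intro hw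
      obtain ⟨n, hn⟩ := exists_nat_one_div_lt (sub_pos.2 hw)
      exact ⟨n, by linarith⟩
    · rintro ⟨n, hn⟩
      have : (0 : ℝ) < 1 / ((n : ℝ) + 1) := by positivity
      linarith
  have hm : Monotone fun n : ℕ => {s | c + 1 / ((n : ℝ) + 1) < z s} := by
    intro a b hab w hw
    have hw' : c + 1 / ((a : ℝ) + 1) < z w := hw
    have : 1 / ((b : ℝ) + 1) ≤ 1 / ((a : ℝ) + 1) := by
      apply one_div_le_one_div_of_le (by positivity)
      have : (a : ℝ) ≤ b := Nat.cast_le.2 hab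
      linarith
    change c + 1 / ((b : ℝ) + 1) < z w
    linarith
  refine ENNReal.toReal_mono (measure_ne_top _ _) ?_
  rw [hU, hm.measure_iUnion]
  refine iSup_le fun n => ?_
  -- The decrement of the common truncation integral over [c, c + ε] is at least ε times the measure
  -- of {z > c + ε} and at most ε times that of {x > c}.
  set ε : ℝ := 1 / ((n : ℝ) + 1) with hε
  have hε0 : 0 < ε := by positivity
  have h1 : ε * leb.real {s | c + ε < z s} ≤ cutInt z c - cutInt z (c + ε) := by
    rw [cutInt, cutInt, ← integral_sub (integrable_cut hz _) (integrable_cut hz _)]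
    have hms : MeasurableSet {s | c + ε < z s} := measurableSet_lt measurable_const hzm
    rw [mul_comm, ← smul_eq_mul, ← integral_indicator_const _ hms]
    refine integral_mono ((integrable_const _).indicator hms)
      ((integrable_cut hz _).sub (integrable_cut hz _)) fun s => ?_
    by_cases hs : c + ε < z s
    · simp only
      rw [indicator_of_mem (show s ∈ {s | c + ε < z s} from hs), max_eq_left (by linarith),
        max_eq_left (by linarith)]
      linarith
    · simp only
      rw [indicator_of_notMem (show s ∉ {s | c + ε < z s} from hs),
        max_eq_right (a := z s - (c + ε)) (by linarith), sub_zero]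
      exact le_max_right _ _
  have h2 : cutInt x c - cutInt x (c + ε) ≤ ε * leb.real {s | c < x s} := by
    rw [cutInt, cutInt, ← integral_sub (integrable_cut hx _) (integrable_cut hx _)]
    have hms : MeasurableSet {s | c < x s} := measurableSet_lt measurable_const hxm
    rw [mul_comm, ← smul_eq_mul, ← integral_indicator_const _ hms]
    refine integral_mono ((integrable_cut hx _).sub (integrable_cut hx _))
      ((integrable_const _).indicator hms) fun s => ?_
    by_cases hs : c < x s
    · simp only
      rw [indicator_of_mem (show s ∈ {s | c < x s} from hs), max_eq_left (by linarith)]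
      have := le_max_left (x s - (c + ε)) 0
      linarith
    · simp only
      rw [indicator_of_notMem (show s ∉ {s | c < x s} from hs), max_eq_right (by linarith),
        max_eq_right (by linarith), sub_zero]
  rw [h c hc, h (c + ε) (by linarith)] at h1
  have h3 := le_of_mul_le_mul_left (h1.trans h2) hε0
  exact (ENNReal.toReal_le_toReal (measure_ne_top _ _) (measure_ne_top _ _)).1 h3

/-- A convex combination of `n` functions equimeasurable with `x` is, up to a dilation by `n`,
as large as `x`. -/
theorem cutInt_mul_le_cutInt_sum {x : ℝ → ℝ} (hxm : Measurable x) (hx : Integrable x leb)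
    {ι : Type*} [Fintype ι] {w : ι → ℝ} {z : ι → ℝ → ℝ} (hw0 : ∀ i, 0 ≤ w i)
    (hw1 : ∑ i, w i = 1) (hzm : ∀ i, Measurable (z i)) (hz : ∀ i, Integrable (z i) leb)
    (hz0 : ∀ i, ∀ᵐ s ∂leb, 0 ≤ z i s) (h : ∀ i r, 0 ≤ r → cutInt (z i) r = cutInt x r)
    {r : ℝ} (hr : 0 ≤ r) :
    cutInt x (Fintype.card ι * r) ≤ cutInt (fun s => ∑ i, w i * z i s) r := by
  set n : ℝ := (Fintype.card ι : ℝ) with hn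
  have hnr : 0 ≤ n * r := mul_nonneg (Nat.cast_nonneg _) hr
  set S : ι → Set ℝ := fun i => {s | n * r < z i s} with hS
  have hSm : ∀ i, MeasurableSet (S i) := fun i => measurableSet_lt measurable_const (hzm i)
  set p := leb.real {s | n * r < x s} with hp
  have hSp : ∀ i, leb.real (S i) = p := fun i => le_antisymm
    (leb_lt_le_of_cutInt_eq hxm (hzm i) hx (hz i) (h i) hnr)
    (leb_lt_le_of_cutInt_eq (hzm i) hxm (hz i) hx (fun r hr => (h i r hr).symm) hnr)
  have hSint : ∀ i, ∫ s in S i, z i s ∂leb = cutInt x (n * r) + n * r * p := by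
    intro i
    have e : cutInt (z i) (n * r) = ∫ s in S i, (z i s - n * r) ∂leb := by
      rw [← integral_indicator (hSm i), cutInt]
      congr 1
      ext s
      by_cases hs : s ∈ S i
      · rw [indicator_of_mem hs]
        exact max_eq_left (sub_nonneg.2 (le_of_lt hs))
      · rw [indicator_of_notMem hs]
        exact max_eq_right (sub_nonpos.2 (not_lt.1 hs))
    rw [← h i _ hnr, e, integral_sub (hz i).integrableOn (integrable_const _)]
    simp only [integral_const, smul_eq_mul]
    rw [measureReal_restrict_apply_univ, hSp i]
    ring
  -- On U, of measure at most n p, the combination has integral at least that of a single z i over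
  -- its own S i, namely `cutInt x (n * r)` + n r p. Subtracting r times the measure of U cancels n
  -- r p.
  set U := ⋃ i, S i with hU
  have hUm : MeasurableSet U := MeasurableSet.iUnion hSm
  have hUle : leb.real U ≤ n * p := by
    refine (measureReal_iUnion_fintype_le S).trans ?_
    simp [hSp, hn]
  set Z : ℝ → ℝ := fun s => ∑ i, w i * z i s with hZ
  have hZi : Integrable Z leb := integrable_finsetSum _ fun i _ => (hz i).const_mul _
  have h1 : ∫ s in U, (Z s - r) ∂leb ≤ cutInt Z r := by
    refine le_trans (integral_mono (hZi.integrableOn.sub (integrable_const _))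
      (integrable_cut hZi r).integrableOn fun s => le_max_left _ _) ?_
    exact setIntegral_le_integral (integrable_cut hZi r)
      (Eventually.of_forall fun s => le_max_right _ _)
  have h2 : cutInt x (n * r) + n * r * p ≤ ∫ s in U, Z s ∂leb := by
    rw [hZ, integral_finsetSum _ fun i _ => ((hz i).const_mul _).integrableOn]
    calc cutInt x (n * r) + n * r * p = ∑ i, w i * (cutInt x (n * r) + n * r * p) := by
          rw [← Finset.sum_mul, hw1, one_mul]
      _ ≤ _ := by
          refine Finset.sum_le_sum fun i _ => ?_
          rw [integral_const_mul, ← hSint i]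
          refine mul_le_mul_of_nonneg_left ?_ (hw0 i)
          exact setIntegral_mono_set (hz i).integrableOn (ae_restrict_of_ae (hz0 i))
            (subset_iUnion S i).eventuallyLE
  rw [integral_sub hZi.integrableOn (integrable_const _)] at h1
  simp only [integral_const, smul_eq_mul, measureReal_restrict_apply_univ] at h1
  nlinarith [mul_le_mul_of_nonneg_left hUle hr]

theorem cutInt_eq_of_tailInt_eq {x z : L0} (hx0 : 0 ≤ x) (hx : x.Integrable) (hz0 : 0 ≤ z)
    (hz : z.Integrable) {r : ℝ} (h : tailInt z r = tailInt x r) : cutInt z r = cutInt x r := by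
  rw [tailInt_eq_cutInt hz0 hz, tailInt_eq_cutInt hx0 hx] at h
  exact (ENNReal.ofReal_eq_ofReal_iff (cutInt_nonneg r) (cutInt_nonneg r)).1 h

theorem convexHull_extremePoints_subset (x : L0) :
    convexHull ℝ ((orbit x).extremePoints ℝ) ⊆ orbit x :=
  convexHull_min extremePoints_subset (convex_orbit x)

/-- Here n is the number of points in a chosen representation of z. It is not bounded over the hull,
so the final estimate must lose n in a limit. -/
theorem exists_tailInt_mul_le {x z : L0} (hx0 : 0 ≤ x) (hx : x.Integrable)
    (hz : z ∈ convexHull ℝ ((orbit x).extremePoints ℝ)) :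
    ∃ n : ℕ, 0 < n ∧ ∀ r, 0 ≤ r → tailInt x (n * r) ≤ tailInt z r := by
  have hzM := majorized_of_mem_orbit hx0 (convexHull_extremePoints_subset x hz)
  rw [mem_convexHull_iff_exists_fintype] at hz
  obtain ⟨ι, _, w, u, hw0, hw1, hu, hsum⟩ := hz
  have hne : Nonempty ι := by
    by_contra hc
    rw [not_nonempty_iff] at hc
    simp at hw1
  refine ⟨Fintype.card ι, Fintype.card_pos, fun r hr => ?_⟩
  have huM : ∀ i, Majorized (u i) x := fun i =>
    majorized_of_mem_orbit hx0 (extremePoints_subset (hu i))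
  have hco : ∀ᵐ s ∂leb, z s = ∑ i, w i * u i s := by
    have hs1 : ∀ᵐ s ∂leb, ∀ i, (w i • u i) s = w i * u i s := by
      rw [ae_all_iff]
      intro i
      filter_upwards [AEEqFun.coeFn_smul (w i) (u i)] with s h1
      rw [h1, Pi.smul_apply, smul_eq_mul]
    filter_upwards [hs1, AEEqFun.coeFn_finsetSum Finset.univ fun i => w i • u i] with s h1 h2
    rw [← hsum, h2, Finset.sum_apply, Finset.sum_congr rfl fun i _ => h1 i]
  have key := cutInt_mul_le_cutInt_sum x.measurable hx hw0 hw1 (fun i => (u i).measurable)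
    (fun i => (huM i).integrable) (fun i => L0_nonneg_ae (huM i).nonneg)
    (fun i r hr => cutInt_eq_of_tailInt_eq hx0 hx (huM i).nonneg (huM i).integrable
      (tailInt_eq_of_mem_extremePoints hx0 hx (hu i) hr)) hr
  rw [tailInt_eq_cutInt hx0 hx, tailInt_eq_cutInt hzM.nonneg hzM.integrable]
  refine ENNReal.ofReal_le_ofReal (key.trans (le_of_eq ?_))
  exact integral_congr_ae (hco.mono fun s hs => by simp only [hs])

theorem headInt_mono (x : L0) {s t : ℝ} (h : s ≤ t) : headInt x s ≤ headInt x t :=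
  lintegral_mono_set (Ioo_subset_Ioo_right h)

theorem headInt_le_headInt_mul {x z : L0} {n : ℝ} (hn : 0 < n)
    (h : ∀ r, 0 ≤ r → tailInt x (n * r) ≤ tailInt z r) {t : ℝ} (ht : 0 < t) :
    headInt x t ≤ headInt z (n * t) := by
  obtain ⟨r, hr, e⟩ := exists_headInt_eq z (mul_pos hn ht)
  rw [e]
  refine (headInt_le x (r := n * r) (by positivity)).trans ?_
  rw [show n * r * t = r * (n * t) by ring]
  gcongr
  exact h r hr

/-- `∫₀ᵗ z* ≤ ∫₀ᵗ (z - c)* + c t`. -/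
theorem headInt_le_sub_const {z y : L0} {c : ℝ} (hc : 0 ≤ c)
    (hy : ∀ᵐ s ∂leb, |z s| ≤ |y s| + c) {t : ℝ} (ht : 0 < t) :
    headInt z t ≤ headInt y t + ENNReal.ofReal (c * t) := by
  obtain ⟨r, hr, e⟩ := exists_headInt_eq y ht
  rw [e]
  refine (headInt_le z (r := r + c) (by positivity)).trans ?_
  rw [add_mul, ENNReal.ofReal_add (by positivity) (by positivity), ← add_assoc]
  gcongr
  refine lintegral_mono_ae (hy.mono fun s hs => ENNReal.ofReal_le_ofReal ?_)
  linarith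

/-- `∫₀ᵗ (y + c)* ≥ ∫₀ᵗ y* + c t` for `t ≤ 1`. -/
theorem headInt_add_const_le {v y : L0} {c : ℝ} (hc : 0 ≤ c)
    (hy : ∀ᵐ s ∂leb, |v s| = |y s| + c) {t : ℝ} (ht : 0 < t) (ht1 : t ≤ 1) :
    headInt y t + ENNReal.ofReal (c * t) ≤ headInt v t := by
  obtain ⟨r, hr, e⟩ := exists_headInt_eq v ht
  have hv : ∀ r, tailInt v r = ∫⁻ s, ENNReal.ofReal (|y s| + c - r) ∂leb := fun r =>
    lintegral_congr_ae (hy.mono fun s hs => by simp only [hs])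
  rw [e, hv]
  rcases le_total c r with h | h
  · have h1 := headInt_le y (t := t) (sub_nonneg.2 h)
    refine (add_le_add_left h1 _).trans ?_
    rw [add_assoc, ← ENNReal.ofReal_add (mul_nonneg (sub_nonneg.2 h) ht.le) (by positivity),
      ← add_mul, sub_add_cancel]
    gcongr
    refine lintegral_mono fun s => ENNReal.ofReal_le_ofReal (by linarith)
  -- For r below c the truncation only lowers the added constant, and c t ≤ (c - r) + r t amounts to
  -- (c - r)(1 - t) ≥ 0; this is where t ≤ 1 enters.
  · have h1 := headInt_le y (t := t) (le_refl (0 : ℝ))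
    rw [zero_mul, ENNReal.ofReal_zero, add_zero] at h1
    have h2 : ∫⁻ s, ENNReal.ofReal (|y s| + c - r) ∂leb
        = tailInt y 0 + ENNReal.ofReal (c - r) := by
      rw [tailInt_zero, ← mul_one (ENNReal.ofReal (c - r)), ← leb_univ, ← lintegral_const,
        ← lintegral_add_right _ measurable_const]
      refine lintegral_congr fun s => ?_
      rw [← ENNReal.ofReal_add (abs_nonneg _) (sub_nonneg.2 h), add_sub_assoc]
    rw [h2, add_assoc, ← ENNReal.ofReal_add (sub_nonneg.2 h) (by positivity)]
    gcongr
    nlinarith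

/-! ### Rescaled dilations and mean values. -/

/-- `(1/τ) σ_τ x*`. -/
noncomputable def scaledDilation (τ : ℝ) (x : L0) : L0 :=
  (1 / τ) • dilation τ (rearrangement x)

theorem scaledDilation_ae (x : L0) {τ : ℝ} (hτ : 1 ≤ τ) :
    scaledDilation τ x =ᵐ[leb] fun s => 1 / τ * (Ioi 0).indicator (rearr x) (s / τ) := by
  have hτ0 : 0 < τ := zero_lt_one.trans_le hτ
  have h1 : ∀ᵐ u : ℝ, u ∈ Ioo (0 : ℝ) 1 → rearrangement x u = rearr x u :=
    (ae_restrict_iff' measurableSet_Ioo).1 (AEEqFun.coeFn_mk _ _)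
  have h2 : ∀ᵐ s : ℝ, s / τ ∈ Ioo (0 : ℝ) 1 → rearrangement x (s / τ) = rearr x (s / τ) := by
    rw [ae_iff] at h1 ⊢
    have := Real.volume_preimage_mul_right (inv_ne_zero hτ0.ne')
      {a | ¬ (a ∈ Ioo (0 : ℝ) 1 → rearrangement x a = rearr x a)}
    rw [h1, mul_zero] at this
    exact this
  filter_upwards [AEEqFun.coeFn_smul (1 / τ) (dilation τ (rearrangement x)),
    AEEqFun.coeFn_mk (μ := leb) _ (dilation_aux τ (rearrangement x)), ae_restrict_of_ae h2,
    ae_restrict_mem measurableSet_Ioo] with s h3 h4 h5 h6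
  rw [scaledDilation, h3, Pi.smul_apply, dilation, h4,
    indicator_of_mem (show s ∈ Iic (min 1 τ) from le_min h6.2.le (h6.2.le.trans hτ)),
    indicator_of_mem (show s / τ ∈ Ioi (0 : ℝ) from div_pos h6.1 hτ0), smul_eq_mul,
    h5 ⟨div_pos h6.1 hτ0, (div_lt_one hτ0).2 (h6.2.trans_le hτ)⟩]

/-- The rescaled dilation is again decreasing, so this is the substitution s ↦ s/τ. Monotonicity in
τ can be read off from it. -/
theorem headInt_scaledDilation {x : L0} (hx : x.Integrable) {τ : ℝ} (hτ : 1 ≤ τ) {t : ℝ}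
    (ht : 0 < t) (ht1 : t ≤ 1) : headInt (scaledDilation τ x) t = headInt x (t / τ) := by
  have hτ0 : 0 < τ := zero_lt_one.trans_le hτ
  have hD := decr_rearr hx
  have hg0 : ∀ s, 0 ≤ 1 / τ * (Ioi 0).indicator (rearr x) (s / τ) := fun s =>
    mul_nonneg (by positivity) (hD.nonneg _)
  have hgi : Integrable fun s => 1 / τ * (Ioi 0).indicator (rearr x) (s / τ) :=
    (hD.int.comp_div hτ0.ne').const_mul _
  rw [headInt_of_antitone (g := fun s => 1 / τ * (Ioi 0).indicator (rearr x) (s / τ)) ?_ hg0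
    (scaledDilation_ae x hτ) ht ht1, headInt_eq_ofReal hx (div_nonneg ht.le hτ0.le),
    ← ofReal_integral_eq_lintegral_ofReal hgi.integrableOn (Eventually.of_forall hg0),
    ← integral_Ioc_eq_integral_Ioo, ← intervalIntegral.integral_of_le ht.le,
    intervalIntegral.integral_const_mul, intervalIntegral.integral_comp_div _ hτ0.ne', zero_div,
    smul_eq_mul, ← mul_assoc, one_div, inv_mul_cancel₀ hτ0.ne', one_mul]
  intro a ha b hb hab
  have := hD.anti (mem_Ioi.2 (div_pos ha.1 hτ0)) (mem_Ioi.2 (div_pos hb.1 hτ0))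
    (div_le_div_of_nonneg_right hab hτ0.le)
  simp only
  gcongr

theorem integrable_of_headInt {y x : L0} (hx : x.Integrable) (h : headInt y 1 ≤ headInt x 1) :
    y.Integrable := by
  rw [integrable_iff_tailInt] at hx ⊢
  rw [headInt_one, headInt_one] at h
  exact ne_top_of_le_ne_top hx h

theorem integrable_scaledDilation {x : L0} (hx : x.Integrable) {τ : ℝ} (hτ : 1 ≤ τ) :
    (scaledDilation τ x).Integrable := by
  refine integrable_of_headInt hx ?_
  rw [headInt_scaledDilation hx hτ one_pos le_rfl]
  exact headInt_mono x ((div_le_one (zero_lt_one.trans_le hτ)).2 hτ)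

theorem scaledDilation_submajorized {x : L0} (hx : x.Integrable) {τ τ' : ℝ} (hτ : 1 ≤ τ)
    (h : τ ≤ τ') : Submajorized (scaledDilation τ' x) (scaledDilation τ x) := by
  refine submajorized_of_headInt fun t ht ht1 => ?_
  rw [headInt_scaledDilation hx hτ ht ht1, headInt_scaledDilation hx (hτ.trans h) ht ht1]
  exact headInt_mono x (div_le_div_of_nonneg_left ht.le (zero_lt_one.trans_le hτ) h)

theorem scaledDilation_one_submajorized {x : L0} (hx : x.Integrable) :
    Submajorized (scaledDilation 1 x) x := by
  refine submajorized_of_headInt fun t ht ht1 => ?_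
  rw [headInt_scaledDilation hx le_rfl ht ht1, div_one]

theorem tailInt_const {c : ℝ} (hc : 0 ≤ c) (r : ℝ) :
    tailInt (AEEqFun.const ℝ c) r = ENNReal.ofReal (c - r) := by
  rw [tailInt, lintegral_congr_ae (g := fun _ => ENNReal.ofReal (c - r)), lintegral_const,
    leb_univ, mul_one]
  filter_upwards [AEEqFun.coeFn_const (μ := leb) ℝ c] with s hs
  rw [hs, Function.const_apply, abs_of_nonneg hc]

theorem integrable_const_L0 (c : ℝ) : (AEEqFun.const ℝ c : L0).Integrable :=
  (integrable_congr (AEEqFun.coeFn_const ℝ c)).2 (integrable_const c)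

/-- This is `headInt_le` at t = 1, a form of Jensen's inequality. -/
theorem tailInt_mean_le {x : L0} (hx : x.Integrable) {r : ℝ} (hr : 0 ≤ r) :
    tailInt (AEEqFun.const ℝ (tailInt x 0).toReal) r ≤ tailInt x r := by
  rw [tailInt_const ENNReal.toReal_nonneg]
  refine ENNReal.ofReal_le_of_le_toReal ?_
  have h := (headInt_one x).symm.le.trans (headInt_le x (t := 1) hr)
  have h' := ENNReal.toReal_mono
    (ENNReal.add_ne_top.2 ⟨tailInt_ne_top hx hr, ENNReal.ofReal_ne_top⟩) h
  rw [ENNReal.toReal_add (tailInt_ne_top hx hr) ENNReal.ofReal_ne_top, mul_one,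
    ENNReal.toReal_ofReal hr] at h'
  linarith

theorem majorized_mean {x : L0} (hx : x.Integrable) :
    Majorized (AEEqFun.const ℝ (tailInt x 0).toReal) x := by
  refine ⟨?_, integrable_const_L0 _, ?_, fun r hr => tailInt_mean_le hx hr⟩
  · refine L0_nonneg_of_ae ?_
    filter_upwards [AEEqFun.coeFn_const (μ := leb) ℝ (tailInt x 0).toReal] with s hs
    rw [hs]; exact ENNReal.toReal_nonneg
  · rw [tailInt_const ENNReal.toReal_nonneg, sub_zero,
      ENNReal.ofReal_toReal (tailInt_ne_top hx le_rfl)]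

end FullySymm

/-! ### Norm estimates in the fully symmetric space. -/

namespace FullySymm

namespace SymmetricSpace

variable {E : SymmetricSpace}

theorem extNorm_of_mem {y : L0} (h : y ∈ E.carrier) :
    E.extNorm y = ENNReal.ofReal ‖(⟨y, h⟩ : E.carrier)‖ := dif_pos h

theorem extNorm_of_notMem {y : L0} (h : y ∉ E.carrier) : E.extNorm y = ⊤ := dif_neg h

theorem extNorm_ne_top {y : L0} (h : y ∈ E.carrier) : E.extNorm y ≠ ⊤ := by
  rw [extNorm_of_mem h]; exact ENNReal.ofReal_ne_top

theorem extNorm_smul {c : ℝ} (hc : 0 < c) (y : L0) :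
    E.extNorm (c • y) = ENNReal.ofReal c * E.extNorm y := by
  by_cases h : y ∈ E.carrier
  · rw [extNorm_of_mem h, extNorm_of_mem (E.carrier.smul_mem c h), ← ENNReal.ofReal_mul hc.le]
    congr 1
    have := norm_smul c (⟨y, h⟩ : E.carrier)
    rwa [Real.norm_of_nonneg hc.le] at this
  · rw [extNorm_of_notMem h, extNorm_of_notMem fun h' => h ?_, ENNReal.mul_top]
    · exact (ENNReal.ofReal_pos.2 hc).ne'
    · have := E.carrier.smul_mem c⁻¹ h'
      rwa [smul_smul, inv_mul_cancel₀ hc.ne', one_smul] at this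

theorem extNorm_add_le (y z : L0) : E.extNorm (y + z) ≤ E.extNorm y + E.extNorm z := by
  by_cases hy : y ∈ E.carrier
  · by_cases hz : z ∈ E.carrier
    · rw [extNorm_of_mem hy, extNorm_of_mem hz, extNorm_of_mem (E.carrier.add_mem hy hz),
        ← ENNReal.ofReal_add (norm_nonneg _) (norm_nonneg _)]
      exact ENNReal.ofReal_le_ofReal (norm_add_le (⟨y, hy⟩ : E.carrier) ⟨z, hz⟩)
    · rw [extNorm_of_notMem hz, add_top]; exact le_top
  · rw [extNorm_of_notMem hy, top_add]; exact le_top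

theorem extNorm_mono {y z : L0} (h : |y| ≤ |z|) : E.extNorm y ≤ E.extNorm z := by
  by_cases hz : z ∈ E.carrier
  · obtain ⟨hy, hle⟩ := E.solid ⟨z, hz⟩ y h
    rw [extNorm_of_mem hz, extNorm_of_mem hy]
    exact ENNReal.ofReal_le_ofReal hle
  · rw [extNorm_of_notMem hz]; exact le_top

theorem IsFullySymmetric.extNorm_le (hE : E.IsFullySymmetric) {y z : L0} (hy : y.Integrable)
    (h : Submajorized y z) : E.extNorm y ≤ E.extNorm z := by
  by_cases hz : z ∈ E.carrier
  · obtain ⟨hy, hle⟩ := hE ⟨z, hz⟩ y hy h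
    rw [extNorm_of_mem hz, extNorm_of_mem hy]
    exact ENNReal.ofReal_le_ofReal hle
  · rw [extNorm_of_notMem hz]; exact le_top

theorem IsFullySymmetric.mem (hE : E.IsFullySymmetric) {y z : L0} (hz : z ∈ E.carrier)
    (hy : y.Integrable) (h : Submajorized y z) : y ∈ E.carrier := (hE ⟨z, hz⟩ y hy h).1

theorem const_eq_smul (c : ℝ) : (AEEqFun.const ℝ c : L0) = c • AEEqFun.const ℝ (1 : ℝ) := by
  refine AEEqFun.ext ?_
  filter_upwards [AEEqFun.coeFn_const (μ := leb) ℝ c, AEEqFun.coeFn_const (μ := leb) ℝ (1 : ℝ),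
    AEEqFun.coeFn_smul c (AEEqFun.const ℝ (1 : ℝ) : L0)] with s h1 h2 h3
  rw [h1, h3, Pi.smul_apply, h2]
  simp

theorem const_ne_zero {c : ℝ} (hc : 0 < c) : (AEEqFun.const ℝ c : L0) ≠ 0 := by
  intro h
  have h1 := tailInt_const hc.le 0
  rw [h, tailInt_zero, lintegral_congr_ae (g := fun _ => 0)] at h1
  · simp only [lintegral_zero, sub_zero] at h1
    exact (ENNReal.ofReal_pos.2 hc).ne h1
  · filter_upwards [AEEqFun.coeFn_zero (μ := leb) (β := ℝ)] with s hs
    simp [hs]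

/-- A fully symmetric space on `(0,1)` consists of integrable functions. -/
theorem IsFullySymmetric.integrable (hE : E.IsFullySymmetric) {y : L0} (hy : y ∈ E.carrier) :
    y.Integrable := by
  by_contra hc
  rw [integrable_iff_tailInt, not_ne_iff] at hc
  -- A non-integrable y has infinite head integrals, so it submajorizes every constant; its norm
  -- would then bound n ‖1‖ for all n.
  have htop : ∀ t, 0 < t → headInt y t = ⊤ := by
    intro t ht
    obtain ⟨r, hr, e⟩ := exists_headInt_eq y ht
    have h1 := (headInt_one y).symm.le.trans (headInt_le y (t := 1) hr)
    rw [hc, top_le_iff, ENNReal.add_eq_top] at h1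
    rw [e, h1.resolve_right ENNReal.ofReal_ne_top, top_add]
  have hsub : ∀ c : ℝ, Submajorized (AEEqFun.const ℝ c) y := fun c =>
    submajorized_of_headInt fun t ht _ => by rw [htop t ht]; exact le_top
  obtain ⟨h1, -⟩ := hE ⟨y, hy⟩ _ (integrable_const_L0 1) (hsub 1)
  set e : E.carrier := ⟨AEEqFun.const ℝ (1 : ℝ), h1⟩ with he
  have hepos : 0 < ‖e‖ := norm_pos_iff.2 fun h0 =>
    const_ne_zero one_pos (congrArg Subtype.val h0)
  have hb : ∀ n : ℕ, (n : ℝ) * ‖e‖ ≤ ‖(⟨y, hy⟩ : E.carrier)‖ := by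
    intro n
    obtain ⟨hn, hle⟩ := hE ⟨y, hy⟩ _ (integrable_const_L0 n) (hsub n)
    have heq : (⟨_, hn⟩ : E.carrier) = (n : ℝ) • e := Subtype.ext (const_eq_smul (n : ℝ))
    have h2 : ‖(⟨_, hn⟩ : E.carrier)‖ ≤ ‖(⟨y, hy⟩ : E.carrier)‖ := hle
    rw [heq, norm_smul, Real.norm_natCast] at h2
    exact h2
  obtain ⟨n, hn⟩ := exists_nat_gt (‖(⟨y, hy⟩ : E.carrier)‖ / ‖e‖)
  rw [div_lt_iff₀ hepos] at hn
  exact absurd (hb n) (not_le.2 hn)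

theorem IsFullySymmetric.mean_mem (hE : E.IsFullySymmetric) {y : L0} (hy : y ∈ E.carrier) :
    (AEEqFun.const ℝ (tailInt y 0).toReal : L0) ∈ E.carrier :=
  hE.mem hy (integrable_const_L0 _)
    (submajorized_of_tailInt fun _ hr => tailInt_mean_le (hE.integrable hy) hr)

/-- The embedding of a fully symmetric space into `L₁` is continuous. -/
theorem IsFullySymmetric.exists_L1_bound (hE : E.IsFullySymmetric) :
    ∃ C : ℝ, ∀ y : E.carrier, tailInt (y : L0) 0 ≤ ENNReal.ofReal (C * ‖y‖) := by
  by_cases h1 : (AEEqFun.const ℝ (1 : ℝ) : L0) ∈ E.carrier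
  · set e : E.carrier := ⟨AEEqFun.const ℝ (1 : ℝ), h1⟩ with he
    have hepos : 0 < ‖e‖ := norm_pos_iff.2 fun h0 =>
      const_ne_zero one_pos (congrArg Subtype.val h0)
    refine ⟨‖e‖⁻¹, fun y => ?_⟩
    have hyi := hE.integrable y.2
    obtain ⟨hm, hle⟩ := hE y _ (integrable_const_L0 (tailInt (y : L0) 0).toReal)
      (submajorized_of_tailInt fun _ hr => tailInt_mean_le hyi hr)
    have heq : (⟨_, hm⟩ : E.carrier) = (tailInt (y : L0) 0).toReal • e :=
      Subtype.ext (const_eq_smul _)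
    have h2 : ‖(⟨_, hm⟩ : E.carrier)‖ ≤ ‖y‖ := hle
    rw [heq, norm_smul, Real.norm_of_nonneg ENNReal.toReal_nonneg] at h2
    rw [← ENNReal.ofReal_toReal (tailInt_ne_top hyi le_rfl)]
    refine ENNReal.ofReal_le_ofReal ?_
    rw [inv_mul_eq_div, le_div_iff₀ hepos]
    exact h2
  -- If E lacks the constant 1 then every mean of |y| is zero, as a nonzero one would be a constant
  -- of E that rescales to 1.
  · refine ⟨0, fun y => ?_⟩
    have hyi := hE.integrable y.2
    by_contra hc
    rw [zero_mul, ENNReal.ofReal_zero, not_le] at hc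
    have hpos : 0 < (tailInt (y : L0) 0).toReal :=
      ENNReal.toReal_pos hc.ne' (tailInt_ne_top hyi le_rfl)
    have := E.carrier.smul_mem (tailInt (y : L0) 0).toReal⁻¹ (hE.mean_mem y.2)
    rw [const_eq_smul, smul_smul, inv_mul_cancel₀ hpos.ne', one_smul] at this
    exact h1 this

theorem IsFullySymmetric.orbit_subset (hE : E.IsFullySymmetric) {x : L0} (hx0 : 0 ≤ x)
    (hx : x ∈ E.carrier) {y : L0} (hy : y ∈ orbit x) : y ∈ E.carrier :=
  hE.mem hx (majorized_of_mem_orbit hx0 hy).integrable (majorized_of_mem_orbit hx0 hy).submajorized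

/-- The convex hull stays in the convex orbit, convergence in E implies convergence in L₁, and the
orbit is closed there. -/
theorem IsFullySymmetric.Qprime_subset_orbit (hE : E.IsFullySymmetric) {x : L0}
    (hx : x ∈ E.carrier) : Qprime E x ⊆ orbit x := by
  rintro _ ⟨y, hy, rfl⟩
  rw [mem_closure_iff_seq_limit] at hy
  obtain ⟨w, hw, hlim⟩ := hy
  obtain ⟨C, hC⟩ := hE.exists_L1_bound
  refine mem_orbit_of_tendsto (hE.integrable hx) (hE.integrable y.2)
    (fun k => convexHull_extremePoints_subset x (hw k)) ?_
  have h1 : Tendsto (fun k => ENNReal.ofReal (C * ‖y - w k‖)) atTop (𝓝 0) := by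
    have h2 : Tendsto (fun k => ‖y - w k‖) atTop (𝓝 0) := by
      simpa using ((tendsto_const_nhds (x := y) (f := atTop)).sub hlim).norm
    have h3 := ENNReal.tendsto_ofReal (h2.const_mul C)
    simpa using h3
  refine tendsto_of_tendsto_of_tendsto_of_le_of_le tendsto_const_nhds h1 (fun _ => zero_le)
    fun k => ?_
  refine le_trans (le_of_eq ?_) (hC (y - w k))
  rw [tailInt_zero]
  refine lintegral_congr_ae ?_
  filter_upwards [AEEqFun.coeFn_sub (y : L0) (w k : L0)] with s hs
  change _ = ENNReal.ofReal |((y : L0) - (w k : L0) : L0) s|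
  rw [hs, Pi.sub_apply]

theorem extNorm_scaledDilation {τ : ℝ} (hτ : 0 < τ) (x : L0) :
    E.extNorm (scaledDilation τ x) =
      ENNReal.ofReal (1 / τ) * E.extNorm (dilation τ (rearrangement x)) :=
  extNorm_smul (one_div_pos.2 hτ) _

theorem IsFullySymmetric.extNorm_scaledDilation_anti (hE : E.IsFullySymmetric) {x : L0}
    (hx : x.Integrable) {τ τ' : ℝ} (hτ : 1 ≤ τ) (h : τ ≤ τ') :
    E.extNorm (scaledDilation τ' x) ≤ E.extNorm (scaledDilation τ x) :=
  hE.extNorm_le (integrable_scaledDilation hx (hτ.trans h)) (scaledDilation_submajorized hx hτ h)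

theorem IsFullySymmetric.exists_tendsto (hE : E.IsFullySymmetric) {x : L0}
    (hx : x ∈ E.carrier) :
    ∃ φ : ℝ≥0, Tendsto (fun τ : ℝ => E.extNorm (scaledDilation τ x)) atTop (𝓝 (φ : ℝ≥0∞)) := by
  have hxi := hE.integrable hx
  -- Freezing τ below 1 makes the function monotone on the whole line without affecting its limit.
  have hanti : Antitone fun τ : ℝ => E.extNorm (scaledDilation (max 1 τ) x) := fun a b hab =>
    hE.extNorm_scaledDilation_anti hxi (le_max_left _ _) (max_le_max le_rfl hab)
  have hlim := tendsto_atTop_iInf hanti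
  have hfin : ⨅ τ : ℝ, E.extNorm (scaledDilation (max 1 τ) x) ≠ ⊤ := by
    refine ne_top_of_le_ne_top (extNorm_ne_top hx) ((iInf_le _ 1).trans ?_)
    rw [max_self]
    exact hE.extNorm_le (integrable_scaledDilation hxi le_rfl) (scaledDilation_one_submajorized hxi)
  refine ⟨(⨅ τ : ℝ, E.extNorm (scaledDilation (max 1 τ) x)).toNNReal, ?_⟩
  rw [ENNReal.coe_toNNReal hfin]
  refine hlim.congr' ?_
  filter_upwards [eventually_ge_atTop 1] with τ hτ
  rw [max_eq_right hτ]

theorem IsFullySymmetric.extNorm_le_scaledDilation (hE : E.IsFullySymmetric) {x e : L0}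
    (hx : x.Integrable) {n : ℕ} (hn : 0 < n)
    (he : ∀ t, 0 < t → headInt e t ≤ headInt x (t / n)) :
    E.extNorm e ≤ E.extNorm (scaledDilation n x) := by
  have hn1 : (1 : ℝ) ≤ n := Nat.one_le_cast.2 hn
  refine hE.extNorm_le (integrable_of_headInt hx ((he 1 one_pos).trans
    (headInt_mono x ((div_le_one (by linarith)).2 hn1)))) ?_
  refine submajorized_of_headInt fun t ht ht1 => ?_
  rw [headInt_scaledDilation hx hn1 ht ht1]
  exact he t ht

theorem map_eq_of_tailInt_zero {x y : L0} (hx : tailInt x 0 = 0) (hy : tailInt y 0 = 0) :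
    leb.map y = leb.map x := by
  have h : ∀ w : L0, tailInt w 0 = 0 → w =ᵐ[leb] fun _ => 0 := by
    intro w hw
    rw [tailInt_zero, lintegral_eq_zero_iff w.measurable.abs.ennreal_ofReal] at hw
    filter_upwards [hw] with s hs
    simpa using hs
  exact Measure.map_congr ((h y hy).trans (h x hx).symm)

theorem IsFullySymmetric.orbit_subset_Qprime (hE : E.IsFullySymmetric) {x : L0} (hx0 : 0 ≤ x)
    (hx : x ∈ E.carrier)
    (hφ : Tendsto (fun τ : ℝ => E.extNorm (scaledDilation τ x)) atTop (𝓝 0)) :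
    orbit x ⊆ Qprime E x := by
  intro y hy
  have hxi := hE.integrable hx
  have hyE := hE.orbit_subset hx0 hx hy
  have hyM := majorized_of_mem_orbit hx0 hy
  have hsub : {z : L0 | leb.map z = leb.map x} ⊆ (orbit x).extremePoints ℝ := fun z hz =>
    mem_extremePoints_of_map_eq hx0 hxi hz
  refine ⟨⟨y, hyE⟩, ?_, rfl⟩
  by_cases hx00 : tailInt x 0 = 0
  -- For x = 0 there may be no positive constant in E to absorb δ, but then y = 0 is itself extreme.
  · refine subset_closure (subset_convexHull ℝ _ (hsub ?_))
    exact map_eq_of_tailInt_zero hx00 (hyM.zero_eq.trans hx00)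
  have hm : 0 < (tailInt x 0).toReal := ENNReal.toReal_pos hx00 (tailInt_ne_top hxi le_rfl)
  set c := (tailInt x 0).toReal with hc
  have hcE : (AEEqFun.const ℝ c : L0) ∈ E.carrier := hE.mean_mem hx
  rw [Metric.mem_closure_iff]
  intro ε hε
  have hε' : 0 < ENNReal.ofReal (ε / 4) := ENNReal.ofReal_pos.2 (by positivity)
  obtain ⟨n, hn0, hn⟩ : ∃ n : ℕ, 0 < n ∧ E.extNorm (scaledDilation n x) < ENNReal.ofReal (ε / 4) :=
    ((eventually_gt_atTop 0).and
      ((hφ.comp tendsto_natCast_atTop_atTop).eventually (gt_mem_nhds hε'))).exists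
  set K := ‖(⟨_, hcE⟩ : E.carrier)‖ with hK
  have hK0 : 0 ≤ K := norm_nonneg _
  -- δ is taken as a multiple of the mean of x, a constant known to lie in E; a makes its norm at
  -- most ε/4. Each of e and d contributes another ε/4.
  set a : ℝ := ε / 4 / (K + 1) with ha
  have ha0 : 0 < a := by positivity
  obtain ⟨w, e, d, hw, he0, hd0, he, hd, hb⟩ := hyM.exists_convexHull hx0 hxi hn0
    (δ := a * c) (by positivity)
  have hw' : w ∈ convexHull ℝ ((orbit x).extremePoints ℝ) := convexHull_mono hsub hw
  have hwE : w ∈ E.carrier := hE.orbit_subset hx0 hx (convexHull_extremePoints_subset x hw')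
  refine ⟨⟨w, hwE⟩, hw', ?_⟩
  have hle : |y - w| ≤ |a • AEEqFun.const ℝ c + e + d| := by
    rw [← AEEqFun.coeFn_le]
    filter_upwards [hb, AEEqFun.coeFn_abs (y - w), AEEqFun.coeFn_sub y w,
      AEEqFun.coeFn_abs (a • AEEqFun.const ℝ c + e + d : L0),
      AEEqFun.coeFn_add (a • AEEqFun.const ℝ c + e : L0) d,
      AEEqFun.coeFn_add (a • AEEqFun.const ℝ c : L0) e,
      AEEqFun.coeFn_smul a (AEEqFun.const ℝ c : L0), AEEqFun.coeFn_const (μ := leb) ℝ c]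
      with s h1 h2 h3 h4 h5 h6 h7 h8
    rw [h2, h3, h4, h5, Pi.add_apply, h6, Pi.add_apply, h7, Pi.smul_apply, h8]
    exact h1.trans (le_abs_self _)
  have hdist : ENNReal.ofReal (dist (⟨y, hyE⟩ : E.carrier) ⟨w, hwE⟩) = E.extNorm (y - w) := by
    rw [dist_eq_norm, extNorm_of_mem (E.carrier.sub_mem hyE hwE)]
    rfl
  have ha1 : E.extNorm (a • AEEqFun.const ℝ c) ≤ ENNReal.ofReal (ε / 4) := by
    rw [extNorm_smul ha0, extNorm_of_mem hcE, ← ENNReal.ofReal_mul ha0.le]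
    refine ENNReal.ofReal_le_ofReal ?_
    rw [← hK, ha, div_mul_eq_mul_div, div_le_iff₀ (by positivity)]
    nlinarith
  have hfin : ENNReal.ofReal (dist (⟨y, hyE⟩ : E.carrier) ⟨w, hwE⟩) ≤
      ENNReal.ofReal (ε / 4) + ENNReal.ofReal (ε / 4) + ENNReal.ofReal (ε / 4) := by
    rw [hdist]
    refine (extNorm_mono hle).trans ((extNorm_add_le _ _).trans ?_)
    refine add_le_add ((extNorm_add_le _ _).trans (add_le_add ha1 ?_)) ?_
    · exact (hE.extNorm_le_scaledDilation hxi hn0 he).trans hn.le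
    · exact (hE.extNorm_le_scaledDilation hxi hn0 hd).trans hn.le
  rw [← ENNReal.ofReal_add (by positivity) (by positivity),
    ← ENNReal.ofReal_add (by positivity) (by positivity),
    ENNReal.ofReal_le_ofReal_iff (by positivity)] at hfin
  linarith

theorem IsFullySymmetric.le_extNorm_sub (hE : E.IsFullySymmetric) {x : L0} (hx0 : 0 ≤ x)
    (hx : x ∈ E.carrier) {φ : ℝ≥0∞}
    (hφ : Tendsto (fun τ : ℝ => E.extNorm (scaledDilation τ x)) atTop (𝓝 φ)) {z : L0}
    (hz : z ∈ convexHull ℝ ((orbit x).extremePoints ℝ)) {c : ℝ} (hc : 0 ≤ c)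
    (hcE : (AEEqFun.const ℝ c : L0) ∈ E.carrier) :
    φ ≤ E.extNorm (z - AEEqFun.const ℝ c) := by
  have hxi := hE.integrable hx
  obtain ⟨n, hn, hnt⟩ := exists_tailInt_mul_le hx0 hxi hz
  have hn' : (0 : ℝ) < n := Nat.cast_pos.2 hn
  set y : L0 := z - AEEqFun.const ℝ c with hy
  have hzy : ∀ᵐ s ∂leb, |z s| ≤ |y s| + c := by
    filter_upwards [AEEqFun.coeFn_sub z (AEEqFun.const ℝ c), AEEqFun.coeFn_const (μ := leb) ℝ c]
      with s h1 h2
    rw [hy, h1, Pi.sub_apply, h2]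
    have := abs_add_le (z s - c) c
    rw [sub_add_cancel, abs_of_nonneg hc] at this
    exact this
  have hbound : ∀ τ : ℝ, (n : ℝ) ≤ τ → E.extNorm (scaledDilation τ x) ≤
      E.extNorm y + ENNReal.ofReal (n / τ) * E.extNorm (AEEqFun.const ℝ c) := by
    intro τ hτ
    have hτ0 : 0 < τ := hn'.trans_le hτ
    have hτ1 : 1 ≤ τ := (Nat.one_le_cast.2 hn).trans hτ
    have hκ : 0 < n / τ := div_pos hn' hτ0
    have hκ1 : n / τ ≤ 1 := (div_le_one hτ0).2 hτ
    rw [← extNorm_smul hκ]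
    set v : L0 := |y| + (n / τ) • AEEqFun.const ℝ c with hv
    have hvy : ∀ᵐ s ∂leb, |v s| = |y s| + n / τ * c := by
      filter_upwards [AEEqFun.coeFn_add |y| ((n / τ) • AEEqFun.const ℝ c), AEEqFun.coeFn_abs y,
        AEEqFun.coeFn_smul (n / τ) (AEEqFun.const ℝ c : L0),
        AEEqFun.coeFn_const (μ := leb) ℝ c] with s h1 h2 h3 h4
      rw [hv, h1, Pi.add_apply, h2, h3, Pi.smul_apply, h4, Function.const_apply, smul_eq_mul]
      exact abs_of_nonneg (by positivity)
    -- The factor n dilates t/τ to n t/τ ≤ t, so the head integral of y needs no factor. The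
    -- constant c is paid for only on length n t/τ, hence with weight n/τ, which tends to 0.
    have hsub : Submajorized (scaledDilation τ x) v := by
      refine submajorized_of_headInt fun t ht ht1 => ?_
      rw [headInt_scaledDilation hxi hτ1 ht ht1]
      have htt : n * (t / τ) = n / τ * t := by ring
      calc headInt x (t / τ) ≤ headInt z (n * (t / τ)) :=
            headInt_le_headInt_mul hn' hnt (div_pos ht hτ0)
        _ ≤ headInt y (n * (t / τ)) + ENNReal.ofReal (c * (n * (t / τ))) :=
            headInt_le_sub_const hc hzy (mul_pos hn' (div_pos ht hτ0))
        _ ≤ headInt y t + ENNReal.ofReal (n / τ * c * t) := by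
            rw [htt, show c * (n / τ * t) = n / τ * c * t by ring]
            exact add_le_add (headInt_mono y (mul_le_of_le_one_left ht.le hκ1)) le_rfl
        _ ≤ headInt v t := headInt_add_const_le (by positivity) hvy ht ht1
    refine (hE.extNorm_le (integrable_scaledDilation hxi hτ1) hsub).trans
      ((extNorm_add_le _ _).trans ?_)
    refine add_le_add (extNorm_mono ?_) le_rfl
    rw [← AEEqFun.coeFn_le]
    filter_upwards [AEEqFun.coeFn_abs |y|, AEEqFun.coeFn_abs y] with s h1 h2
    rw [h1, h2, abs_abs]
  have hlim : Tendsto (fun τ : ℝ => E.extNorm y +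
      ENNReal.ofReal (n / τ) * E.extNorm (AEEqFun.const ℝ c)) atTop (𝓝 (E.extNorm y + 0)) := by
    refine tendsto_const_nhds.add ?_
    have h1 : Tendsto (fun τ : ℝ => ENNReal.ofReal (n / τ)) atTop (𝓝 0) := by
      have := ENNReal.tendsto_ofReal (tendsto_const_nhds.div_atTop tendsto_id (a := (n : ℝ)))
      simpa using this
    simpa using ENNReal.Tendsto.mul_const h1 (Or.inr (extNorm_ne_top hcE))
  rw [add_zero] at hlim
  exact le_of_tendsto_of_tendsto hφ hlim ((eventually_ge_atTop (n : ℝ)).mono hbound)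

/-- The mean of x is the test point: it lies in the orbit, at distance at least φ from every element
of the convex hull of the extreme points. -/
theorem IsFullySymmetric.eq_zero_of_orbit_eq (hE : E.IsFullySymmetric) {x : L0} (hx0 : 0 ≤ x)
    (hx : x ∈ E.carrier) {φ : ℝ≥0}
    (hφ : Tendsto (fun τ : ℝ => E.extNorm (scaledDilation τ x)) atTop (𝓝 (φ : ℝ≥0∞)))
    (h : orbit x ⊆ Qprime E x) : φ = 0 := by
  have hxi := hE.integrable hx
  obtain ⟨y, hy, hyc⟩ := h ((majorized_mean hxi).mem_orbit hx0 hxi)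
  by_contra hne
  rw [Metric.mem_closure_iff] at hy
  obtain ⟨z, hz, hzd⟩ := hy φ (NNReal.coe_pos.2 (pos_iff_ne_zero.2 hne))
  have hcE : (AEEqFun.const ℝ (tailInt x 0).toReal : L0) ∈ E.carrier := hE.mean_mem hx
  have key := hE.le_extNorm_sub hx0 hx hφ hz ENNReal.toReal_nonneg hcE
  rw [← hyc, extNorm_of_mem (E.carrier.sub_mem z.2 y.2), ← ENNReal.ofReal_coe_nnreal,
    ENNReal.ofReal_le_ofReal_iff (norm_nonneg _)] at key
  rw [dist_comm, dist_eq_norm] at hzd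
  exact absurd key (not_le.2 hzd)

end SymmetricSpace

end FullySymm

/-- The limit `φ(x) = lim (1/τ) ‖σ_τ(x*)‖_E` exists and is finite, and `Ω'(x) = Q'(x)` if and only
if `φ(x) = 0`. -/
theorem mainTheorem1 (E : FullySymm.SymmetricSpace) (hE : E.IsFullySymmetric)
    (x : FullySymm.L0) (hxE : x ∈ E.carrier) (hx : 0 ≤ x) :
    ∃ φ : ℝ≥0,
      Tendsto (fun τ : ℝ => ENNReal.ofReal (1 / τ) *
        E.extNorm (FullySymm.dilation τ (FullySymm.rearrangement x))) atTop (𝓝 (φ : ℝ≥0∞)) ∧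
      (FullySymm.orbit x = FullySymm.Qprime E x ↔ φ = 0) := by
  obtain ⟨φ, hφ⟩ := hE.exists_tendsto hxE
  refine ⟨φ, hφ.congr' ?_, fun h => hE.eq_zero_of_orbit_eq hx hxE hφ h.le, fun h => ?_⟩
  · filter_upwards [eventually_gt_atTop 0] with τ hτ
    exact FullySymm.SymmetricSpace.extNorm_scaledDilation hτ x
  · rw [h, ENNReal.coe_zero] at hφ
    exact (hE.orbit_subset_Qprime hx hxE hφ).antisymm (hE.Qprime_subset_orbit hxE)
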